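/- Let $n\ge 0$ be an integer, let $\gamma$ be the standard Gaussian measure on $\mathbb{R}^n$, and let $\lambda>0$. Let $d\nu=f\,d\gamma$ be a probability measure on $\mathbb{R}^n$, where $f\ge 0$ is locally integrable and has a locally integrable weak gradient $\nabla f$. Assume that - $\nu$ is centered: $\int |x|\,d\nu<\infty$ and $\int x\,d\nu=0$; - $\nu$ belongs to the class $\mathcal{P}(\lambda)$: for every smooth $\nu$-integrable $g:\mathbb{R}^n\to\mathbb{R}$ with $\int g\,d\nu=0$ one has $\lambda\int g^2\,d\nu\le\int|\nabla g|^2\,d\nu$ (in $[0,\infty]$); - the Fisher information ${\rm I}(\nu)=\int\frac{|\nabla f|^2}{f}\,d\gamma$ is finite (the integrand is read as $0$ where $f=0$). Then the relative entropy ${\rm H}(\nu)=\int f\log f\,d\gamma$ is finite, the quadratic Kantorovich–Wasserstein distance $${\rm W}_2(\nu,\gamma)=\inf_{\pi}\Big(\iint|x-y|^2\,d\pi(x,y)\Big)^{1/2}$$ (infimum over all couplings $\pi$ of $\nu$ and $\gamma$) is finite, and the logarithmic Sobolev deficit $\delta_{\rm LSI}(\nu)=\frac12\,{\rm I}(\nu)-{\rm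 H}(\nu)$ satisfies $$\delta_{\rm LSI}(\nu)\;\ge\; c_2(\lambda)\,{\rm W}_2(\nu,\gamma)^2,$$ where $$c_2(\lambda)=\frac12\Big(\frac1{c(\lambda)}-1\Big),\qquad c(\lambda)=\frac{1-\lambda+\lambda\log\lambda}{(1-\lambda)^2}\ \ (\lambda\ne1),\qquad c(1)=\frac12 .$$ -/

import Mathlib

open MeasureTheory ProbabilityTheory
open scoped ENNReal ContDiff

noncomputable section

namespace LSIStability

/-- `ℝⁿ` with its Euclidean norm. -/
abbrev E (n : ℕ) : Type := EuclideanSpace ℝ (Fin n)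

/-- The standard Gaussian measure `γ` on `ℝⁿ`. -/
abbrev gauss (n : ℕ) : Measure (E n) := stdGaussian (E n)

/-- `G` is the weak gradient of `f` on `ℝⁿ`: both are locally integrable and
`∫ f ∂ᵥφ dx = - ∫ ⟨G, v⟩ φ dx` for every test function `φ ∈ C_c^∞(ℝⁿ)` and every direction `v`. -/
structure HasWeakGradient {n : ℕ} (f : E n → ℝ) (G : E n → E n) : Prop where
  locallyIntegrable : LocallyIntegrable f volume
  locallyIntegrable_grad : LocallyIntegrable G volume
  integral_eq : ∀ φ : E n → ℝ, ContDiff ℝ ∞ φ → HasCompactSupport φ → ∀ v : E n,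
    ∫ x, f x * fderiv ℝ φ x v = - ∫ x, inner ℝ (G x) v * φ x

/-- The class `P(l)`: `ν` satisfies a Poincaré inequality with constant `l`, that is
`l ∫ g² dν ≤ ∫ |∇g|² dν` in `[0, ∞]` for every smooth `ν`-integrable `g` with `∫ g dν = 0`. -/
def SatisfiesPoincare {n : ℕ} (ν : Measure (E n)) (l : ℝ) : Prop :=
  ∀ g : E n → ℝ, ContDiff ℝ ∞ g → Integrable g ν → ∫ x, g x ∂ν = 0 →
    ENNReal.ofReal l * ∫⁻ x, ENNReal.ofReal (g x ^ 2) ∂ν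
      ≤ ∫⁻ x, ENNReal.ofReal (‖gradient g x‖ ^ 2) ∂ν

/-- `ν` has a first moment and its barycenter is the origin. -/
def IsCentered {n : ℕ} (ν : Measure (E n)) : Prop :=
  Integrable (fun x : E n => x) ν ∧ ∫ x, x ∂ν = 0

/-- The entropy `H(ν) = ∫ f log f dγ` of `ν = f γ` relative to `γ`. -/
def entropy {n : ℕ} (f : E n → ℝ) : ℝ :=
  ∫ x, f x * Real.log (f x) ∂(gauss n)

/-- The Fisher information `I(ν) = ∫ |∇f|² / f dγ` of `ν = f γ` relative to `γ`, where `G = ∇f`.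
A weak gradient vanishes almost everywhere on `{f = 0}`, where the integrand is read as `0`. -/
def fisherInfo {n : ℕ} (f : E n → ℝ) (G : E n → E n) : ℝ :=
  ∫ x, ‖G x‖ ^ 2 / f x ∂(gauss n)

/-- The logarithmic Sobolev deficit `δ_LSI(ν) = I(ν) / 2 - H(ν)` of `ν = f γ`, where `G = ∇f`. -/
def lsiDeficit {n : ℕ} (f : E n → ℝ) (G : E n → E n) : ℝ :=
  1 / 2 * fisherInfo f G - entropy f

/-- `π` is a coupling of `ν` and `μ`. -/
def IsCoupling {n : ℕ} (π : Measure (E n × E n)) (ν μ : Measure (E n)) : Prop :=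
  π.map Prod.fst = ν ∧ π.map Prod.snd = μ

/-- The quadratic Kantorovich–Wasserstein distance, with values in `[0, ∞]`. -/
def W2 {n : ℕ} (ν μ : Measure (E n)) : ℝ≥0∞ :=
  ⨅ (π : Measure (E n × E n)) (_ : IsCoupling π ν μ),
    (∫⁻ p, ENNReal.ofReal (‖p.1 - p.2‖ ^ 2) ∂π) ^ (1 / 2 : ℝ)

/-- `c(l) = (1 - l + l log l) / (1 - l)²`, with `c(1) = 1/2`. -/
def cConst (l : ℝ) : ℝ :=
  if l = 1 then 1 / 2 else (1 - l + l * Real.log l) / (1 - l) ^ 2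

/-- `c₂(l) = (1 / c(l) - 1) / 2`. -/
def c2Const (l : ℝ) : ℝ :=
  1 / 2 * (1 / cConst l - 1)

end LSIStability

end

open MeasureTheory ProbabilityTheory
open scoped ENNReal ContDiff

noncomputable section

namespace LSIStability

set_option linter.unusedSectionVars false

open Filter Topology Set Module

/-! Along the Ornstein-Uhlenbeck flow the Poincaré inequality of `ν` improves the logarithmic
Sobolev inequality to `H(ν) ≤ (c(λ)/2) I(ν)`. Talagrand's inequality `W₂(ν,γ)² ≤ 2 H(ν)` then turns
the gain into stability: as `0 < c(λ) ≤ 1`, one has `I/2 - H ≥ (1/c - 1) H ≥ (1/2)(1/c - 1) W₂²`.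

The gain is a contraction of the Fisher information (`fisher_contraction`). Let `P_ρ` be the Mehler
operator and `D` a partial derivative of `f`, so that the same derivative of `P_ρ f` is `ρ P_ρ D`.
With `m = P_ρ D / P_ρ f`, symmetry of `P_ρ` gives `∫ (P_ρ D)² / P_ρ f dγ = ∫ D · P_ρ m dγ`. Since
`ν` is centered, `∫ D dγ = 0`, so `P_ρ m` may be replaced by its deviation from its `ν`-mean, and
Cauchy-Schwarz leaves the variance of `P_ρ m` under `ν`. That variance is bounded by the Poincaré
inequality together with the reverse local Poincaré inequality for `P_ρ` (`variance_mehler_le`). The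
outcome is the factor `κ = ρ² / (ρ² + λ(1 - ρ²))`.

With `u = ρ²`, integrating the dissipation of entropy along the flow gives `H ≤ (I/2) ∫₀¹ u / (u +
λ(1 - u)) du`, and this integral is `c(λ)`. The entropy is never differentiated in time: the local
logarithmic Sobolev inequality (`entropy_le_entropy_mehler_add`) bounds its loss over one step of
the semigroup, and along a geometric sequence of correlations these losses add up to at most a lower
Riemann sum (`entropy_mehler_le_of_poincare`).

The Gaussian inequalities themselves come from the line, where monotone rearrangement proves both.
Talagrand's inequality tensorizes through fibrewise quantile maps and the chain rule for entropy
(`talagrand_pi`), the logarithmic Sobolev inequality through subadditivity of entropy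
(`logSobolev_pi`).

Low regularity is handled by working with `P_ρ f`, which is positive, continuous and has partial
derivatives, and by letting `ρ → 1` with Fatou's lemma. The Poincaré inequality for linear functions
supplies second moments, which make the entropy of `P_ρ f` finite before that of `f` is known to be.
The vanishing of `∇f` almost everywhere on `{f = 0}` makes the convention for the Fisher integrand
harmless. -/

lemma exists_seq_tendsto_one : ∃ r : ℕ → ℝ, (∀ k, 0 < r k) ∧ (∀ k, r k < 1) ∧ (∀ k, 1 / 2 ≤ r k) ∧
    Tendsto r atTop (𝓝 1) := by
  have hb : ∀ k : ℕ, (1 : ℝ) / ((k : ℝ) + 1 + 1) ≤ 1 / 2 := fun k => by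
    apply one_div_le_one_div_of_le <;> linarith [k.cast_nonneg (α := ℝ)]
  refine ⟨fun k => 1 - 1 / ((k : ℝ) + 1 + 1), fun k => ?_, fun k => ?_, fun k => ?_, ?_⟩
  · linarith [hb k]
  · have : 0 < 1 / ((k : ℝ) + 1 + 1) := by positivity
    linarith
  · linarith [hb k]
  · have := (tendsto_add_atTop_iff_nat 1).2 (tendsto_one_div_add_atTop_nhds_zero_nat (𝕜 := ℝ))
    simpa using this.const_sub 1

/-! ### Gaussian kernels and differentiation under the integral. -/

section Mehler

variable {V : Type*} [NormedAddCommGroup V] [InnerProductSpace ℝ V] [FiniteDimensional ℝ V]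
  [MeasurableSpace V] [BorelSpace V]

/-- The density of the centered Gaussian measure of covariance `s` times the identity. -/
def gaussKer (s : ℝ) (w : V) : ℝ :=
  (2 * Real.pi * s) ^ (-(finrank ℝ V : ℝ) / 2) * Real.exp (-‖w‖ ^ 2 / (2 * s))

lemma gaussKer_pos {s : ℝ} (hs : 0 < s) (w : V) : 0 < gaussKer s w := by
  unfold gaussKer; positivity

lemma contDiff_gaussKer (s : ℝ) : ContDiff ℝ ∞ (gaussKer s : V → ℝ) := by
  unfold gaussKer
  exact contDiff_const.mul ((((contDiff_norm_sq ℝ).neg).div_const _).exp)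

@[fun_prop]
lemma continuous_gaussKer (s : ℝ) : Continuous (gaussKer s : V → ℝ) :=
  (contDiff_gaussKer s).continuous

lemma integrable_gaussKer {s : ℝ} (hs : 0 < s) : Integrable (gaussKer s : V → ℝ) := by
  have h := (GaussianFourier.integrable_cexp_neg_mul_sq_norm_add (V := V)
    (b := ((1 / (2 * s) : ℝ) : ℂ)) (by rw [Complex.ofReal_re]; positivity) 0 0).norm
  refine (h.const_mul ((2 * Real.pi * s) ^ (-(finrank ℝ V : ℝ) / 2))).congr (ae_of_all _ fun w => ?_)
  simp only [gaussKer]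
  congr 1
  rw [Complex.norm_exp]
  congr 1
  simp [← Complex.ofReal_pow]
  ring

lemma stdGaussian_eq_withDensity :
    stdGaussian V = volume.withDensity (fun w => ENNReal.ofReal (gaussKer 1 w)) := by
  have hfin : IsFiniteMeasure (volume.withDensity (fun w : V => ENNReal.ofReal (gaussKer 1 w))) :=
    isFiniteMeasure_withDensity_ofReal (integrable_gaussKer one_pos).2
  apply Measure.ext_of_charFun
  ext t
  rw [charFun_stdGaussian, charFun_apply, integral_withDensity_eq_integral_toReal_smul
    (by fun_prop) (by simp)]
  have h := GaussianFourier.integral_cexp_neg_mul_sq_norm_add (V := V)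
    (b := (1 / 2 : ℂ)) (by norm_num) Complex.I t
  have e : ∀ w : V, (ENNReal.ofReal (gaussKer 1 w)).toReal • Complex.exp (inner ℝ w t * Complex.I)
      = (((2 * Real.pi) ^ (-(finrank ℝ V : ℝ) / 2) : ℝ) : ℂ)
        * Complex.exp (-(1 / 2 : ℂ) * ‖w‖ ^ 2 + Complex.I * inner ℝ t w) := by
    intro w
    rw [ENNReal.toReal_ofReal (gaussKer_pos one_pos w).le, gaussKer, Complex.real_smul]
    push_cast
    rw [mul_one, mul_assoc, ← Complex.exp_add, real_inner_comm]
    congr 2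
    ring
  simp_rw [e]
  rw [integral_const_mul, h, ← mul_assoc]
  have : ((Real.pi : ℂ) / (1 / 2)) ^ ((finrank ℝ V : ℂ) / 2)
      = (((2 * Real.pi) ^ ((finrank ℝ V : ℝ) / 2) : ℝ) : ℂ) := by
    rw [Complex.ofReal_cpow (by positivity)]
    push_cast
    congr 1
    ring
  rw [this, ← Complex.ofReal_mul, ← Real.rpow_add (by positivity), show -(finrank ℝ V : ℝ) / 2 + (finrank ℝ V : ℝ) / 2 = 0 by ring,
    Real.rpow_zero, Complex.I_sq]
  norm_num

lemma stdGaussian_absolutelyContinuous : stdGaussian V ≪ (volume : Measure V) := by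
  rw [stdGaussian_eq_withDensity]; exact withDensity_absolutelyContinuous _ _

lemma integral_stdGaussian (F : V → ℝ) :
    ∫ w, F w ∂(stdGaussian V) = ∫ w, F w * gaussKer 1 w := by
  rw [stdGaussian_eq_withDensity, integral_withDensity_eq_integral_toReal_smul (by fun_prop) (by simp)]
  congr 1; ext w
  rw [ENNReal.toReal_ofReal (gaussKer_pos one_pos w).le, smul_eq_mul, mul_comm]

lemma integrable_stdGaussian_iff (F : V → ℝ) :
    Integrable F (stdGaussian V) ↔ Integrable (fun w => F w * gaussKer 1 w) := by
  rw [stdGaussian_eq_withDensity, integrable_withDensity_iff_integrable_smul' (by fun_prop) (by simp)]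
  refine integrable_congr (ae_of_all _ fun w => ?_)
  simp only
  rw [ENNReal.toReal_ofReal (gaussKer_pos one_pos w).le, smul_eq_mul, mul_comm]

lemma gaussKer_one_smul {σ : ℝ} (hσ : 0 < σ) (w : V) :
    gaussKer 1 (σ⁻¹ • w) = σ ^ finrank ℝ V * gaussKer (σ ^ 2) w := by
  unfold gaussKer
  rw [norm_smul, Real.norm_of_nonneg (by positivity), mul_one,
    Real.mul_rpow (x := 2 * Real.pi) (y := σ ^ 2) (by positivity) (by positivity),
    ← Real.rpow_natCast_mul hσ.le]
  have : σ ^ finrank ℝ V * σ ^ (((2 : ℕ) : ℝ) * (-(finrank ℝ V : ℝ) / 2)) = 1 := by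
    rw [← Real.rpow_natCast, ← Real.rpow_add hσ]; ring_nf; simp
  rw [show (-(σ⁻¹ * ‖w‖) ^ 2 / (2 * 1)) = -‖w‖ ^ 2 / (2 * σ ^ 2) by field_simp]
  linear_combination (-(2 * Real.pi) ^ (-(finrank ℝ V : ℝ) / 2) * Real.exp (-‖w‖ ^ 2 / (2 * σ ^ 2))) * this

lemma integral_comp_affine_stdGaussian {σ : ℝ} (hσ : 0 < σ) (a : V) (F : V → ℝ) :
    ∫ z, F (a + σ • z) ∂(stdGaussian V) = ∫ w, F w * gaussKer (σ ^ 2) (w - a) := by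
  rw [integral_stdGaussian, ← integral_add_left_eq_self (fun w => F w * gaussKer (σ ^ 2) (w - a)) a]
  have h := Measure.integral_comp_smul (volume : Measure V)
    (fun w => F (a + w) * gaussKer 1 (σ⁻¹ • w)) σ
  simp only [smul_smul, inv_mul_cancel₀ hσ.ne', one_smul] at h
  rw [h, smul_eq_mul, ← integral_const_mul]
  congr 1; ext w
  rw [gaussKer_one_smul hσ, abs_of_pos (by positivity), add_sub_cancel_left]
  field_simp

lemma integrable_comp_affine_stdGaussian {σ : ℝ} (hσ : 0 < σ) (a : V) (F : V → ℝ) :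
    Integrable (fun z => F (a + σ • z)) (stdGaussian V)
      ↔ Integrable (fun w => F w * gaussKer (σ ^ 2) (w - a)) := by
  have h1 := (measurePreserving_add_left volume a).integrable_comp_emb
    (measurableEmbedding_addLeft a) (g := fun w => F w * gaussKer (σ ^ 2) (w - a))
  have h2 := integrable_comp_smul_iff volume (fun w => F (a + w) * gaussKer (σ ^ 2) w) hσ.ne'
  simp only [Function.comp_def, add_sub_cancel_left] at h1
  rw [← h1, ← h2, integrable_stdGaussian_iff, ← integrable_const_mul_iff (c := (σ ^ finrank ℝ V)⁻¹) (by simp [hσ.ne'])]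
  refine integrable_congr (ae_of_all _ fun w => ?_)
  have := gaussKer_one_smul hσ (σ • w)
  rw [smul_smul, inv_mul_cancel₀ hσ.ne', one_smul] at this
  simp only
  rw [this]
  field_simp

/-- Variance `s < 1` decays strictly faster than the standard Gaussian, with room for a bounded
shift of the center and for the linear factor that differentiation produces. This gives one
integrable bound for every `F ∈ L¹(γ)`. -/
lemma exists_gaussKer_dom {s : ℝ} (hs : 0 < s) (hs1 : s < 1) (R : ℝ) :
    ∃ C, 0 ≤ C ∧ ∀ a w : V, ‖a‖ ≤ R → (1 + ‖w - a‖) * gaussKer s (w - a) ≤ C * gaussKer 1 w := by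
  obtain ⟨k, hk, hks⟩ : ∃ k, 0 < k ∧ 1 / (2 * s) = k + 1 / 2 :=
    ⟨1 / (2 * s) - 1 / 2, by
      have : 1 / 2 < 1 / (2 * s) := one_div_lt_one_div_of_lt (by positivity) (by linarith)
      linarith, by ring⟩
  set A := (2 * Real.pi * s) ^ (-(finrank ℝ V : ℝ) / 2)
  set B := (2 * Real.pi * 1) ^ (-(finrank ℝ V : ℝ) / 2)
  have hA : 0 < A := by positivity
  have hB : 0 < B := by positivity
  -- With `‖w‖ ≤ t + R` the exponents differ by at most `(R + 1) t - k t² + R² / 2`; the first term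
  -- of the constant is the maximum of the quadratic in `t`.
  refine ⟨A / B * Real.exp ((R + 1) ^ 2 / (4 * k) + R ^ 2 / 2), by positivity, fun a w ha => ?_⟩
  set t := ‖w - a‖
  have ht : 0 ≤ t := norm_nonneg _
  have hR : 0 ≤ R := (norm_nonneg _).trans ha
  have hw : ‖w‖ ≤ t + R := by
    have : ‖w‖ ≤ ‖w - a‖ + ‖a‖ := by simpa using norm_add_le (w - a) a
    linarith
  have hw2 : ‖w‖ ^ 2 ≤ (t + R) ^ 2 := by gcongr
  have h1 : 1 + t ≤ Real.exp t := by linarith [Real.add_one_le_exp t]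
  have key : t + -t ^ 2 / (2 * s) ≤ (R + 1) ^ 2 / (4 * k) + R ^ 2 / 2 + -‖w‖ ^ 2 / (2 * 1) := by
    have e1 : -t ^ 2 / (2 * s) = -(k + 1 / 2) * t ^ 2 := by rw [← hks]; ring
    have e2 : (R + 1) * t - k * t ^ 2 ≤ (R + 1) ^ 2 / (4 * k) := by
      rw [le_div_iff₀ (by positivity)]
      nlinarith [sq_nonneg (2 * k * t - (R + 1))]
    rw [e1]; nlinarith
  calc (1 + t) * (A * Real.exp (-t ^ 2 / (2 * s)))
      ≤ Real.exp t * (A * Real.exp (-t ^ 2 / (2 * s))) := by gcongr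
    _ = A * Real.exp (t + -t ^ 2 / (2 * s)) := by rw [Real.exp_add]; ring
    _ ≤ A * Real.exp ((R + 1) ^ 2 / (4 * k) + R ^ 2 / 2 + -‖w‖ ^ 2 / (2 * 1)) := by gcongr
    _ = A / B * Real.exp ((R + 1) ^ 2 / (4 * k) + R ^ 2 / 2)
          * (B * Real.exp (-‖w‖ ^ 2 / (2 * 1))) := by rw [Real.exp_add]; field_simp

lemma hasDerivAt_gaussKer {s : ℝ} (hs : 0 < s) (u v : V) (t : ℝ) :
    HasDerivAt (fun t : ℝ => gaussKer s (u - t • v))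
      (inner ℝ (u - t • v) v / s * gaussKer s (u - t • v)) t := by
  have h1 : HasDerivAt (fun t : ℝ => u - t • v) (-v) t := by
    simpa using ((hasDerivAt_id t).smul_const v).const_sub u
  have h2 := ((h1.norm_sq.neg.div_const (2 * s)).exp).const_mul
    ((2 * Real.pi * s) ^ (-(finrank ℝ V : ℝ) / 2))
  refine h2.congr_deriv ?_
  simp only [gaussKer, inner_neg_right, Pi.neg_apply]
  field_simp

variable {F : V → ℝ}

lemma integrable_mul_gaussKer (hF : Integrable F (stdGaussian V)) {s : ℝ} (hs : 0 < s) (hs1 : s < 1)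
    (a : V) {P : V → ℝ} (hP : AEStronglyMeasurable P volume) {c : ℝ}
    (hPb : ∀ w, |P w| ≤ c * (1 + ‖w - a‖)) :
    Integrable (fun w => F w * (P w * gaussKer s (w - a))) := by
  obtain ⟨C, hC, hb⟩ := exists_gaussKer_dom (V := V) hs hs1 ‖a‖
  rw [integrable_stdGaussian_iff] at hF
  have hFm : AEStronglyMeasurable F volume := by
    have := hF.1.mul ((continuous_gaussKer (V := V) 1).aestronglyMeasurable.inv₀ (μ := volume))
    refine this.congr (ae_of_all _ fun w => ?_)
    have := (gaussKer_pos (V := V) one_pos w).ne'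
    simp only [Pi.mul_apply, Pi.inv_apply]; field_simp
  refine (hF.norm.const_mul (c * C)).mono' (hFm.mul (hP.mul
    (by fun_prop : Continuous fun w => gaussKer s (w - a)).aestronglyMeasurable)) (ae_of_all _ fun w => ?_)
  have hc : 0 ≤ c := by
    have := (abs_nonneg _).trans (hPb w)
    by_contra h
    nlinarith [norm_nonneg (w - a)]
  rw [norm_mul, norm_mul, norm_mul, Real.norm_of_nonneg (gaussKer_pos hs _).le,
    Real.norm_of_nonneg (gaussKer_pos one_pos _).le, Real.norm_eq_abs (P w)]
  have := mul_le_mul_of_nonneg_left (hb a w le_rfl) hc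
  have h3 := mul_le_mul_of_nonneg_right (hPb w) (gaussKer_pos hs (w - a)).le
  have h4 : |P w| * gaussKer s (w - a) ≤ c * (C * gaussKer 1 w) := by nlinarith
  calc ‖F w‖ * (|P w| * gaussKer s (w - a)) ≤ ‖F w‖ * (c * (C * gaussKer 1 w)) := by gcongr
    _ = _ := by ring

lemma continuous_integral_mul_gaussKer (hF : Integrable F (stdGaussian V)) {s : ℝ} (hs : 0 < s)
    (hs1 : s < 1) {P : V → ℝ} (hP : Continuous P) {c : ℝ} (hPb : ∀ w, |P w| ≤ c * (1 + ‖w‖)) :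
    Continuous fun a : V => ∫ w, F w * (P (w - a) * gaussKer s (w - a)) := by
  rw [continuous_iff_continuousAt]
  intro a₀
  obtain ⟨C, hC, hb⟩ := exists_gaussKer_dom (V := V) hs hs1 (‖a₀‖ + 1)
  have hc : 0 ≤ c := by
    have := (abs_nonneg _).trans (hPb 0)
    simpa using this
  have hF' := (integrable_stdGaussian_iff F).1 hF
  refine continuousAt_of_dominated (bound := fun w => c * C * ‖F w * gaussKer 1 w‖) ?_ ?_
    (hF'.norm.const_mul _) (ae_of_all _ fun w => by fun_prop)
  · refine Eventually.of_forall fun a => (integrable_mul_gaussKer hF hs hs1 a (c := c)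
      (by fun_prop : Continuous fun w => P (w - a)).aestronglyMeasurable fun w => hPb _).1
  · have : ∀ᶠ a in 𝓝 a₀, ‖a‖ < ‖a₀‖ + 1 :=
      continuous_norm.continuousAt.eventually_lt continuousAt_const (by linarith)
    filter_upwards [this] with a ha
    refine ae_of_all _ fun w => ?_
    rw [norm_mul, norm_mul, norm_mul, Real.norm_of_nonneg (gaussKer_pos hs _).le,
      Real.norm_of_nonneg (gaussKer_pos one_pos _).le, Real.norm_eq_abs (P _)]
    have := mul_le_mul_of_nonneg_left (hb a w ha.le) hc
    have h3 := mul_le_mul_of_nonneg_right (hPb (w - a)) (gaussKer_pos hs (w - a)).le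
    have h4 : |P (w - a)| * gaussKer s (w - a) ≤ c * (C * gaussKer 1 w) := by nlinarith
    calc ‖F w‖ * (|P (w - a)| * gaussKer s (w - a)) ≤ ‖F w‖ * (c * (C * gaussKer 1 w)) := by gcongr
      _ = _ := by ring

/-- The derivative falls on the kernel, so integrability of `F` is enough. -/
lemma hasDerivAt_integral_mul_gaussKer (hF : Integrable F (stdGaussian V)) {s : ℝ} (hs : 0 < s)
    (hs1 : s < 1) (a v : V) :
    HasDerivAt (fun t : ℝ => ∫ w, F w * gaussKer s (w - (a + t • v)))
      (∫ w, F w * (inner ℝ (w - a) v / s * gaussKer s (w - a))) 0 := by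
  obtain ⟨C, hC, hb⟩ := exists_gaussKer_dom (V := V) hs hs1 (‖a‖ + ‖v‖)
  have hF' := (integrable_stdGaussian_iff F).1 hF
  have hPb : ∀ a w : V, |inner ℝ (w - a) v / s| ≤ ‖v‖ / s * (1 + ‖w - a‖) := by
    intro a w
    rw [abs_div, abs_of_pos hs, div_mul_eq_mul_div]
    gcongr
    calc |inner ℝ (w - a) v| ≤ ‖w - a‖ * ‖v‖ := abs_real_inner_le_norm _ _
      _ ≤ _ := by nlinarith [norm_nonneg v]
  have key := hasDerivAt_integral_of_dominated_loc_of_deriv_le (μ := (volume : Measure V)) (𝕜 := ℝ)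
    (F := fun t w => F w * gaussKer s (w - (a + t • v)))
    (F' := fun t w => F w * (inner ℝ (w - (a + t • v)) v / s * gaussKer s (w - (a + t • v))))
    (x₀ := 0) (s := Metric.ball 0 1) (bound := fun w => ‖v‖ / s * C * ‖F w * gaussKer 1 w‖)
    (Metric.ball_mem_nhds _ one_pos) ?_ ?_ ?_ ?_ (hF'.norm.const_mul _) ?_
  · simpa using key.2
  · refine Eventually.of_forall fun t => ?_
    have := (integrable_mul_gaussKer hF hs hs1 (a + t • v) (P := fun _ => 1) (c := 1)
      aestronglyMeasurable_const fun w => by simp).1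
    simpa using this
  · have := integrable_mul_gaussKer hF hs hs1 (a + (0 : ℝ) • v) (P := fun _ => 1) (c := 1)
      aestronglyMeasurable_const fun w => by simp
    simpa using this
  · exact (integrable_mul_gaussKer hF hs hs1 _ (by fun_prop) fun w => hPb _ w).1
  · refine ae_of_all _ fun w t ht => ?_
    rw [norm_mul, norm_mul, norm_mul, Real.norm_of_nonneg (gaussKer_pos hs _).le,
      Real.norm_of_nonneg (gaussKer_pos one_pos _).le, Real.norm_eq_abs (_ / _)]
    have ht' : ‖a + t • v‖ ≤ ‖a‖ + ‖v‖ := by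
      refine (norm_add_le _ _).trans ?_
      rw [norm_smul]
      have : ‖t‖ < 1 := by simpa using ht
      nlinarith [norm_nonneg v]
    have := mul_le_mul_of_nonneg_left (hb _ w ht') (by positivity : 0 ≤ ‖v‖ / s)
    have h3 := mul_le_mul_of_nonneg_right (hPb (a + t • v) w) (gaussKer_pos hs (w - (a + t • v))).le
    have h4 : |inner ℝ (w - (a + t • v)) v / s| * gaussKer s (w - (a + t • v))
      ≤ ‖v‖ / s * (C * gaussKer 1 w) := by nlinarith
    calc _ ≤ ‖F w‖ * (‖v‖ / s * (C * gaussKer 1 w)) := by gcongr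
      _ = _ := by ring
  · refine ae_of_all _ fun w t ht => ?_
    have := (hasDerivAt_gaussKer hs (w - a) v t).const_mul (F w)
    simpa only [sub_sub] using this

end Mehler

/-! ### The Mehler operators. -/

section Mehler

variable {V : Type*} [NormedAddCommGroup V] [InnerProductSpace ℝ V] [FiniteDimensional ℝ V]
  [MeasurableSpace V] [BorelSpace V] {F : V → ℝ}

lemma measurePreserving_rotation {a b : ℝ} (hab : a ^ 2 + b ^ 2 = 1) :
    MeasurePreserving (fun p : V × V => (a • p.1 + b • p.2, -b • p.1 + a • p.2))
      ((stdGaussian V).prod (stdGaussian V)) ((stdGaussian V).prod (stdGaussian V)) := by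
  have ha : -1 ≤ a ∧ a ≤ 1 := abs_le.1 (abs_le_one_iff_mul_self_le_one.2 (by nlinarith [sq_nonneg b]))
  have hs : √(1 - a ^ 2) = |b| := by rw [← Real.sqrt_sq_eq_abs]; congr 1; linarith
  obtain ⟨t, hc, hsn⟩ : ∃ t, Real.cos t = a ∧ Real.sin t = b := by
    rcases le_total 0 b with hb | hb
    · exact ⟨Real.arccos a, Real.cos_arccos ha.1 ha.2, by
        rw [Real.sin_arccos, hs, abs_of_nonneg hb]⟩
    · exact ⟨-Real.arccos a, by rw [Real.cos_neg, Real.cos_arccos ha.1 ha.2], by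
        rw [Real.sin_neg, Real.sin_arccos, hs, abs_of_nonpos hb, neg_neg]⟩
  have h := IsGaussian.map_rotation_eq_self_of_forall_strongDual_eq_zero
    (μ := stdGaussian V) integral_strongDual_stdGaussian t
  refine ⟨by fun_prop, ?_⟩
  rw [← hc, ← hsn]
  convert h using 2
  ext p <;> simp [ContinuousLinearMap.rotation_apply]

lemma measurePreserving_combination {a b : ℝ} (hab : a ^ 2 + b ^ 2 = 1) :
    MeasurePreserving (fun p : V × V => a • p.1 + b • p.2)
      ((stdGaussian V).prod (stdGaussian V)) (stdGaussian V) :=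
  measurePreserving_fst.comp (measurePreserving_rotation hab)

lemma sq_add_sqrt_sq {ρ : ℝ} (h0 : 0 ≤ ρ) (h1 : ρ ≤ 1) : ρ ^ 2 + √(1 - ρ ^ 2) ^ 2 = 1 := by
  rw [Real.sq_sqrt (by nlinarith)]; ring

/-- The Ornstein-Uhlenbeck operator of correlation `ρ`, by Mehler's formula. -/
def mehler (ρ : ℝ) (F : V → ℝ) (y : V) : ℝ :=
  ∫ z, F (ρ • y + √(1 - ρ ^ 2) • z) ∂(stdGaussian V)

lemma one_sub_sq_mem {ρ : ℝ} (h0 : 0 < ρ) (h1 : ρ < 1) : 0 < 1 - ρ ^ 2 ∧ 1 - ρ ^ 2 < 1 :=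
  ⟨by nlinarith, by nlinarith⟩

lemma mehler_eq {ρ : ℝ} (h0 : 0 < ρ) (h1 : ρ < 1) (F : V → ℝ) (y : V) :
    mehler ρ F y = ∫ w, F w * gaussKer (1 - ρ ^ 2) (w - ρ • y) := by
  have h := (one_sub_sq_mem h0 h1).1
  rw [mehler, integral_comp_affine_stdGaussian (Real.sqrt_pos.2 h), Real.sq_sqrt h.le]

lemma integrable_mehler_section {ρ : ℝ} (h0 : 0 < ρ) (h1 : ρ < 1) (hF : Integrable F (stdGaussian V))
    (y : V) : Integrable (fun z => F (ρ • y + √(1 - ρ ^ 2) • z)) (stdGaussian V) := by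
  have h := one_sub_sq_mem h0 h1
  rw [integrable_comp_affine_stdGaussian (Real.sqrt_pos.2 h.1), Real.sq_sqrt h.1.le]
  simpa using integrable_mul_gaussKer hF h.1 h.2 (ρ • y) (P := fun _ => 1) (c := 1)
    aestronglyMeasurable_const fun w => by simp

lemma continuous_mehler {ρ : ℝ} (h0 : 0 < ρ) (h1 : ρ < 1) (hF : Integrable F (stdGaussian V)) :
    Continuous (mehler ρ F) := by
  have h := one_sub_sq_mem h0 h1
  have := (continuous_integral_mul_gaussKer hF h.1 h.2 (P := fun _ => 1) (c := 1)
    continuous_const fun w => by simp).comp (continuous_const_smul ρ)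
  refine this.congr fun y => ?_
  simp [mehler_eq h0 h1]

lemma integrable_mehler_prod {ρ : ℝ} (h0 : 0 ≤ ρ) (h1 : ρ ≤ 1) (hF : Integrable F (stdGaussian V)) :
    Integrable (fun p : V × V => F (ρ • p.1 + √(1 - ρ ^ 2) • p.2))
      ((stdGaussian V).prod (stdGaussian V)) :=
  (measurePreserving_combination (sq_add_sqrt_sq h0 h1)).integrable_comp_of_integrable hF

lemma integrable_mehler {ρ : ℝ} (h0 : 0 ≤ ρ) (h1 : ρ ≤ 1) (hF : Integrable F (stdGaussian V)) :
    Integrable (mehler ρ F) (stdGaussian V) :=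
  (integrable_mehler_prod h0 h1 hF).integral_prod_left

lemma integral_mehler {ρ : ℝ} (h0 : 0 ≤ ρ) (h1 : ρ ≤ 1) (hF : Integrable F (stdGaussian V)) :
    ∫ y, mehler ρ F y ∂(stdGaussian V) = ∫ y, F y ∂(stdGaussian V) := by
  have h := measurePreserving_combination (V := V) (sq_add_sqrt_sq h0 h1)
  simp only [mehler]
  rw [← integral_prod _ (integrable_mehler_prod h0 h1 hF)]
  have h2 := integral_map h.measurable.aemeasurable (f := F) (by rw [h.map_eq]; exact hF.1)
  rw [h.map_eq] at h2
  exact h2.symm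

/-- The pair `(X, ρX + σZ)` is exchangeable when `X` and `Z` are independent standard Gaussians: the
orthogonal map `(x, z) ↦ (ρx + σz, σx - ρz)` preserves `γ ⊗ γ` and interchanges the two entries. -/
lemma integral_mehler_mul {ρ : ℝ} (h0 : 0 ≤ ρ) (h1 : ρ ≤ 1) {u : V → ℝ}
    (h : Integrable (fun p : V × V => F (ρ • p.1 + √(1 - ρ ^ 2) • p.2) * u p.1)
      ((stdGaussian V).prod (stdGaussian V))) :
    ∫ y, mehler ρ F y * u y ∂(stdGaussian V) = ∫ x, F x * mehler ρ u x ∂(stdGaussian V) := by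
  set σ := √(1 - ρ ^ 2) with hσ
  have hab : ρ ^ 2 + σ ^ 2 = 1 := sq_add_sqrt_sq h0 h1
  have hrot := measurePreserving_rotation (V := V) (a := ρ) (b := -σ) (by rw [neg_sq]; exact hab)
  -- A rotation alone does not exchange the two entries; flipping the sign of the second variable
  -- first makes the composite an involution.
  have hneg : MeasurePreserving (fun p : V × V => (p.1, -p.2))
      ((stdGaussian V).prod (stdGaussian V)) ((stdGaussian V).prod (stdGaussian V)) := by
    have : MeasurePreserving (fun x : V => -x) (stdGaussian V) (stdGaussian V) :=
      ⟨by fun_prop, stdGaussian_map (LinearIsometryEquiv.neg ℝ (E := V))⟩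
    exact (MeasurePreserving.id _).prod this
  have hT := hrot.comp hneg
  have h2 := integral_map hT.measurable.aemeasurable (by rw [hT.map_eq]; exact h.1)
  have h3 := hT.integrable_comp_of_integrable h
  have e : ∀ p : V × V, ((fun p : V × V => F (ρ • p.1 + σ • p.2) * u p.1) ∘
      ((fun p : V × V => (ρ • p.1 + -σ • p.2, - -σ • p.1 + ρ • p.2)) ∘ fun p => (p.1, -p.2))) p
      = F p.1 * u (ρ • p.1 + σ • p.2) := by
    intro p
    simp only [Function.comp]
    congr 2
    · have : ρ • (ρ • p.1 + -σ • -p.2) + σ • (- -σ • p.1 + ρ • -p.2) = (ρ ^ 2 + σ ^ 2) • p.1 := by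
        module
      rw [this, hab, one_smul]
    · module
  rw [hT.map_eq] at h2
  have h3' : Integrable (fun p : V × V => F p.1 * u (ρ • p.1 + σ • p.2))
      ((stdGaussian V).prod (stdGaussian V)) := h3.congr (ae_of_all _ e)
  calc ∫ y, mehler ρ F y * u y ∂(stdGaussian V)
      = ∫ p : V × V, F (ρ • p.1 + σ • p.2) * u p.1 ∂((stdGaussian V).prod (stdGaussian V)) := by
        rw [integral_prod _ h]
        simp only [mehler, integral_mul_const]; rfl
    _ = ∫ p : V × V, F p.1 * u (ρ • p.1 + σ • p.2) ∂((stdGaussian V).prod (stdGaussian V)) := by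
        rw [h2]; exact integral_congr_ae (ae_of_all _ e)
    _ = _ := by
        rw [integral_prod _ h3']
        simp only [mehler, integral_const_mul]; rfl

lemma mehler_nonneg {ρ : ℝ} (hF : ∀ x, 0 ≤ F x) (y : V) : 0 ≤ mehler ρ F y :=
  integral_nonneg fun _ => hF _

lemma mehler_pos {ρ : ℝ} (h0 : 0 < ρ) (h1 : ρ < 1) (hF : Integrable F (stdGaussian V))
    (hF0 : ∀ x, 0 ≤ F x) (hpos : 0 < ∫ x, F x ∂(stdGaussian V)) (y : V) : 0 < mehler ρ F y := by
  have h := one_sub_sq_mem h0 h1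
  have hi := integrable_mul_gaussKer hF h.1 h.2 (ρ • y) (P := fun _ => 1) (c := 1)
    aestronglyMeasurable_const fun w => by simp
  simp only [one_mul] at hi
  rw [mehler_eq h0 h1, integral_pos_iff_support_of_nonneg
    (fun w => mul_nonneg (hF0 w) (gaussKer_pos h.1 _).le) hi]
  rw [integral_stdGaussian, integral_pos_iff_support_of_nonneg
    (fun w => mul_nonneg (hF0 w) (gaussKer_pos one_pos _).le) ((integrable_stdGaussian_iff F).1 hF)] at hpos
  convert hpos using 2
  ext w
  simp [(gaussKer_pos (V := V) h.1 _).ne', (gaussKer_pos (V := V) one_pos _).ne']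

lemma integral_abs_mehler_sub_le {ρ : ℝ} (h0 : 0 ≤ ρ) (h1 : ρ ≤ 1) {G : V → ℝ}
    (hF : Integrable F (stdGaussian V)) (hG : Integrable G (stdGaussian V)) :
    ∫ y, |mehler ρ F y - mehler ρ G y| ∂(stdGaussian V) ≤ ∫ y, |F y - G y| ∂(stdGaussian V) := by
  have hs := (integrable_mehler_prod h0 h1 hF).prod_right_ae
  have ht := (integrable_mehler_prod h0 h1 hG).prod_right_ae
  have hi : Integrable (fun y => |F y - G y|) (stdGaussian V) := (hF.sub hG).abs
  rw [← integral_mehler h0 h1 hi]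
  refine integral_mono_ae ((integrable_mehler h0 h1 hF).sub (integrable_mehler h0 h1 hG)).abs
    (integrable_mehler h0 h1 hi) ?_
  filter_upwards [hs, ht] with y hy1 hy2
  simp only [mehler]
  rw [← integral_sub hy1 hy2]
  exact abs_integral_le_integral_abs

/-- For compactly supported continuous functions this is dominated convergence in Mehler's formula;
density in `L¹(γ)` and the contraction property extend it. -/
lemma tendsto_integral_abs_mehler_sub {ρ : ℕ → ℝ} (h0 : ∀ k, 0 ≤ ρ k) (h1 : ∀ k, ρ k ≤ 1)
    (hρ : Tendsto ρ atTop (𝓝 1)) (hF : Integrable F (stdGaussian V)) :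
    Tendsto (fun k => ∫ y, |mehler (ρ k) F y - F y| ∂(stdGaussian V)) atTop (𝓝 0) := by
  have hcont : ∀ g : V → ℝ, HasCompactSupport g → Continuous g →
      Tendsto (fun k => ∫ y, |mehler (ρ k) g y - g y| ∂(stdGaussian V)) atTop (𝓝 0) := by
    intro g hg hgc
    obtain ⟨C, hC⟩ := hgc.bounded_above_of_compact_support hg
    have hgi : Integrable g (stdGaussian V) := Integrable.of_bound hgc.aestronglyMeasurable C
      (ae_of_all _ hC)
    have hlim : Tendsto (fun k => ∫ p : V × V, |g (ρ k • p.1 + √(1 - ρ k ^ 2) • p.2) - g p.1|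
        ∂((stdGaussian V).prod (stdGaussian V))) atTop (𝓝 0) := by
      rw [show (0 : ℝ) = ∫ p : V × V, (0 : ℝ) ∂((stdGaussian V).prod (stdGaussian V)) by simp]
      refine tendsto_integral_of_dominated_convergence (fun _ => C + C) (fun k => ?_)
        (integrable_const _) (fun k => ae_of_all _ fun p => ?_) (ae_of_all _ fun p => ?_)
      · exact Continuous.aestronglyMeasurable (by fun_prop)
      · rw [Real.norm_eq_abs, abs_abs]
        exact (abs_sub _ _).trans (add_le_add (hC _) (hC _))
      · have : Tendsto (fun k => |g (ρ k • p.1 + √(1 - ρ k ^ 2) • p.2) - g p.1|) atTop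
            (𝓝 |g ((1 : ℝ) • p.1 + √(1 - 1 ^ 2) • p.2) - g p.1|) := by
          have hc : Continuous fun r : ℝ => |g (r • p.1 + √(1 - r ^ 2) • p.2) - g p.1| := by fun_prop
          exact (hc.tendsto 1).comp hρ
        simpa using this
    refine squeeze_zero (fun k => by positivity) (fun k => ?_) hlim
    have hi : Integrable (fun p : V × V => |g (ρ k • p.1 + √(1 - ρ k ^ 2) • p.2) - g p.1|)
        ((stdGaussian V).prod (stdGaussian V)) :=
      ((integrable_mehler_prod (h0 k) (h1 k) hgi).sub (hgi.comp_fst _)).abs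
    rw [integral_prod _ hi]
    refine integral_mono_ae ((integrable_mehler (h0 k) (h1 k) hgi).sub hgi).abs hi.integral_prod_left ?_
    filter_upwards [(integrable_mehler_prod (h0 k) (h1 k) hgi).prod_right_ae] with y hy
    have : mehler (ρ k) g y - g y = ∫ z, (g (ρ k • y + √(1 - ρ k ^ 2) • z) - g y) ∂(stdGaussian V) := by
      rw [integral_sub hy (integrable_const _)]
      simp [mehler]
    rw [this]
    exact abs_integral_le_integral_abs
  rw [Metric.tendsto_atTop]
  intro ε hε
  obtain ⟨g, hg, hgε, hgc, hgi⟩ := hF.exists_hasCompactSupport_integral_sub_le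
    (show (0 : ℝ) < ε / 4 by positivity)
  obtain ⟨N, hN⟩ := (Metric.tendsto_atTop.1 (hcont g hg hgc)) (ε / 4) (by positivity)
  refine ⟨N, fun k hk => ?_⟩
  have hk' := hN k hk
  rw [Real.dist_eq, sub_zero, abs_of_nonneg (by positivity)] at hk' ⊢
  have hA := integral_abs_mehler_sub_le (h0 k) (h1 k) hF hgi
  simp only [Real.norm_eq_abs] at hgε
  have iF := integrable_mehler (h0 k) (h1 k) hF
  have ig := integrable_mehler (h0 k) (h1 k) hgi
  have : ∫ y, |mehler (ρ k) F y - F y| ∂(stdGaussian V)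
      ≤ ∫ y, (|mehler (ρ k) F y - mehler (ρ k) g y| + |mehler (ρ k) g y - g y| + |F y - g y|)
        ∂(stdGaussian V) := by
    refine integral_mono_ae (iF.sub hF).abs
      (((iF.sub ig).abs.add (ig.sub hgi).abs).add (hF.sub hgi).abs) (ae_of_all _ fun y => ?_)
    have e : mehler (ρ k) F y - F y = (mehler (ρ k) F y - mehler (ρ k) g y)
      + (mehler (ρ k) g y - g y) - (F y - g y) := by ring
    simp only
    rw [e]
    exact (abs_sub _ _).trans (add_le_add (abs_add_le _ _) le_rfl)
  have i1 : Integrable (fun y => |mehler (ρ k) F y - mehler (ρ k) g y|) (stdGaussian V) :=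
    (iF.sub ig).abs
  have i2 : Integrable (fun y => |mehler (ρ k) g y - g y|) (stdGaussian V) := (ig.sub hgi).abs
  have i3 : Integrable (fun y => |F y - g y|) (stdGaussian V) := (hF.sub hgi).abs
  have i12 : Integrable (fun y => |mehler (ρ k) F y - mehler (ρ k) g y|
    + |mehler (ρ k) g y - g y|) (stdGaussian V) := i1.add i2
  rw [integral_add i12 i3, integral_add i1 i2] at this
  linarith

/-- The two independent Gaussian noises combine into a single one of variance `b²(1 - a²) + (1 - b²)
= 1 - (ab)²`. -/
lemma mehler_mehler {a b : ℝ} (ha0 : 0 < a) (ha1 : a < 1) (hb0 : 0 < b) (hb1 : b < 1)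
    (hF : Integrable F (stdGaussian V)) (y : V) :
    mehler a (mehler b F) y = mehler (a * b) F y := by
  have hab0 : 0 < a * b := by positivity
  have hab1 : a * b < 1 := by nlinarith
  set c := √(1 - (a * b) ^ 2) with hc
  have hcp : 0 < c := Real.sqrt_pos.2 (one_sub_sq_mem hab0 hab1).1
  have hc2 : c ^ 2 = 1 - (a * b) ^ 2 := Real.sq_sqrt (one_sub_sq_mem hab0 hab1).1.le
  have ha2 : √(1 - a ^ 2) ^ 2 = 1 - a ^ 2 := Real.sq_sqrt (one_sub_sq_mem ha0 ha1).1.le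
  have hb2 : √(1 - b ^ 2) ^ 2 = 1 - b ^ 2 := Real.sq_sqrt (one_sub_sq_mem hb0 hb1).1.le
  have hmp := measurePreserving_combination (V := V)
    (a := b * √(1 - a ^ 2) / c) (b := √(1 - b ^ 2) / c) (by
      rw [div_pow, div_pow, mul_pow, ha2, hb2, hc2, ← add_div, div_eq_one_iff_eq (by rw [← hc2]; positivity)]
      ring)
  have hs := integrable_mehler_section hab0 hab1 hF y
  have h2 := integral_map hmp.measurable.aemeasurable
    (f := fun z => F ((a * b) • y + c • z)) (by rw [hmp.map_eq]; exact hs.1)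
  have hi := hmp.integrable_comp_of_integrable hs
  rw [hmp.map_eq] at h2
  have e : ∀ p : V × V, (a * b) • y + c • ((b * √(1 - a ^ 2) / c) • p.1 + (√(1 - b ^ 2) / c) • p.2)
      = b • (a • y + √(1 - a ^ 2) • p.1) + √(1 - b ^ 2) • p.2 := by
    intro p
    rw [smul_add, smul_smul c, smul_smul c, mul_div_cancel₀ _ hcp.ne', mul_div_cancel₀ _ hcp.ne']
    module
  simp only [Function.comp_def, ← hc, e] at hi h2
  rw [mehler, mehler, ← hc, h2, integral_prod _ hi]
  rfl

/-- The Mehler kernel relative to `γ` is at most a constant times `exp (‖y‖² / 2)`, uniformly in the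
integration variable. Hence `log (P_ρ f)` grows at most quadratically, which is what finiteness of
the entropy requires. -/
lemma exists_abs_mehler_le {ρ : ℝ} (h0 : 0 < ρ) (h1 : ρ < 1) (hF : Integrable F (stdGaussian V)) :
    ∃ C, 0 < C ∧ ∀ y, |mehler ρ F y| ≤ C * Real.exp (‖y‖ ^ 2 / 2) := by
  obtain ⟨hs, hs1⟩ := one_sub_sq_mem h0 h1
  set s := 1 - ρ ^ 2 with hsdef
  set A := (2 * Real.pi * s) ^ (-(finrank ℝ V : ℝ) / 2)
  set B := (2 * Real.pi * 1) ^ (-(finrank ℝ V : ℝ) / 2)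
  have hA : 0 < A := by positivity
  have hB : 0 < B := by positivity
  have hI := (integrable_stdGaussian_iff F).1 hF
  have hI0 : 0 ≤ ∫ w, ‖F w * gaussKer 1 w‖ := integral_nonneg fun _ => norm_nonneg _
  refine ⟨A / B * (∫ w, ‖F w * gaussKer 1 w‖) + 1, by positivity, fun y => ?_⟩
  have hk : ∀ w : V, gaussKer s (w - ρ • y) ≤ A / B * Real.exp (‖y‖ ^ 2 / 2) * gaussKer 1 w := by
    intro w
    -- Completing the square: `‖w - ρy‖² + (1 - ρ²)‖y‖² = (1 - ρ²)‖w‖² + ‖ρw - y‖²`.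
    have : -‖w - ρ • y‖ ^ 2 / (2 * s) ≤ ‖y‖ ^ 2 / 2 + -‖w‖ ^ 2 / (2 * 1) := by
      rw [div_le_iff₀ (by positivity)]
      have e1 := norm_sub_sq_real w (ρ • y)
      have e2 := norm_sub_sq_real (ρ • w) y
      rw [norm_smul, real_inner_smul_right, Real.norm_of_nonneg h0.le] at e1
      rw [norm_smul, real_inner_smul_left, Real.norm_of_nonneg h0.le] at e2
      rw [e1, hsdef]
      nlinarith [sq_nonneg ‖ρ • w - y‖]
    calc A * Real.exp (-‖w - ρ • y‖ ^ 2 / (2 * s))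
        ≤ A * Real.exp (‖y‖ ^ 2 / 2 + -‖w‖ ^ 2 / (2 * 1)) := by gcongr
      _ = A / B * Real.exp (‖y‖ ^ 2 / 2) * (B * Real.exp (-‖w‖ ^ 2 / (2 * 1))) := by
        rw [Real.exp_add]; field_simp
  rw [mehler_eq h0 h1]
  calc |∫ w, F w * gaussKer s (w - ρ • y)|
      ≤ ∫ w, A / B * Real.exp (‖y‖ ^ 2 / 2) * ‖F w * gaussKer 1 w‖ := by
        rw [← Real.norm_eq_abs]
        refine norm_integral_le_of_norm_le (hI.norm.const_mul _) (ae_of_all _ fun w => ?_)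
        rw [norm_mul, norm_mul, Real.norm_of_nonneg (gaussKer_pos hs _).le,
          Real.norm_of_nonneg (gaussKer_pos one_pos _).le]
        calc ‖F w‖ * _ ≤ ‖F w‖ * (A / B * Real.exp (‖y‖ ^ 2 / 2) * gaussKer 1 w) := by
              gcongr; exact hk w
          _ = _ := by ring
    _ = A / B * (∫ w, ‖F w * gaussKer 1 w‖) * Real.exp (‖y‖ ^ 2 / 2) := by
        rw [integral_const_mul]; ring
    _ ≤ _ := by gcongr; linarith

end Mehler

/-! ### Weak gradients and Gaussian integration by parts. -/

section WeakGradient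

variable {n : ℕ} {f : E n → ℝ} {G : E n → E n}

lemma exists_subseq_tendsto_ae {α : Type*} [MeasurableSpace α] {μ : Measure α} {u : ℕ → α → ℝ}
    {w : α → ℝ} (hu : ∀ k, Integrable (u k) μ) (hw : Integrable w μ)
    (h : Tendsto (fun k => ∫ x, |u k x - w x| ∂μ) atTop (𝓝 0)) :
    ∃ ns : ℕ → ℕ, StrictMono ns ∧
      ∀ᵐ x ∂μ, Tendsto (fun i => u (ns i) x) atTop (𝓝 (w x)) := by
  refine (tendstoInMeasure_of_tendsto_eLpNorm (p := 1) one_ne_zero (fun k => (hu k).1) hw.1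
    ?_).exists_seq_tendsto_ae
  have e : ∀ k, eLpNorm (u k - w) 1 μ = ENNReal.ofReal (∫ x, |u k x - w x| ∂μ) := by
    intro k
    have hi : Integrable (fun x => |u k x - w x|) μ := ((hu k).sub hw).abs
    rw [eLpNorm_one_eq_lintegral_enorm, ofReal_integral_eq_lintegral_ofReal hi
      (ae_of_all _ fun _ => abs_nonneg _)]
    refine lintegral_congr fun x => ?_
    rw [Pi.sub_apply, ← ofReal_norm, Real.norm_eq_abs]
  simp_rw [e]
  simpa using ENNReal.tendsto_ofReal h

lemma exists_smooth_cutoff (n : ℕ) : ∃ χ : E n → ℝ, ContDiff ℝ ∞ χ ∧ HasCompactSupport χ ∧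
    (∀ x, 0 ≤ χ x) ∧ (∀ x, χ x ≤ 1) ∧ ∀ x, ‖x‖ ≤ 1 → χ x = 1 := by
  let χ : ContDiffBump (0 : E n) := ⟨1, 2, one_pos, one_lt_two⟩
  exact ⟨χ, χ.contDiff, χ.hasCompactSupport, fun _ => χ.nonneg, fun _ => χ.le_one, fun x hx =>
    χ.one_of_mem_closedBall (by simpa [χ] using hx)⟩

lemma integrable_mul_gaussKer' {F : E n → ℝ} (hF : Integrable F (gauss n)) {s : ℝ} (hs : 0 < s)
    (hs1 : s < 1) (a : E n) : Integrable (fun w => F w * gaussKer s (w - a)) := by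
  have := integrable_mul_gaussKer hF hs hs1 a (P := fun _ => 1) (c := 1)
    aestronglyMeasurable_const fun w => by simp
  simpa only [one_mul] using this

/-- Integration by parts against a smooth function without compact support. -/
lemma HasWeakGradient.integral_eq_of_integrable (hG : HasWeakGradient f G) {φ : E n → ℝ}
    (hφ : ContDiff ℝ ∞ φ) (v : E n) (h1 : Integrable fun x => f x * φ x)
    (h2 : Integrable fun x => f x * fderiv ℝ φ x v)
    (h3 : Integrable fun x => inner ℝ (G x) v * φ x) :
    ∫ x, f x * fderiv ℝ φ x v = - ∫ x, inner ℝ (G x) v * φ x := by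
  obtain ⟨χ, hχs, hχc, hχ0, hχl, hχe⟩ := exists_smooth_cutoff n
  have hdc : Continuous (fderiv ℝ χ) := hχs.continuous_fderiv (by simp)
  obtain ⟨C, hC⟩ := hdc.bounded_above_of_compact_support (hχc.fderiv (𝕜 := ℝ))
  have hC0 : 0 ≤ C := (norm_nonneg _).trans (hC 0)
  -- The cutoffs `χ(r x)` with `r → 0` exhaust the space, and their derivative carries a factor `r`,
  -- so the extra term of the product rule disappears in the limit.
  let r : ℕ → ℝ := fun k => ((k : ℝ) + 1)⁻¹
  have hr0 : ∀ k, 0 < r k := fun k => by positivity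
  have hr1 : ∀ k, r k ≤ 1 := fun k => inv_le_one_of_one_le₀ (by simp)
  have hr : Tendsto r atTop (𝓝 0) := by
    simpa [r] using tendsto_one_div_add_atTop_nhds_zero_nat (𝕜 := ℝ)
  have hcs : ∀ k, ContDiff ℝ ∞ fun x : E n => χ (r k • x) := fun k =>
    hχs.comp (contDiff_const_smul (r k))
  have hd : ∀ k x, fderiv ℝ (fun x : E n => χ (r k • x) * φ x) x v
      = χ (r k • x) * fderiv ℝ φ x v + φ x * (r k * fderiv ℝ χ (r k • x) v) := by
    intro k x
    have e1 : HasFDerivAt (fun x : E n => χ (r k • x))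
        ((fderiv ℝ χ (r k • x)).comp (r k • ContinuousLinearMap.id ℝ (E n))) x :=
      HasFDerivAt.comp x (hχs.differentiable (by simp) _).hasFDerivAt
        ((hasFDerivAt_id x).const_smul (r k))
    have e2 := (hφ.differentiable (by simp) x).hasFDerivAt
    rw [(e1.fun_mul e2).fderiv]
    simp
  have heq : ∀ k, ∫ x, f x * fderiv ℝ (fun x : E n => χ (r k • x) * φ x) x v
      = - ∫ x, inner ℝ (G x) v * (χ (r k • x) * φ x) := by
    intro k
    refine hG.integral_eq _ ((hcs k).mul hφ) ?_ v
    refine HasCompactSupport.mul_right ?_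
    exact hχc.comp_homeomorph (Homeomorph.smulOfNeZero (r k) (hr0 k).ne')
  have hχ1 : ∀ x, |χ x| ≤ 1 := fun x => by rw [abs_of_nonneg (hχ0 x)]; exact hχl x
  have hlim : ∀ x : E n, Tendsto (fun k => χ (r k • x)) atTop (𝓝 1) := by
    intro x
    have : Tendsto (fun k => χ (r k • x)) atTop (𝓝 (χ ((0 : ℝ) • x))) :=
      (hχs.continuous.tendsto _).comp (hr.smul_const x)
    rwa [zero_smul, hχe 0 (by simp)] at this
  have hlimd : ∀ x : E n, Tendsto (fun k => r k * fderiv ℝ χ (r k • x) v) atTop (𝓝 0) := by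
    intro x
    have : Tendsto (fun k => r k * fderiv ℝ χ (r k • x) v) atTop
        (𝓝 (0 * fderiv ℝ χ ((0 : ℝ) • x) v)) :=
      hr.mul ((((hdc.clm_apply continuous_const).tendsto _)).comp (hr.smul_const x))
    simpa using this
  have hL : Tendsto (fun k => ∫ x, f x * fderiv ℝ (fun x : E n => χ (r k • x) * φ x) x v) atTop
      (𝓝 (∫ x, f x * fderiv ℝ φ x v)) := by
    refine tendsto_integral_of_dominated_convergence
      (fun x => ‖f x * fderiv ℝ φ x v‖ + C * ‖v‖ * ‖f x * φ x‖) (fun k => ?_)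
      (h2.norm.add (h1.norm.const_mul _)) (fun k => ae_of_all _ fun x => ?_)
      (ae_of_all _ fun x => ?_)
    · refine hG.locallyIntegrable.aestronglyMeasurable.mul (Continuous.aestronglyMeasurable ?_)
      exact (((hcs k).mul hφ).continuous_fderiv (by simp)).clm_apply continuous_const
    · rw [hd, mul_add]
      refine (norm_add_le _ _).trans (add_le_add ?_ ?_)
      · rw [mul_left_comm, norm_mul]
        have := hχ1 (r k • x)
        rw [← Real.norm_eq_abs] at this
        nlinarith [norm_nonneg (f x * fderiv ℝ φ x v)]
      · rw [← mul_assoc, norm_mul, mul_comm]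
        gcongr
        rw [norm_mul, Real.norm_of_nonneg (hr0 k).le]
        have h4 := (fderiv ℝ χ (r k • x)).le_opNorm v
        have h5 := mul_le_mul_of_nonneg_right (hC (r k • x)) (norm_nonneg v)
        have h6 := norm_nonneg (fderiv ℝ χ (r k • x) v)
        nlinarith [hr1 k, hr0 k]
    · simp only [hd]
      have := (((hlim x).mul_const (fderiv ℝ φ x v)).add ((hlimd x).const_mul (φ x))).const_mul (f x)
      simpa using this
  have hR : Tendsto (fun k => - ∫ x, inner ℝ (G x) v * (χ (r k • x) * φ x)) atTop
      (𝓝 (- ∫ x, inner ℝ (G x) v * φ x)) := by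
    refine (tendsto_integral_of_dominated_convergence
      (fun x => ‖inner ℝ (G x) v * φ x‖) (fun k => ?_) h3.norm (fun k => ae_of_all _ fun x => ?_)
      (ae_of_all _ fun x => ?_)).neg
    · refine AEStronglyMeasurable.mul ?_ (((hcs k).mul hφ).continuous.aestronglyMeasurable)
      exact hG.locallyIntegrable_grad.aestronglyMeasurable.inner aestronglyMeasurable_const
    · rw [mul_left_comm, norm_mul]
      have := hχ1 (r k • x)
      rw [← Real.norm_eq_abs] at this
      nlinarith [norm_nonneg (inner ℝ (G x) v * φ x)]
    · simpa using ((hlim x).mul_const (φ x)).const_mul (inner ℝ (G x) v)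
  exact tendsto_nhds_unique hL (by simpa only [heq] using hR)

lemma fderiv_gaussKer_sub {s : ℝ} (hs : 0 < s) (a w v : E n) :
    fderiv ℝ (fun w => gaussKer s (w - a)) w v = - (inner ℝ (w - a) v / s * gaussKer s (w - a)) := by
  have hd : DifferentiableAt ℝ (fun w : E n => gaussKer s (w - a)) w :=
    ((contDiff_gaussKer s).comp (contDiff_id.sub contDiff_const)).differentiable (by simp) w
  have h1 := hd.hasFDerivAt.hasLineDerivAt v
  have h2 := hasDerivAt_gaussKer hs (w - a) (-v) 0
  have h3 : HasDerivAt (fun t : ℝ => gaussKer s (w + t • v - a))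
      (-(inner ℝ (w - a) v / s * gaussKer s (w - a))) 0 := by
    convert h2 using 1
    · ext t; congr 1; module
    · simp; ring
  exact HasDerivAt.unique (show HasDerivAt _ _ _ from h1) h3

/-- The commutation `∂ᵥ P_ρ f = ρ P_ρ (∂ᵥ f)`: differentiate the kernel in its center, then
integrate by parts to move the derivative onto `f`. The weak derivative of `f` thereby becomes a
classical derivative of `P_ρ f`. -/
lemma hasDerivAt_mehler (hG : HasWeakGradient f G) (hfi : Integrable f (gauss n)) {v : E n}
    (hGi : Integrable (fun x => inner ℝ (G x) v) (gauss n)) {ρ : ℝ} (h0 : 0 < ρ) (h1 : ρ < 1)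
    (y : E n) :
    HasDerivAt (fun t : ℝ => mehler ρ f (y + t • v))
      (ρ * mehler ρ (fun x => inner ℝ (G x) v) y) 0 := by
  obtain ⟨hs, hs1⟩ := one_sub_sq_mem h0 h1
  set s := 1 - ρ ^ 2
  have h := hasDerivAt_integral_mul_gaussKer hfi hs hs1 (ρ • y) (ρ • v)
  have hP : ∀ w : E n, |-(inner ℝ (w - ρ • y) v / s)| ≤ ‖v‖ / s * (1 + ‖w - ρ • y‖) := by
    intro w
    rw [abs_neg, abs_div, abs_of_pos hs, div_mul_eq_mul_div]
    gcongr
    calc |inner ℝ (w - ρ • y) v| ≤ ‖w - ρ • y‖ * ‖v‖ := abs_real_inner_le_norm _ _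
      _ ≤ _ := by nlinarith [norm_nonneg v]
  have hw := hG.integral_eq_of_integrable (φ := fun w => gaussKer s (w - ρ • y))
    ((contDiff_gaussKer s).comp (contDiff_id.sub contDiff_const)) v
    (integrable_mul_gaussKer' hfi hs hs1 (ρ • y))
    (by
      simp_rw [fderiv_gaussKer_sub hs]
      simpa using integrable_mul_gaussKer hfi hs hs1 (ρ • y)
        (P := fun w => -(inner ℝ (w - ρ • y) v / s)) (c := ‖v‖ / s) (by fun_prop) hP)
    (integrable_mul_gaussKer' hGi hs hs1 (ρ • y))
  simp_rw [fderiv_gaussKer_sub hs, mul_neg, integral_neg, neg_inj] at hw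
  rw [mehler_eq h0 h1, ← hw, ← integral_const_mul]
  refine HasDerivAt.congr_deriv (h.congr_of_eventuallyEq (Eventually.of_forall fun t => ?_)) ?_
  · simp only [mehler_eq h0 h1]
    refine integral_congr_ae (ae_of_all _ fun w => ?_)
    simp only
    congr 3
    module
  · refine integral_congr_ae (ae_of_all _ fun w => ?_)
    simp only [real_inner_smul_right]
    ring

/-- Integration by parts against the Gaussian density, whose logarithmic gradient is `-x`. For a
centered `ν` the right-hand side vanishes, which is how centering enters the proof. -/
lemma HasWeakGradient.integral_gauss (hG : HasWeakGradient f G) (hfi : Integrable f (gauss n))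
    {v : E n} (hGi : Integrable (fun x => inner ℝ (G x) v) (gauss n))
    (hxf : Integrable (fun x => f x * inner ℝ x v) (gauss n)) :
    ∫ x, inner ℝ (G x) v ∂(gauss n) = ∫ x, f x * inner ℝ x v ∂(gauss n) := by
  have e : ∀ w : E n, fderiv ℝ (gaussKer 1) w v = -(inner ℝ w v * gaussKer 1 w) := by
    intro w
    have := fderiv_gaussKer_sub (n := n) one_pos 0 w v
    simpa using this
  have hxf' := (integrable_stdGaussian_iff _).1 hxf
  have := hG.integral_eq_of_integrable (contDiff_gaussKer 1) v
    ((integrable_stdGaussian_iff _).1 hfi)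
    (by
      simp_rw [e]
      refine hxf'.neg.congr (ae_of_all _ fun w => ?_)
      simp; ring)
    ((integrable_stdGaussian_iff _).1 hGi)
  rw [integral_stdGaussian, integral_stdGaussian]
  simp_rw [e, mul_neg, integral_neg, neg_inj] at this
  rw [← this]
  congr 1; ext w; ring

end WeakGradient

/-! ### The weak gradient on the zero set. -/

section ZeroSet

variable {n : ℕ} {f : E n → ℝ} {G : E n → E n}

/-- The saturation `ε r / (ε + r)` is at most `ε`, while its derivative tends, as `ε → 0`, to the
indicator of `r = 0` on `r ≥ 0`: composed with `f`, it isolates the gradient on `{f = 0}`. -/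
lemma hasDerivAt_saturation {ε r : ℝ} (hε : 0 < ε) (hr : 0 ≤ r) :
    HasDerivAt (fun r => ε * r / (ε + r)) ((ε / (ε + r)) ^ 2) r := by
  have h1 : HasDerivAt (fun r : ℝ => ε * r) ε r := by simpa using (hasDerivAt_id r).const_mul ε
  have h2 : HasDerivAt (fun r : ℝ => ε + r) 1 r := (hasDerivAt_id r).const_add ε
  refine (h1.fun_div h2 (by positivity)).congr_deriv ?_
  field_simp
  ring

lemma integral_saturation_mehler (hf : ∀ x, 0 ≤ f x) (hG : HasWeakGradient f G)
    (hfi : Integrable f (gauss n)) {v : E n} (hGi : Integrable (fun x => inner ℝ (G x) v) (gauss n))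
    {ρ : ℝ} (h0 : 0 < ρ) (h1 : ρ < 1) {ε : ℝ} (hε : 0 < ε) {φ : E n → ℝ} (hφ : ContDiff ℝ ∞ φ)
    (hφc : HasCompactSupport φ) :
    ∫ x, (ε * mehler ρ f x / (ε + mehler ρ f x)) * fderiv ℝ φ x v
      = - (ρ * ∫ x, (ε / (ε + mehler ρ f x)) ^ 2 * mehler ρ (fun x => inner ℝ (G x) v) x * φ x) := by
  set u := mehler ρ f
  set D := mehler ρ (fun x => inner ℝ (G x) v)
  have hu : Continuous u := continuous_mehler h0 h1 hfi
  have hD : Continuous D := continuous_mehler h0 h1 hGi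
  have hu0 : ∀ x, 0 ≤ u x := mehler_nonneg hf
  have hne : ∀ x, ε + u x ≠ 0 := fun x => by have := hu0 x; positivity
  have hd : Continuous fun x => fderiv ℝ φ x v := (hφ.continuous_fderiv (by simp)).clm_apply continuous_const
  have hdc : HasCompactSupport fun x => fderiv ℝ φ x v := hφc.fderiv_apply (𝕜 := ℝ) v
  have h := integral_bilinear_hasLineDerivAt_right_eq_neg_left_of_integrable (μ := (volume : Measure (E n)))
    (f := fun x => ε * u x / (ε + u x)) (f' := fun x => ρ * ((ε / (ε + u x)) ^ 2 * D x)) (g := φ)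
    (g' := fun x => fderiv ℝ φ x v) (v := v) (B := ContinuousLinearMap.mul ℝ ℝ) ?_ ?_ ?_ ?_ ?_
  · simp only [ContinuousLinearMap.mul_apply'] at h
    rw [h, ← integral_const_mul]
    congr 2; ext x; ring
  · exact Continuous.integrable_of_hasCompactSupport (by fun_prop (disch := exact hne _)) hφc.mul_left
  · exact Continuous.integrable_of_hasCompactSupport (by
      simp only [ContinuousLinearMap.mul_apply']; fun_prop (disch := exact hne _)) hdc.mul_left
  · exact Continuous.integrable_of_hasCompactSupport (by
      simp only [ContinuousLinearMap.mul_apply']; fun_prop (disch := exact hne _)) hφc.mul_left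
  · intro x _
    have h2 := hasDerivAt_mehler hG hfi hGi h0 h1 x
    have h3 := HasDerivAt.comp (0 : ℝ) (h := fun t : ℝ => mehler ρ f (x + t • v))
      (h₂ := fun r => ε * r / (ε + r))
      (hasDerivAt_saturation hε (by simpa using hu0 x)) h2
    simp only [zero_smul, add_zero] at h3
    exact h3.congr_deriv (by ring)
  · intro x _
    exact (hφ.differentiable (by simp) x).hasFDerivAt.hasLineDerivAt v

/-- Test the gradient of the saturation of `f` against `φ`: integration by parts bounds the result
by a multiple of `ε`, whereas it tends to `∫ 1_{f = 0} ∂ᵥf φ`. The chain rule is applied to `P_ρ f`,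
where it is classical, before `ρ → 1`. -/
lemma HasWeakGradient.ae_eq_zero_of_integrable (hfm : Measurable f) (hf : ∀ x, 0 ≤ f x)
    (hG : HasWeakGradient f G)
    (hfi : Integrable f (gauss n)) {v : E n} (hGi : Integrable (fun x => inner ℝ (G x) v) (gauss n)) :
    ∀ᵐ x, f x = 0 → inner ℝ (G x) v = 0 := by
  set D : E n → ℝ := fun x => inner ℝ (G x) v with hD
  have hDl : LocallyIntegrable (({x | f x = 0} : Set (E n)).indicator D) := by
    have : LocallyIntegrable D := by
      intro x
      obtain ⟨s, hs, hi⟩ := hG.locallyIntegrable_grad x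
      exact ⟨s, hs, hi.inner_const v⟩
    intro x
    obtain ⟨s, hs, hi⟩ := this x
    exact ⟨s, hs, hi.indicator (hfm (measurableSet_singleton 0))⟩
  have key := ae_eq_zero_of_integral_contDiff_smul_eq_zero hDl ?_
  · filter_upwards [key] with x hx h0
    rwa [indicator_of_mem (by exact h0)] at hx
  intro φ hφ hφc
  have hφ' : ContDiff ℝ ∞ φ := hφ
  -- Dividing by the Gaussian density passes from Lebesgue measure to `γ`, where the Mehler
  -- operators converge; compact support keeps the quotient bounded.
  let q : E n → ℝ := fun x => φ x / gaussKer 1 x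
  have hq : Continuous q := hφ.continuous.div (continuous_gaussKer 1) fun x => (gaussKer_pos one_pos x).ne'
  have hqc : HasCompactSupport q := by
    have : q = fun x => φ x * (gaussKer 1 x)⁻¹ := by ext; simp [q, div_eq_mul_inv]
    rw [this]; exact hφc.mul_right
  obtain ⟨C, hC⟩ := hq.bounded_above_of_compact_support hqc
  have hC0 : 0 ≤ C := (norm_nonneg _).trans (hC 0)
  have toγ : ∀ F : E n → ℝ, ∫ x, F x * φ x = ∫ x, F x * q x ∂(gauss n) := by
    intro F
    rw [integral_stdGaussian]
    congr 1; ext x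
    have := (gaussKer_pos (V := E n) one_pos x).ne'
    simp only [q]; field_simp
  obtain ⟨r, hr0, hr1, hr2, hr⟩ := exists_seq_tendsto_one
  obtain ⟨ns, hns, hae⟩ := exists_subseq_tendsto_ae
    (fun k => integrable_mehler (hr0 k).le (hr1 k).le hfi) hfi
    (tendsto_integral_abs_mehler_sub (fun k => (hr0 k).le) (fun k => (hr1 k).le) hr hfi)
  have hDlim := (tendsto_integral_abs_mehler_sub (fun k => (hr0 k).le) (fun k => (hr1 k).le) hr hGi).comp
    hns.tendsto_atTop
  set K := ∫ x, |fderiv ℝ φ x v|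
  have hd : Continuous fun x => fderiv ℝ φ x v := (hφ'.continuous_fderiv (by simp)).clm_apply continuous_const
  have hdi : Integrable fun x => fderiv ℝ φ x v :=
    hd.integrable_of_hasCompactSupport (hφc.fderiv_apply (𝕜 := ℝ) v)
  have hfr : ∀ {ε a : ℝ}, 0 < ε → 0 ≤ a → |(ε / (ε + a)) ^ 2| ≤ 1 := by
    intro ε a hε ha
    rw [abs_of_nonneg (by positivity)]
    exact pow_le_one₀ (by positivity) ((div_le_one (by positivity)).2 (by linarith))
  have hDq : Integrable (fun x => D x * q x) (gauss n) :=
    hGi.mul_bdd (c := C) hq.aestronglyMeasurable (ae_of_all _ hC)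
  -- the bound for a fixed level
  have hε : ∀ ε : ℝ, 0 < ε → |∫ x, (ε / (ε + f x)) ^ 2 * D x * q x ∂(gauss n)| ≤ 2 * ε * K := by
    intro ε hε
    -- The weights, bounded by `1`, converge almost everywhere along the subsequence and the factor
    -- `P_ρ D` converges in `L¹(γ)`; the two limits are taken one at a time.
    have hlim : Tendsto (fun k => ∫ x, (ε / (ε + mehler (r (ns k)) f x)) ^ 2
        * mehler (r (ns k)) D x * q x ∂(gauss n)) atTop
        (𝓝 (∫ x, (ε / (ε + f x)) ^ 2 * D x * q x ∂(gauss n))) := by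
      have hmu : ∀ k, Continuous fun x => (ε / (ε + mehler (r k) f x)) ^ 2 := by
        intro k
        have := continuous_mehler (hr0 k) (hr1 k) hfi
        have h2 : ∀ x, ε + mehler (r k) f x ≠ 0 := fun x => by
          have := mehler_nonneg (ρ := r k) hf x; positivity
        fun_prop (disch := exact h2 _)
      have hA : Tendsto (fun k => ∫ x, (ε / (ε + mehler (r (ns k)) f x)) ^ 2 * (D x * q x) ∂(gauss n))
          atTop (𝓝 (∫ x, (ε / (ε + f x)) ^ 2 * (D x * q x) ∂(gauss n))) := by
        refine tendsto_integral_of_dominated_convergence (fun x => ‖D x * q x‖) (fun k => ?_)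
          hDq.norm (fun k => ae_of_all _ fun x => ?_) ?_
        · exact (hmu _).aestronglyMeasurable.mul hDq.1
        · rw [norm_mul, Real.norm_eq_abs]
          exact mul_le_of_le_one_left (norm_nonneg _) (hfr hε (mehler_nonneg hf x))
        · filter_upwards [hae] with x hx
          have hne : ε + f x ≠ 0 := by have := hf x; positivity
          exact (((tendsto_const_nhds.div (hx.const_add ε) hne)).pow 2).mul_const _
      have hB : Tendsto (fun k => ∫ x, (ε / (ε + mehler (r (ns k)) f x)) ^ 2
          * (mehler (r (ns k)) D x - D x) * q x ∂(gauss n)) atTop (𝓝 0) := by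
        refine squeeze_zero_norm (fun k => ?_) (by simpa using hDlim.const_mul C)
        rw [← integral_const_mul]
        refine norm_integral_le_of_norm_le
          ((((integrable_mehler (hr0 _).le (hr1 _).le hGi).sub hGi).abs).const_mul C)
          (ae_of_all _ fun x => ?_)
        rw [norm_mul, norm_mul, Real.norm_eq_abs, Real.norm_eq_abs]
        have h1 := hfr hε (mehler_nonneg (ρ := r (ns k)) hf x)
        calc _ ≤ 1 * |mehler (r (ns k)) D x - D x| * C := by gcongr; exact hC x
          _ = _ := by simp; ring
      have hAB := hA.add hB
      rw [add_zero] at hAB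
      simp only [← mul_assoc (_ ^ 2)] at hAB
      refine hAB.congr fun k => ?_
      rw [← integral_add]
      · congr 1; ext x; ring
      · simp only [mul_assoc]
        exact hDq.bdd_mul (c := 1) (hmu _).aestronglyMeasurable
          (ae_of_all _ fun x => hfr hε (mehler_nonneg hf x))
      · refine Integrable.mul_bdd (c := C) ?_ hq.aestronglyMeasurable (ae_of_all _ hC)
        exact ((integrable_mehler (hr0 _).le (hr1 _).le hGi).sub hGi).bdd_mul (c := 1)
          (hmu _).aestronglyMeasurable (ae_of_all _ fun x => hfr hε (mehler_nonneg hf x))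
    refine le_of_tendsto (hlim.abs) (Eventually.of_forall fun k => ?_)
    have h := integral_saturation_mehler hf hG hfi hGi (hr0 (ns k)) (hr1 (ns k)) hε hφ' hφc
    rw [toγ] at h
    have hb : |∫ x, (ε * mehler (r (ns k)) f x / (ε + mehler (r (ns k)) f x)) * fderiv ℝ φ x v|
        ≤ ε * K := by
      rw [← integral_const_mul, ← Real.norm_eq_abs]
      refine norm_integral_le_of_norm_le (hdi.abs.const_mul ε) (ae_of_all _ fun x => ?_)
      have hu := mehler_nonneg (ρ := r (ns k)) hf x
      rw [norm_mul, Real.norm_eq_abs, Real.norm_eq_abs, abs_of_nonneg (by positivity)]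
      gcongr
      rw [div_le_iff₀ (by positivity)]
      nlinarith
    rw [h, abs_neg, abs_mul, abs_of_pos (hr0 _)] at hb
    -- Integration by parts leaves a factor `ρ` on the left; `ρ ≥ 1/2` accounts for the `2` in the
    -- bound.
    have := hr2 (ns k)
    have h0 := abs_nonneg (∫ x, (ε / (ε + mehler (r (ns k)) f x)) ^ 2
        * mehler (r (ns k)) D x * q x ∂(gauss n))
    nlinarith
  have hlim2 : Tendsto (fun m : ℕ => ∫ x, ((1 / ((m : ℝ) + 1)) / ((1 / ((m : ℝ) + 1)) + f x)) ^ 2 * D x * q x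
      ∂(gauss n)) atTop (𝓝 (∫ x, ({x | f x = 0} : Set (E n)).indicator D x * q x ∂(gauss n))) := by
    simp only [mul_assoc]
    refine tendsto_integral_of_dominated_convergence (fun x => ‖D x * q x‖) (fun k => ?_)
      hDq.norm (fun k => ae_of_all _ fun x => ?_) (ae_of_all _ fun x => ?_)
    · exact (by fun_prop : Measurable _).aestronglyMeasurable.mul hDq.1
    · rw [norm_mul, Real.norm_eq_abs]
      exact mul_le_of_le_one_left (norm_nonneg _) (hfr (by positivity) (hf x))
    · by_cases hx : f x = 0
      · rw [indicator_of_mem (by exact hx)]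
        refine tendsto_const_nhds.congr fun m => ?_
        have : (1 / ((m : ℝ) + 1)) ≠ 0 := by positivity
        rw [hx, add_zero, div_self this]; ring
      · rw [indicator_of_notMem (by exact hx), zero_mul]
        have h1 : Tendsto (fun m : ℕ => (1 / ((m : ℝ) + 1)) / ((1 / ((m : ℝ) + 1)) + f x)) atTop
            (𝓝 (0 / (0 + f x))) :=
          (tendsto_one_div_add_atTop_nhds_zero_nat (𝕜 := ℝ)).div
            ((tendsto_one_div_add_atTop_nhds_zero_nat (𝕜 := ℝ)).add_const _) (by simpa using hx)
        simpa using (h1.pow 2).mul_const (D x * q x)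
  have hz : ∫ x, ({x | f x = 0} : Set (E n)).indicator D x * q x ∂(gauss n) = 0 := by
    have h0 : Tendsto (fun m : ℕ => 2 * (1 / ((m : ℝ) + 1)) * K) atTop (𝓝 0) := by
      have := ((tendsto_one_div_add_atTop_nhds_zero_nat (𝕜 := ℝ)).const_mul 2).mul_const K
      rwa [mul_zero, zero_mul] at this
    exact tendsto_nhds_unique hlim2
      (squeeze_zero_norm (fun m : ℕ => hε (1 / ((m : ℝ) + 1)) (by positivity)) h0)
  rw [← toγ] at hz
  simpa only [smul_eq_mul, mul_comm] using hz

lemma HasWeakGradient.mul_cutoff (hG : HasWeakGradient f G) {χ : E n → ℝ} (hχ : ContDiff ℝ ∞ χ)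
    (hχc : HasCompactSupport χ) :
    HasWeakGradient (fun x => χ x * f x) (fun x => χ x • G x + f x • gradient χ x) := by
  have hgc : Continuous (gradient χ) :=
    (InnerProductSpace.toDual ℝ (E n)).symm.continuous.comp (hχ.continuous_fderiv (by simp))
  have hgs : HasCompactSupport (gradient χ) :=
    (hχc.fderiv (𝕜 := ℝ)).comp_left (g := (InnerProductSpace.toDual ℝ (E n)).symm) (map_zero _)
  have i1 : Integrable fun x => χ x * f x :=
    hG.locallyIntegrable.integrable_smul_left_of_hasCompactSupport hχ.continuous hχc
  have i2 : Integrable fun x => χ x • G x :=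
    hG.locallyIntegrable_grad.integrable_smul_left_of_hasCompactSupport hχ.continuous hχc
  have i3 : Integrable fun x => f x • gradient χ x :=
    hG.locallyIntegrable.integrable_smul_right_of_hasCompactSupport hgc hgs
  refine ⟨i1.locallyIntegrable, (i2.add i3).locallyIntegrable, fun φ hφ hφc v => ?_⟩
  have h := hG.integral_eq _ (hχ.mul hφ) hφc.mul_left v
  have hd : ∀ x, fderiv ℝ (fun x => χ x * φ x) x v = χ x * fderiv ℝ φ x v + φ x * fderiv ℝ χ x v := by
    intro x
    rw [((hχ.differentiable (by simp) x).hasFDerivAt.fun_mul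
      (hφ.differentiable (by simp) x).hasFDerivAt).fderiv]
    simp
  have hg : ∀ x, inner ℝ (gradient χ x) v = fderiv ℝ χ x v := fun x =>
    InnerProductSpace.toDual_symm_apply
  have hφb : ∃ C, ∀ x, ‖φ x‖ ≤ C := hφ.continuous.bounded_above_of_compact_support hφc
  obtain ⟨C, hC⟩ := hφb
  have hdφ : Continuous fun x => fderiv ℝ φ x v := (hφ.continuous_fderiv (by simp)).clm_apply continuous_const
  obtain ⟨C', hC'⟩ := hdφ.bounded_above_of_compact_support (hφc.fderiv_apply (𝕜 := ℝ) v)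
  have j1 : Integrable fun x => χ x * f x * fderiv ℝ φ x v :=
    i1.mul_bdd (c := C') hdφ.aestronglyMeasurable (ae_of_all _ hC')
  have j2 : Integrable fun x => inner ℝ (χ x • G x) v * φ x :=
    (i2.inner_const v).mul_bdd (c := C) hφ.continuous.aestronglyMeasurable (ae_of_all _ hC)
  have j3 : Integrable fun x => inner ℝ (f x • gradient χ x) v * φ x :=
    (i3.inner_const v).mul_bdd (c := C) hφ.continuous.aestronglyMeasurable (ae_of_all _ hC)
  have e1 : ∫ x, f x * fderiv ℝ (fun x => χ x * φ x) x v
      = (∫ x, χ x * f x * fderiv ℝ φ x v) + ∫ x, inner ℝ (f x • gradient χ x) v * φ x := by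
    rw [← integral_add j1 j3]
    congr 1; ext x
    rw [hd, real_inner_smul_left, hg]; ring
  have e2 : ∫ x, inner ℝ (χ x • G x + f x • gradient χ x) v * φ x
      = (∫ x, inner ℝ (χ x • G x) v * φ x) + ∫ x, inner ℝ (f x • gradient χ x) v * φ x := by
    rw [← integral_add j2 j3]
    congr 1; ext x
    rw [inner_add_left]; ring
  have e3 : ∫ x, inner ℝ (G x) v * (χ x * φ x) = ∫ x, inner ℝ (χ x • G x) v * φ x := by
    congr 1; ext x; rw [real_inner_smul_left]; ring
  change ∫ x, f x * fderiv ℝ (fun x => χ x * φ x) x v = - ∫ x, inner ℝ (G x) v * (χ x * φ x) at h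
  rw [e1, e3] at h
  rw [e2]; linarith

lemma integrable_gauss_of_integrable {F : E n → ℝ} (hF : Integrable F) : Integrable F (gauss n) := by
  rw [integrable_stdGaussian_iff]
  refine hF.mul_bdd (c := (2 * Real.pi * 1) ^ (-(finrank ℝ (E n) : ℝ) / 2))
    (continuous_gaussKer 1).aestronglyMeasurable (ae_of_all _ fun x => ?_)
  rw [Real.norm_of_nonneg (gaussKer_pos one_pos x).le, gaussKer]
  refine mul_le_of_le_one_right (by positivity) (Real.exp_le_one_iff.2 ?_)
  have := sq_nonneg ‖x‖
  linarith

/-- The weak gradient of a nonnegative function vanishes almost everywhere on its zero set. -/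
lemma HasWeakGradient.ae_eq_zero (hfm : Measurable f) (hf : ∀ x, 0 ≤ f x)
    (hG : HasWeakGradient f G) (v : E n) : ∀ᵐ x, f x = 0 → inner ℝ (G x) v = 0 := by
  obtain ⟨χ, hχs, hχc, hχ0, hχ1, hχe⟩ := exists_smooth_cutoff n
  have key : ∀ N : ℕ, ∀ᵐ x : E n, ‖x‖ < N + 1 → f x = 0 → inner ℝ (G x) v = 0 := by
    intro N
    -- The localized density is integrable and its cutoff equals `1` for `‖x‖ < N + 1`. Where `f =
    -- 0`, the extra term `f ∇χ` of its gradient vanishes.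
    set r : ℝ := ((N : ℝ) + 1)⁻¹
    have hr : 0 < r := by positivity
    have hs : ContDiff ℝ ∞ fun x : E n => χ (r • x) := hχs.comp (contDiff_const_smul r)
    have hc : HasCompactSupport fun x : E n => χ (r • x) :=
      hχc.comp_homeomorph (Homeomorph.smulOfNeZero r hr.ne')
    have hw := hG.mul_cutoff hs hc
    have i1 : Integrable fun x => χ (r • x) * f x :=
      hG.locallyIntegrable.integrable_smul_left_of_hasCompactSupport hs.continuous hc
    have hgc : Continuous (gradient fun x : E n => χ (r • x)) :=
      (InnerProductSpace.toDual ℝ (E n)).symm.continuous.comp (hs.continuous_fderiv (by simp))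
    have hgs : HasCompactSupport (gradient fun x : E n => χ (r • x)) :=
      (hc.fderiv (𝕜 := ℝ)).comp_left (g := (InnerProductSpace.toDual ℝ (E n)).symm) (map_zero _)
    have i2 := (hG.locallyIntegrable_grad.integrable_smul_left_of_hasCompactSupport hs.continuous hc).add
      (hG.locallyIntegrable.integrable_smul_right_of_hasCompactSupport hgc hgs)
    have := hw.ae_eq_zero_of_integrable ((hs.continuous.measurable).mul hfm)
      (fun x => mul_nonneg (hχ0 _) (hf x)) (integrable_gauss_of_integrable i1)
      (integrable_gauss_of_integrable (i2.inner_const v))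
    filter_upwards [this] with x hx hxN h0
    have h1 := hx (by rw [Pi.mul_apply, h0, mul_zero])
    rw [h0, zero_smul, add_zero, hχe, one_smul] at h1
    · exact h1
    · rw [norm_smul, Real.norm_of_nonneg hr.le, inv_mul_le_iff₀ (by positivity)]
      linarith
  filter_upwards [ae_all_iff.2 key] with x hx h0
  obtain ⟨N, hN⟩ := exists_nat_gt ‖x‖
  exact hx N (by linarith) h0

end ZeroSet

/-! ### Fatou's lemma for real integrals. -/

lemma integrable_of_lintegral_ofReal_le {α : Type*} [MeasurableSpace α] {μ : Measure α} {F : α → ℝ}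
    (hF : AEStronglyMeasurable F μ) (h0 : ∀ᵐ x ∂μ, 0 ≤ F x) {c : ℝ} (hc : 0 ≤ c)
    (h : ∫⁻ x, ENNReal.ofReal (F x) ∂μ ≤ ENNReal.ofReal c) :
    Integrable F μ ∧ ∫ x, F x ∂μ ≤ c := by
  have hi : Integrable F μ := by
    refine ⟨hF, ?_⟩
    rw [hasFiniteIntegral_iff_ofReal h0]
    exact h.trans_lt ENNReal.ofReal_lt_top
  refine ⟨hi, ?_⟩
  rw [← ofReal_integral_eq_lintegral_ofReal hi h0] at h
  exact (ENNReal.ofReal_le_ofReal_iff hc).1 h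

lemma integrable_of_tendsto_of_integral_le {α : Type*} [MeasurableSpace α] {μ : Measure α}
    {u : ℕ → α → ℝ} {F : α → ℝ} (hu : ∀ k, Integrable (u k) μ) (hu0 : ∀ k, ∀ᵐ x ∂μ, 0 ≤ u k x)
    (hlim : ∀ᵐ x ∂μ, Tendsto (fun k => u k x) atTop (𝓝 (F x))) {c : ℝ}
    (hc : ∀ k, ∫ x, u k x ∂μ ≤ c) : Integrable F μ ∧ ∫ x, F x ∂μ ≤ c := by
  have hF0 : ∀ᵐ x ∂μ, 0 ≤ F x := by
    filter_upwards [hlim, ae_all_iff.2 hu0] with x hx h0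
    exact ge_of_tendsto' hx h0
  refine integrable_of_lintegral_ofReal_le
    (aestronglyMeasurable_of_tendsto_ae atTop (fun k => (hu k).1) hlim) hF0
    ((integral_nonneg_of_ae (hu0 0)).trans (hc 0)) ?_
  calc ∫⁻ x, ENNReal.ofReal (F x) ∂μ
      = ∫⁻ x, liminf (fun k => ENNReal.ofReal (u k x)) atTop ∂μ := by
        refine lintegral_congr_ae ?_
        filter_upwards [hlim] with x hx
        exact (ENNReal.tendsto_ofReal hx).liminf_eq.symm
    _ ≤ liminf (fun k => ∫⁻ x, ENNReal.ofReal (u k x) ∂μ) atTop :=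
        lintegral_liminf_le' fun k => (hu k).1.aemeasurable.ennreal_ofReal
    _ ≤ ENNReal.ofReal c := by
        refine liminf_le_of_frequently_le' (Frequently.of_forall fun k => ?_)
        rw [← ofReal_integral_eq_lintegral_ofReal (hu k) (hu0 k)]
        exact ENNReal.ofReal_le_ofReal (hc k)

/-! ### Contraction of the Fisher information under a Poincaré inequality. -/

section Contraction

variable {n : ℕ} {f : E n → ℝ}

lemma integral_inner_sq_gauss (v : E n) : Integrable (fun z => inner ℝ z v ^ 2) (gauss n) ∧
    ∫ z, inner ℝ z v ^ 2 ∂(gauss n) = ‖v‖ ^ 2 := by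
  have h1 := variance_dual_stdGaussian (innerSL ℝ v)
  have h2 : MemLp (innerSL ℝ v) 2 (gauss n) := IsGaussian.memLp_dual _ _ _ (by simp)
  have h3 := h2.integrable_sq
  rw [variance_of_integral_eq_zero h2.1.aemeasurable (integral_strongDual_stdGaussian _),
    innerSL_apply_norm] at h1
  simp only [innerSL_apply_apply] at h1 h3
  refine ⟨h3.congr (ae_of_all _ fun z => ?_), ?_⟩
  · simp only; rw [real_inner_comm]
  · rw [← h1]; congr 1; ext z; rw [real_inner_comm]

lemma abs_mehler_le (ρ : ℝ) {m : E n → ℝ} {C : ℝ} (hm : ∀ x, |m x| ≤ C) (x : E n) :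
    |mehler ρ m x| ≤ C := by
  have := norm_integral_le_of_norm_le_const (μ := gauss n)
    (f := fun z => m (ρ • x + √(1 - ρ ^ 2) • z)) (ae_of_all _ fun z => hm _)
  rwa [probReal_univ, mul_one] at this

/-- Smoothness makes `P_ρ m`, once centered, admissible in the Poincaré inequality. As `m` vanishes
outside a ball, near a given point the Gaussian kernel may be cut off at large distance without
changing the integral, which reduces to convolution with a smooth compactly supported kernel. -/
lemma contDiff_mehler_of_bounded {ρ : ℝ} (h0 : 0 < ρ) (h1 : ρ < 1) {m : E n → ℝ} {R C : ℝ}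
    (hm : Measurable m) (hmC : ∀ x, |m x| ≤ C) (hmR : ∀ x, R < ‖x‖ → m x = 0) :
    ContDiff ℝ ∞ (mehler ρ m) := by
  obtain ⟨hs, hs1⟩ := one_sub_sq_mem h0 h1
  set s := 1 - ρ ^ 2
  obtain ⟨χ, hχs, hχc, hχ0, hχ1, hχe⟩ := exists_smooth_cutoff n
  have hmi : Integrable m := by
    have hs : m = (Metric.closedBall (0 : E n) R).indicator m := by
      ext x
      by_cases hx : x ∈ Metric.closedBall (0 : E n) R
      · rw [indicator_of_mem hx]
      · rw [indicator_of_notMem hx, hmR x (by simpa using hx)]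
    rw [hs, integrable_indicator_iff measurableSet_closedBall]
    exact Measure.integrableOn_of_bounded (M := C) measure_closedBall_lt_top.ne hm.aestronglyMeasurable
      (ae_of_all _ hmC)
  rw [contDiff_iff_contDiffAt]
  intro x₀
  -- The cutoff equals `1` at every `ρx - w` with `‖x‖ ≤ ‖x₀‖ + 1` and `‖w‖ ≤ R`, because `ρ < 1`.
  set r : ℝ := (|R| + ‖x₀‖ + 1)⁻¹ with hr
  have hrpos : 0 < r := by positivity
  have hk : ContDiff ℝ ∞ fun u : E n => χ (r • u) * gaussKer s u :=
    (hχs.comp (contDiff_const_smul r)).mul (contDiff_gaussKer s)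
  have hkc : HasCompactSupport fun u : E n => χ (r • u) * gaussKer s u :=
    (hχc.comp_homeomorph (Homeomorph.smulOfNeZero r hrpos.ne')).mul_right
  have hconv := HasCompactSupport.contDiff_convolution_right (ContinuousLinearMap.mul ℝ ℝ)
    (μ := volume) (n := ⊤) hkc hmi.locallyIntegrable hk
  have hcomp := (hconv.comp (contDiff_const_smul ρ)).contDiffAt (x := x₀)
  refine hcomp.congr_of_eventuallyEq ?_
  filter_upwards [Metric.ball_mem_nhds x₀ one_pos] with x hx
  rw [mehler_eq h0 h1, Function.comp_apply, convolution_def]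
  refine integral_congr_ae (ae_of_all _ fun w => ?_)
  simp only [ContinuousLinearMap.mul_apply']
  by_cases hw : R < ‖w‖
  · rw [hmR w hw]; simp
  · have e : gaussKer s (ρ • x - w) = gaussKer s (w - ρ • x) := by
      unfold gaussKer; rw [norm_sub_rev]
    rw [hχe, one_mul, e]
    rw [norm_smul, Real.norm_of_nonneg hrpos.le, hr, inv_mul_le_iff₀ (by positivity), mul_one]
    have h2 : ‖x‖ ≤ ‖x₀‖ + 1 := by
      have h3 : ‖x - x₀‖ < 1 := by simpa [dist_eq_norm] using hx
      have h4 : ‖x‖ ≤ ‖x - x₀‖ + ‖x₀‖ := by simpa using norm_add_le (x - x₀) x₀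
      linarith
    have h5 : ‖ρ • x - w‖ ≤ ‖ρ • x‖ + ‖w‖ := norm_sub_le _ _
    rw [norm_smul, Real.norm_of_nonneg h0.le] at h5
    have h6 := le_abs_self R
    nlinarith [norm_nonneg x]

/-- The reverse local Poincaré inequality. The derivative of `P_ρ m` along `v` is `(ρ/σ)` times the
covariance of `m(ρx + σZ)` with `⟨Z, v⟩`, and the latter has variance `‖v‖²`; Cauchy-Schwarz with
`v` the gradient itself concludes. -/
lemma norm_gradient_mehler_sq_le {ρ : ℝ} (h0 : 0 < ρ) (h1 : ρ < 1) {m : E n → ℝ} {R C : ℝ}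
    (hm : Measurable m) (hmC : ∀ x, |m x| ≤ C) (hmR : ∀ x, R < ‖x‖ → m x = 0) (x : E n) :
    ‖gradient (mehler ρ m) x‖ ^ 2
      ≤ ρ ^ 2 / (1 - ρ ^ 2) * (mehler ρ (fun y => m y ^ 2) x - mehler ρ m x ^ 2) := by
  have hcd := contDiff_mehler_of_bounded h0 h1 hm hmC hmR
  obtain ⟨hs, hs1⟩ := one_sub_sq_mem h0 h1
  set v := gradient (mehler ρ m) x
  set h := mehler ρ m x with hh
  set s := 1 - ρ ^ 2 with hsd
  set σ := √s with hσd
  have hσ : 0 < σ := Real.sqrt_pos.2 hs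
  have hσ2 : σ ^ 2 = s := Real.sq_sqrt hs.le
  have hmi : Integrable m (gauss n) := Integrable.of_bound hm.aestronglyMeasurable C (ae_of_all _ hmC)
  have hXm : Measurable fun z => m (ρ • x + σ • z) := by fun_prop
  have hXi : Integrable (fun z => m (ρ • x + σ • z)) (gauss n) :=
    Integrable.of_bound hXm.aestronglyMeasurable C (ae_of_all _ fun _ => hmC _)
  have hX2 : Integrable (fun z => m (ρ • x + σ • z) ^ 2) (gauss n) :=
    Integrable.of_bound (hXm.pow_const 2).aestronglyMeasurable (C ^ 2) (ae_of_all _ fun z => by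
      rw [Real.norm_eq_abs, abs_pow]; exact pow_le_pow_left₀ (abs_nonneg _) (hmC _) 2)
  obtain ⟨hvi, hvn⟩ := integral_inner_sq_gauss v
  have hv1 : Integrable (fun z : E n => inner ℝ z v) (gauss n) :=
    (IsGaussian.integrable_id (μ := gauss n)).inner_const v
  have hv0 : ∫ z : E n, inner ℝ z v ∂(gauss n) = 0 := by
    have := integral_strongDual_stdGaussian (innerSL ℝ v)
    simpa [real_inner_comm] using this
  have hXv : Integrable (fun z => m (ρ • x + σ • z) * inner ℝ z v) (gauss n) :=
    hv1.bdd_mul (c := C) hXm.aestronglyMeasurable (ae_of_all _ fun _ => hmC _)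
  -- the derivative in the direction of the gradient
  have hder : ‖v‖ ^ 2 = ρ / σ * ∫ z, m (ρ • x + σ • z) * inner ℝ z v ∂(gauss n) := by
    have e1 : HasDerivAt (fun t : ℝ => mehler ρ m (x + t • v)) (‖v‖ ^ 2) 0 := by
      have := (hcd.differentiable (by simp) x).hasGradientAt.hasFDerivAt.hasLineDerivAt v
      have h2 : HasDerivAt (fun t : ℝ => mehler ρ m (x + t • v)) _ 0 := this
      refine h2.congr_deriv ?_
      rw [← real_inner_self_eq_norm_sq]
      exact InnerProductSpace.toDual_apply_apply
    have e2 := hasDerivAt_integral_mul_gaussKer hmi hs hs1 (ρ • x) (ρ • v)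
    have e3 : (fun t : ℝ => ∫ w, m w * gaussKer s (w - (ρ • x + t • ρ • v)))
        = fun t : ℝ => mehler ρ m (x + t • v) := by
      ext t
      rw [mehler_eq h0 h1]
      congr 1; ext w; congr 3; module
    rw [e3] at e2
    rw [e1.unique e2]
    have e4 := integral_comp_affine_stdGaussian hσ (ρ • x)
      (fun w => m w * (inner ℝ (w - ρ • x) (ρ • v) / s))
    rw [hσ2] at e4
    simp only [mul_assoc] at e4
    rw [← e4, ← integral_const_mul]
    congr 1; ext z
    rw [add_sub_cancel_left, real_inner_smul_left, real_inner_smul_right, ← hσ2]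
    field_simp
  have hcen : ‖v‖ ^ 2 = ρ / σ * ∫ z, (m (ρ • x + σ • z) - h) * inner ℝ z v ∂(gauss n) := by
    rw [hder]
    congr 1
    simp only [sub_mul]
    rw [integral_sub hXv (hv1.const_mul h), integral_const_mul, hv0, mul_zero, sub_zero]
  have hvar : ∫ z, (m (ρ • x + σ • z) - h) ^ 2 ∂(gauss n)
      = mehler ρ (fun y => m y ^ 2) x - h ^ 2 := by
    have e : ∀ z, (m (ρ • x + σ • z) - h) ^ 2
      = m (ρ • x + σ • z) ^ 2 - 2 * h * m (ρ • x + σ • z) + h ^ 2 := fun z => by ring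
    simp_rw [e]
    have i2 : Integrable (fun z => m (ρ • x + σ • z) ^ 2 - 2 * h * m (ρ • x + σ • z)) (gauss n) :=
      hX2.sub (hXi.const_mul _)
    rw [integral_add i2 (integrable_const _), integral_sub hX2 (hXi.const_mul _), integral_const_mul,
      integral_const]
    have : ∫ z, m (ρ • x + σ • z) ∂(gauss n) = h := rfl
    rw [this]
    simp only [mehler, probReal_univ, smul_eq_mul]
    ring
  have hvi2 : Integrable (fun z => (m (ρ • x + σ • z) - h) ^ 2) (gauss n) := by
    have e : ∀ z, (m (ρ • x + σ • z) - h) ^ 2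
      = m (ρ • x + σ • z) ^ 2 - 2 * h * m (ρ • x + σ • z) + h ^ 2 := fun z => by ring
    simp_rw [e]
    exact (hX2.sub (hXi.const_mul _)).add (integrable_const _)
  -- Cauchy-Schwarz in the form of Young's inequality; half of `‖v‖²` is absorbed on the left
  -- afterwards.
  have hle : ρ / σ * ∫ z, (m (ρ • x + σ • z) - h) * inner ℝ z v ∂(gauss n)
      ≤ 1 / 2 * (ρ ^ 2 / s) * ∫ z, (m (ρ • x + σ • z) - h) ^ 2 ∂(gauss n) + 1 / 2 * ‖v‖ ^ 2 := by
    rw [← hvn, ← integral_const_mul, ← integral_const_mul, ← integral_const_mul,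
      ← integral_add (hvi2.const_mul _) (hvi.const_mul _)]
    refine integral_mono ?_ ((hvi2.const_mul _).add (hvi.const_mul _)) fun z => ?_
    · refine Integrable.const_mul ?_ _
      simp only [sub_mul]
      exact hXv.sub (hv1.const_mul h)
    · simp only
      have e : ρ ^ 2 / s = (ρ / σ) ^ 2 := by rw [div_pow, hσ2]
      rw [e]
      nlinarith [sq_nonneg (ρ / σ * (m (ρ • x + σ • z) - h) - inner ℝ z v)]
  rw [← hvar]
  linarith

lemma integral_withDensity_gauss (hfm : Measurable f) (hf : ∀ x, 0 ≤ f x) (g : E n → ℝ) :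
    ∫ x, g x ∂((gauss n).withDensity fun x => ENNReal.ofReal (f x)) = ∫ x, f x * g x ∂(gauss n) := by
  rw [integral_withDensity_eq_integral_toReal_smul (by fun_prop) (by simp)]
  congr 1; ext x
  rw [ENNReal.toReal_ofReal (hf x), smul_eq_mul]

/-- The gradient bound contributes `-∫ (P_ρ m)² dν`, which is at most minus the variance. Moving
this to the left adds `ρ²/(1 - ρ²)` to the Poincaré constant `l`, and solving for the variance gives
the factor. -/
lemma variance_mehler_le {l : ℝ} (hl : 0 < l) (hfm : Measurable f) (hf : ∀ x, 0 ≤ f x)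
    (hfi : Integrable f (gauss n)) (hf1 : ∫ x, f x ∂(gauss n) = 1)
    (hpoin : SatisfiesPoincare ((gauss n).withDensity fun x => ENNReal.ofReal (f x)) l)
    {ρ : ℝ} (h0 : 0 < ρ) (h1 : ρ < 1) {m : E n → ℝ} {R C : ℝ}
    (hm : Measurable m) (hmC : ∀ x, |m x| ≤ C) (hmR : ∀ x, R < ‖x‖ → m x = 0) :
    ∫ x, f x * (mehler ρ m x - ∫ y, f y * mehler ρ m y ∂(gauss n)) ^ 2 ∂(gauss n)
      ≤ ρ ^ 2 / (ρ ^ 2 + l * (1 - ρ ^ 2)) * ∫ x, mehler ρ f x * m x ^ 2 ∂(gauss n) := by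
  have hcd := contDiff_mehler_of_bounded h0 h1 hm hmC hmR
  obtain ⟨hs, hs1⟩ := one_sub_sq_mem h0 h1
  set ν := (gauss n).withDensity fun x => ENNReal.ofReal (f x) with hν
  set h := mehler ρ m with hh
  set hb := ∫ y, f y * h y ∂(gauss n)
  set s := 1 - ρ ^ 2 with hsd
  have hC0 : 0 ≤ C := (abs_nonneg _).trans (hmC 0)
  have hprob : IsProbabilityMeasure ν := ⟨by
    rw [hν, withDensity_apply _ MeasurableSet.univ, setLIntegral_univ,
      ← ofReal_integral_eq_lintegral_ofReal hfi (ae_of_all _ hf), hf1, ENNReal.ofReal_one]⟩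
  have hhC : ∀ x, |h x| ≤ C := abs_mehler_le ρ hmC
  have hm2C : ∀ x, |m x ^ 2| ≤ C ^ 2 := fun x => by
    rw [abs_pow]; exact pow_le_pow_left₀ (abs_nonneg _) (hmC x) 2
  have hm2i : Integrable (fun x => m x ^ 2) (gauss n) :=
    Integrable.of_bound (hm.pow_const 2).aestronglyMeasurable (C ^ 2) (ae_of_all _ hm2C)
  set q := mehler ρ (fun y => m y ^ 2)
  have hqc : Continuous q := continuous_mehler h0 h1 hm2i
  have hqC : ∀ x, |q x| ≤ C ^ 2 := abs_mehler_le ρ hm2C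
  have hhi : Integrable h ν := Integrable.of_bound hcd.continuous.aestronglyMeasurable C (ae_of_all _ hhC)
  have hhi2 : Integrable (fun x => h x ^ 2) ν :=
    Integrable.of_bound (hcd.continuous.pow 2).aestronglyMeasurable (C ^ 2) (ae_of_all _ fun x => by
      rw [Real.norm_eq_abs, abs_pow]; exact pow_le_pow_left₀ (abs_nonneg _) (hhC x) 2)
  have hqi : Integrable q ν := Integrable.of_bound hqc.aestronglyMeasurable (C ^ 2) (ae_of_all _ hqC)
  have hbar : ∫ x, h x ∂ν = hb := integral_withDensity_gauss hfm hf h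
  set g := fun x => h x - hb with hg
  have hgc : ContDiff ℝ ∞ g := hcd.sub contDiff_const
  have hgi : Integrable g ν := hhi.sub (integrable_const _)
  have hg0 : ∫ x, g x ∂ν = 0 := by
    rw [hg, integral_sub hhi (integrable_const _), hbar]; simp
  have e2 : ∀ x, g x ^ 2 = h x ^ 2 - 2 * hb * h x + hb ^ 2 := fun x => by simp only [hg]; ring
  have i2 : Integrable (fun x => h x ^ 2 - 2 * hb * h x) ν := hhi2.sub (hhi.const_mul _)
  have hg2i : Integrable (fun x => g x ^ 2) ν := by
    simp_rw [e2]
    exact i2.add (integrable_const _)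
  have hV : ∫ x, g x ^ 2 ∂ν = ∫ x, h x ^ 2 ∂ν - hb ^ 2 := by
    simp_rw [e2]
    rw [integral_add i2 (integrable_const _), integral_sub hhi2 (hhi.const_mul _),
      integral_const_mul, hbar]
    simp; ring
  have hp := hpoin g hgc hgi hg0
  have hgrad : ∀ x, ‖gradient g x‖ ^ 2 ≤ ρ ^ 2 / s * (q x - h x ^ 2) := by
    intro x
    have : gradient g x = gradient h x := by
      unfold gradient; rw [hg, fderiv_sub_const]
    rw [this]
    exact norm_gradient_mehler_sq_le h0 h1 hm hmC hmR x
  have hBi : Integrable (fun x => ρ ^ 2 / s * (q x - h x ^ 2)) ν := (hqi.sub hhi2).const_mul _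
  have hp2 : ENNReal.ofReal (l * ∫ x, g x ^ 2 ∂ν)
      ≤ ENNReal.ofReal (∫ x, ρ ^ 2 / s * (q x - h x ^ 2) ∂ν) := by
    rw [ENNReal.ofReal_mul hl.le, ofReal_integral_eq_lintegral_ofReal hg2i
      (ae_of_all _ fun _ => sq_nonneg _), ofReal_integral_eq_lintegral_ofReal hBi
      (ae_of_all _ fun x => (sq_nonneg _).trans (hgrad x))]
    exact hp.trans (lintegral_mono fun x => ENNReal.ofReal_le_ofReal (hgrad x))
  rw [ENNReal.ofReal_le_ofReal_iff (integral_nonneg fun x => (sq_nonneg _).trans (hgrad x)),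
    integral_const_mul, integral_sub hqi hhi2] at hp2
  have hq : ∫ x, q x ∂ν = ∫ x, mehler ρ f x * m x ^ 2 ∂(gauss n) := by
    rw [integral_withDensity_gauss hfm hf]
    refine (integral_mehler_mul h0.le h1.le ?_).symm
    exact (integrable_mehler_prod h0.le h1.le hfi).mul_bdd (c := C ^ 2)
      (by fun_prop : Measurable fun p : E n × E n => m p.1 ^ 2).aestronglyMeasurable
      (ae_of_all _ fun p => hm2C p.1)
  have hV' : ∫ x, f x * (h x - hb) ^ 2 ∂(gauss n) = ∫ x, g x ^ 2 ∂ν :=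
    (integral_withDensity_gauss hfm hf _).symm
  rw [hV', div_mul_eq_mul_div, le_div_iff₀ (by positivity)]
  rw [hq, div_mul_eq_mul_div, le_div_iff₀ hs] at hp2
  -- Only variance at most second moment is needed to solve the inequality for the variance.
  have hge : ∫ x, g x ^ 2 ∂ν ≤ ∫ x, h x ^ 2 ∂ν := by rw [hV]; linarith [sq_nonneg hb]
  nlinarith [sq_nonneg ρ]

/-- Contraction of the Fisher information along the Ornstein-Uhlenbeck flow, one direction. -/
lemma fisher_contraction {l : ℝ} (hl : 0 < l) (hfm : Measurable f) (hf : ∀ x, 0 ≤ f x)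
    (hfi : Integrable f (gauss n)) (hf1 : ∫ x, f x ∂(gauss n) = 1)
    (hpoin : SatisfiesPoincare ((gauss n).withDensity fun x => ENNReal.ofReal (f x)) l)
    {D : E n → ℝ} (hDi : Integrable D (gauss n)) (hD0 : ∫ x, D x ∂(gauss n) = 0)
    (hDz : ∀ᵐ x ∂(gauss n), f x = 0 → D x = 0)
    (hDf : Integrable (fun x => D x ^ 2 / f x) (gauss n))
    {ρ : ℝ} (h0 : 0 < ρ) (h1 : ρ < 1) :
    Integrable (fun x => mehler ρ D x ^ 2 / mehler ρ f x) (gauss n) ∧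
    ∫ x, mehler ρ D x ^ 2 / mehler ρ f x ∂(gauss n)
      ≤ ρ ^ 2 / (ρ ^ 2 + l * (1 - ρ ^ 2)) * ∫ x, D x ^ 2 / f x ∂(gauss n) := by
  obtain ⟨hs, hs1⟩ := one_sub_sq_mem h0 h1
  set κ := ρ ^ 2 / (ρ ^ 2 + l * (1 - ρ ^ 2)) with hκ
  have hκ0 : 0 < κ := by positivity
  set u := mehler ρ f
  set w := mehler ρ D
  have hu : Continuous u := continuous_mehler h0 h1 hfi
  have hw : Continuous w := continuous_mehler h0 h1 hDi
  have hup : ∀ x, 0 < u x := mehler_pos h0 h1 hfi hf (by rw [hf1]; exact one_pos)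
  have hm0 : Continuous fun x => w x / u x := hw.div hu fun x => (hup x).ne'
  -- The optimal dual function `P_ρ D / P_ρ f`, truncated to balls so that it is bounded with
  -- bounded support. The bound is uniform in the radius, and at each point the truncation is
  -- eventually inactive.
  let m : ℕ → E n → ℝ := fun k => (Metric.closedBall 0 (k : ℝ)).indicator fun x => w x / u x
  have hm : ∀ k, Measurable (m k) := fun k => hm0.measurable.indicator measurableSet_closedBall
  have hmb : ∀ k, ∃ C, ∀ x, |m k x| ≤ C := by
    intro k
    obtain ⟨C, hC⟩ := (isCompact_closedBall (0 : E n) (k : ℝ)).exists_bound_of_continuousOn hm0.continuousOn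
    refine ⟨max C 0, fun x => ?_⟩
    by_cases hx : x ∈ Metric.closedBall (0 : E n) (k : ℝ)
    · simp only [m, indicator_of_mem hx]
      exact (hC x hx).trans (le_max_left _ _)
    · simp [m, indicator_of_notMem hx]
  have hmR : ∀ (k : ℕ) x, (k : ℝ) < ‖x‖ → m k x = 0 := fun k x hx => by
    simp only [m]; exact indicator_of_notMem (by simpa using hx) _
  have hA : ∀ k, ∫ x, u x * m k x ^ 2 ∂(gauss n) ≤ κ * ∫ x, D x ^ 2 / f x ∂(gauss n) := by
    intro k
    obtain ⟨C, hC⟩ := hmb k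
    have hcd := contDiff_mehler_of_bounded h0 h1 (hm k) hC (hmR k)
    have hV := variance_mehler_le hl hfm hf hfi hf1 hpoin h0 h1 (hm k) hC (hmR k)
    set h := mehler ρ (m k)
    set hb := ∫ y, f y * h y ∂(gauss n)
    rw [← hκ] at hV
    have hhC : ∀ x, |h x| ≤ C := abs_mehler_le ρ hC
    have e1 : ∫ x, u x * m k x ^ 2 ∂(gauss n) = ∫ x, w x * m k x ∂(gauss n) := by
      congr 1; ext x
      by_cases hx : x ∈ Metric.closedBall (0 : E n) (k : ℝ)
      · simp only [m, indicator_of_mem hx]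
        have := (hup x).ne'
        field_simp
      · simp [m, indicator_of_notMem hx]
    have e2 : ∫ x, w x * m k x ∂(gauss n) = ∫ x, D x * h x ∂(gauss n) :=
      integral_mehler_mul h0.le h1.le ((integrable_mehler_prod h0.le h1.le hDi).mul_bdd (c := C)
        ((hm k).comp measurable_fst).aestronglyMeasurable (ae_of_all _ fun p => hC p.1))
    have hDh : Integrable (fun x => D x * h x) (gauss n) :=
      hDi.mul_bdd (c := C) hcd.continuous.aestronglyMeasurable (ae_of_all _ hhC)
    -- As `D` has mean zero, subtracting the `ν`-mean of `P_ρ m` is free; this replaces a second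
    -- moment by a variance.
    have e3 : ∫ x, D x * h x ∂(gauss n) = ∫ x, D x * (h x - hb) ∂(gauss n) := by
      simp only [mul_sub]
      rw [integral_sub hDh (hDi.mul_const hb), integral_mul_const, hD0, zero_mul, sub_zero]
    have hfV : Integrable (fun x => f x * (h x - hb) ^ 2) (gauss n) := by
      refine hfi.mul_bdd (c := (C + |hb|) ^ 2)
        ((hcd.continuous.sub continuous_const).pow 2).aestronglyMeasurable (ae_of_all _ fun x => ?_)
      rw [Real.norm_eq_abs, abs_pow]
      exact pow_le_pow_left₀ (abs_nonneg _) ((abs_sub _ _).trans (by linarith [hhC x])) 2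
    -- Young's inequality with weight `κ`: by the variance bound the last term is at most half of `∫
    -- u m²` and is absorbed. Where `f = 0`, `D` vanishes almost everywhere and both sides are `0`.
    have e4 : ∫ x, D x * (h x - hb) ∂(gauss n) ≤
        κ / 2 * ∫ x, D x ^ 2 / f x ∂(gauss n) + 1 / (2 * κ) * ∫ x, f x * (h x - hb) ^ 2 ∂(gauss n) := by
      rw [← integral_const_mul, ← integral_const_mul,
        ← integral_add (hDf.const_mul _) (hfV.const_mul _)]
      refine integral_mono_ae ?_ ((hDf.const_mul _).add (hfV.const_mul _)) ?_
      · simp only [mul_sub]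
        exact hDh.sub (hDi.mul_const hb)
      · filter_upwards [hDz] with x hx
        rcases (hf x).eq_or_lt with h | h
        · rw [hx h.symm, ← h]; simp
        · have : 0 ≤ (κ * D x - f x * (mehler ρ (m k) x - hb)) ^ 2 / (2 * κ * f x) := by positivity
          have e : (κ * D x - f x * (mehler ρ (m k) x - hb)) ^ 2 / (2 * κ * f x)
            = κ / 2 * (D x ^ 2 / f x) + 1 / (2 * κ) * (f x * (mehler ρ (m k) x - hb) ^ 2)
              - D x * (mehler ρ (m k) x - hb) := by
            field_simp
            ring
          linarith
    rw [← e3, ← e2, ← e1] at e4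
    have : 1 / (2 * κ) * ∫ x, f x * (h x - hb) ^ 2 ∂(gauss n)
        ≤ 1 / (2 * κ) * (κ * ∫ x, u x * m k x ^ 2 ∂(gauss n)) := by gcongr
    have e5 : 1 / (2 * κ) * (κ * ∫ x, u x * m k x ^ 2 ∂(gauss n))
      = 1 / 2 * ∫ x, u x * m k x ^ 2 ∂(gauss n) := by field_simp
    linarith
  refine integrable_of_tendsto_of_integral_le (u := fun k x => u x * m k x ^ 2) (fun k => ?_)
    (fun k => ae_of_all _ fun x => mul_nonneg (hup x).le (sq_nonneg _)) (ae_of_all _ fun x => ?_) hA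
  · obtain ⟨C, hC⟩ := hmb k
    refine (integrable_mehler h0.le h1.le hfi).mul_bdd (c := C ^ 2)
      ((hm k).pow_const 2).aestronglyMeasurable (ae_of_all _ fun x => ?_)
    rw [Real.norm_eq_abs, abs_pow]
    exact pow_le_pow_left₀ (abs_nonneg _) (hC x) 2
  · refine tendsto_const_nhds.congr' ?_
    obtain ⟨N, hN⟩ := exists_nat_gt ‖x‖
    filter_upwards [eventually_ge_atTop N] with k hk
    have hx : x ∈ Metric.closedBall (0 : E n) (k : ℝ) := by
      simpa using hN.le.trans (by exact_mod_cast hk)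
    simp only [m, indicator_of_mem hx]
    have := (hup x).ne'
    field_simp

end Contraction

/-! ### Monotone rearrangement on the line. -/

section Rearrangement

lemma cumulative_props {p : ℝ → ℝ} (hc : Continuous p) (hpos : ∀ x, 0 < p x) (hi : Integrable p)
    (h1 : ∫ x, p x = 1) :
    (∀ x, HasDerivAt (fun x => ∫ t in Iic x, p t) (p x) x) ∧ StrictMono (fun x => ∫ t in Iic x, p t) ∧
    Tendsto (fun x => ∫ t in Iic x, p t) atBot (𝓝 0) ∧
    Tendsto (fun x => ∫ t in Iic x, p t) atTop (𝓝 1) ∧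
    ∀ x, (∫ t in Iic x, p t) ∈ Ioo (0 : ℝ) 1 := by
  have hd : ∀ x, HasDerivAt (fun x => ∫ t in Iic x, p t) (p x) x := by
    intro x
    have e : (fun x => ∫ t in Iic x, p t) = fun x => (∫ t in Iic 0, p t) + ∫ t in (0 : ℝ)..x, p t := by
      ext y
      rw [← intervalIntegral.integral_Iic_sub_Iic hi.integrableOn hi.integrableOn]
      ring
    rw [e]
    exact (intervalIntegral.integral_hasDerivAt_right (hc.intervalIntegrable _ _)
      hc.aestronglyMeasurable.stronglyMeasurableAtFilter hc.continuousAt).const_add _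
  have hm : StrictMono (fun x => ∫ t in Iic x, p t) :=
    strictMono_of_deriv_pos fun x => by rw [(hd x).deriv]; exact hpos x
  set μ : Measure ℝ := volume.withDensity fun x => ENNReal.ofReal (p x)
  have hμ : IsProbabilityMeasure μ := ⟨by
    rw [withDensity_apply _ MeasurableSet.univ, setLIntegral_univ,
      ← ofReal_integral_eq_lintegral_ofReal hi (ae_of_all _ fun x => (hpos x).le), h1,
      ENNReal.ofReal_one]⟩
  have hcdf : (fun x => ∫ t in Iic x, p t) = cdf μ := by
    ext x
    rw [cdf_eq_real, Measure.real, withDensity_apply _ measurableSet_Iic,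
      ← ofReal_integral_eq_lintegral_ofReal hi.integrableOn (ae_of_all _ fun x => (hpos x).le),
      ENNReal.toReal_ofReal (integral_nonneg fun x => (hpos x).le)]
  refine ⟨hd, hm, ?_, ?_, fun x => ⟨?_, ?_⟩⟩
  · rw [hcdf]; exact tendsto_cdf_atBot μ
  · rw [hcdf]; exact tendsto_cdf_atTop μ
  · refine lt_of_le_of_lt ?_ (hm (show x - 1 < x by linarith))
    exact integral_nonneg fun x => (hpos x).le
  · refine lt_of_lt_of_le (hm (show x < x + 1 by linarith)) ?_
    have := congrFun hcdf (x + 1)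
    simp only at this ⊢
    rw [this]
    exact cdf_le_one μ _

/-- The map is `Q⁻¹ ∘ P` for the two distribution functions. Differentiating `Q(S y) = P(y)` gives
the one-dimensional Monge-Ampère equation `q(S) S' = p`. -/
lemma exists_rearrangement {p q : ℝ → ℝ} (hpc : Continuous p) (hqc : Continuous q)
    (hp : ∀ x, 0 < p x) (hq : ∀ x, 0 < q x) (hpi : Integrable p) (hqi : Integrable q)
    (hp1 : ∫ x, p x = 1) (hq1 : ∫ x, q x = 1) :
    ∃ S : ℝ → ℝ, StrictMono S ∧ (∀ y, ∫ t in Iic (S y), q t = ∫ t in Iic y, p t) ∧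
      (∀ y, HasDerivAt S (p y / q (S y)) y) ∧
      MeasurePreserving S (volume.withDensity fun x => ENNReal.ofReal (p x))
        (volume.withDensity fun x => ENNReal.ofReal (q x)) := by
  obtain ⟨hPd, hPm, hP0, hP1, hPI⟩ := cumulative_props hpc hp hpi hp1
  obtain ⟨hQd, hQm, hQ0, hQ1, hQI⟩ := cumulative_props hqc hq hqi hq1
  set P := fun x => ∫ t in Iic x, p t with hP
  set Q := fun x => ∫ t in Iic x, q t with hQ
  have hPc : Continuous P := continuous_iff_continuousAt.2 fun x => (hPd x).continuousAt
  have hQc : Continuous Q := continuous_iff_continuousAt.2 fun x => (hQd x).continuousAt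
  have surj : ∀ {R : ℝ → ℝ}, Continuous R → Tendsto R atBot (𝓝 0) → Tendsto R atTop (𝓝 1) →
      ∀ u ∈ Ioo (0 : ℝ) 1, ∃ x, R x = u := by
    intro R hR h0 h1 u hu
    obtain ⟨a, ha⟩ := (h0.eventually (gt_mem_nhds hu.1)).exists
    obtain ⟨b, hb⟩ := (h1.eventually (lt_mem_nhds hu.2)).exists
    exact mem_range_of_exists_le_of_exists_ge hR ⟨a, ha.le⟩ ⟨b, hb.le⟩
  choose! J hJ using surj hQc hQ0 hQ1
  have hJQ : ∀ x, J (Q x) = x := fun x => hQm.injective (hJ _ (hQI x))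
  set S := fun y => J (P y) with hS
  have hSP : ∀ y, Q (S y) = P y := fun y => hJ _ (hPI y)
  have hSm : StrictMono S := fun a b hab => by
    rw [← hQm.lt_iff_lt, hSP, hSP]; exact hPm hab
  have hSs : Function.Surjective S := fun x => by
    obtain ⟨y, hy⟩ := surj hPc hP0 hP1 _ (hQI x)
    exact ⟨y, by rw [hS]; simp only; rw [hy, hJQ]⟩
  -- A strictly monotone map onto the whole line has no jumps.
  have hJc : ∀ u ∈ Ioo (0 : ℝ) 1, ContinuousAt J u := by
    intro u hu
    refine StrictMonoOn.continuousAt_of_image_mem_nhds (s := Ioo 0 1) (fun a ha b hb hab => ?_)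
      (isOpen_Ioo.mem_nhds hu) ?_
    · rw [← hQm.lt_iff_lt, hJ _ ha, hJ _ hb]; exact hab
    · have : J '' Ioo 0 1 = univ := eq_univ_of_forall fun x => ⟨Q x, hQI x, hJQ x⟩
      rw [this]; exact univ_mem
  have hSd : ∀ y, HasDerivAt S (p y / q (S y)) y := by
    intro y
    have h1 : HasDerivAt J (q (J (P y)))⁻¹ (P y) :=
      HasDerivAt.of_local_left_inverse (hJc _ (hPI y)) (hQd _) (hq _).ne'
        (by filter_upwards [isOpen_Ioo.mem_nhds (hPI y)] with u hu using hJ u hu)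
    exact (h1.comp y (hPd y)).congr_deriv (by rw [div_eq_mul_inv, mul_comm])
  refine ⟨S, hSm, hSP, hSd, hSm.monotone.measurable, ?_⟩
  have hfin : ∀ {r : ℝ → ℝ}, Integrable r →
      IsFiniteMeasure (volume.withDensity fun x => ENNReal.ofReal (r x)) :=
    fun hr => isFiniteMeasure_withDensity_ofReal hr.2
  have hf1 := hfin hpi
  have hf2 := hfin hqi
  refine Measure.ext_of_Iic _ _ fun a => ?_
  obtain ⟨b, rfl⟩ := hSs a
  rw [Measure.map_apply hSm.monotone.measurable measurableSet_Iic]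
  have : S ⁻¹' Iic (S b) = Iic b := by ext x; simp [hSm.le_iff_le]
  rw [this, withDensity_apply _ measurableSet_Iic, withDensity_apply _ measurableSet_Iic,
    ← ofReal_integral_eq_lintegral_ofReal hpi.integrableOn (ae_of_all _ fun x => (hp x).le),
    ← ofReal_integral_eq_lintegral_ofReal hqi.integrableOn (ae_of_all _ fun x => (hq x).le)]
  exact congrArg _ (hSP b).symm

lemma integral_withDensity_ofReal {p : ℝ → ℝ} (hpc : Continuous p) (hp : ∀ x, 0 < p x) (g : ℝ → ℝ) :
    ∫ x, g x ∂(volume.withDensity fun x => ENNReal.ofReal (p x)) = ∫ x, g x * p x := by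
  rw [integral_withDensity_eq_integral_toReal_smul (by fun_prop) (by simp)]
  congr 1; ext x
  rw [ENNReal.toReal_ofReal (hp x).le, smul_eq_mul, mul_comm]

lemma integrable_withDensity_ofReal {p : ℝ → ℝ} (hpc : Continuous p) (hp : ∀ x, 0 < p x) (g : ℝ → ℝ) :
    Integrable g (volume.withDensity fun x => ENNReal.ofReal (p x)) ↔ Integrable fun x => g x * p x := by
  rw [integrable_withDensity_iff_integrable_smul' (by fun_prop) (by simp)]
  refine integrable_congr (ae_of_all _ fun x => ?_)
  simp only
  rw [ENNReal.toReal_ofReal (hp x).le, smul_eq_mul, mul_comm]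

/-- An integrable `g` is small at suitable points arbitrarily far out on both sides, so `g'` cannot
be dominated by a function of negative total integral. No decay of `g` at infinity is required,
which suits transport maps of unknown growth. -/
lemma integral_nonneg_of_deriv_le {g g' h : ℝ → ℝ} (hg : Integrable g)
    (hd : ∀ x, HasDerivAt g (g' x) x) (hh : Integrable h) (hle : ∀ x, g' x ≤ h x) : 0 ≤ ∫ x, h x := by
  by_contra! hneg
  set c := -∫ x, h x with hc
  have hcp : 0 < c := by linarith
  have hlim : Tendsto (fun p : ℝ × ℝ => ∫ x in p.1..p.2, h x) (atBot ×ˢ atTop) (𝓝 (∫ x, h x)) :=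
    intervalIntegral_tendsto_integral hh tendsto_fst tendsto_snd
  have hev := hlim.eventually (gt_mem_nhds (show ∫ x, h x < -(c / 2) by linarith))
  rw [eventually_prod_iff] at hev
  obtain ⟨pa, hpa, pb, hpb, hab⟩ := hev
  obtain ⟨A, hA⟩ := eventually_atBot.1 (hpa.and (eventually_le_atBot 0))
  obtain ⟨B, hB⟩ := eventually_atTop.1 (hpb.and (eventually_ge_atTop 0))
  -- By Markov's inequality `{|g| ≥ c/8}` has finite measure, so no half-line lies inside it. At the
  -- chosen points `g b - g a > -c/4`, against an integral below `-c/2`.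
  have small : ∀ s : Set ℝ, volume s = ⊤ → ∃ x ∈ s, |g x| < c / 8 := by
    intro s hs
    by_contra! hcon
    have h1 := hg.measure_norm_ge_lt_top (show 0 < c / 8 by positivity)
    have h2 : volume s ≤ volume {x | c / 8 ≤ ‖g x‖} := measure_mono fun x hx => hcon x hx
    rw [hs] at h2
    exact absurd (h2.trans_lt h1) (lt_irrefl _)
  obtain ⟨a, ha, hga⟩ := small (Iic A) Real.volume_Iic
  obtain ⟨b, hb, hgb⟩ := small (Ici B) Real.volume_Ici
  have h1 := hab (hA a ha).1 (hB b hb).1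
  have h2 : g b - g a ≤ ∫ x in a..b, h x :=
    intervalIntegral.sub_le_integral_of_hasDeriv_right_of_le ((hA a ha).2.trans (hB b hb).2)
      (fun x _ => (hd x).continuousAt.continuousWithinAt) (fun x _ => (hd x).hasDerivWithinAt)
      hh.integrableOn (fun x _ => hle x)
  simp only at h1
  rw [abs_lt] at hga hgb
  linarith

end Rearrangement

/-! ### Talagrand and logarithmic Sobolev inequalities on the line. -/

section OneDim

lemma gaussPDF_eq (x : ℝ) : (gaussianPDFReal 0 1) x = (√(2 * Real.pi))⁻¹ * Real.exp (-x ^ 2 / 2) := by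
  rw [gaussianPDFReal_def]; simp

lemma gaussPDF_pos (x : ℝ) : 0 < (gaussianPDFReal 0 1) x := gaussianPDFReal_pos 0 1 x one_ne_zero

lemma continuous_gaussPDF : Continuous (gaussianPDFReal 0 1) := by
  have : (gaussianPDFReal 0 1) = fun x => (√(2 * Real.pi))⁻¹ * Real.exp (-x ^ 2 / 2) := funext gaussPDF_eq
  rw [this]; fun_prop

lemma hasDerivAt_gaussPDF (x : ℝ) : HasDerivAt (gaussianPDFReal 0 1) (-x * (gaussianPDFReal 0 1) x) x := by
  have e : (gaussianPDFReal 0 1) = fun x => (√(2 * Real.pi))⁻¹ * Real.exp (-x ^ 2 / 2) := funext gaussPDF_eq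
  rw [e]
  have h : HasDerivAt (fun x : ℝ => -x ^ 2 / 2) (-x) x := by
    refine ((hasDerivAt_pow 2 x).neg.div_const 2).congr_deriv ?_
    simp; ring
  exact (h.exp.const_mul _).congr_deriv (by ring)

lemma gaussianReal_eq_withDensity :
    (gaussianReal 0 1) = volume.withDensity fun x => ENNReal.ofReal ((gaussianPDFReal 0 1) x) := by
  rw [gaussianReal_of_var_ne_zero _ one_ne_zero]; rfl

lemma integral_gaussianReal (g : ℝ → ℝ) : ∫ x, g x ∂(gaussianReal 0 1) = ∫ x, g x * (gaussianPDFReal 0 1) x := by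
  rw [gaussianReal_eq_withDensity, integral_withDensity_ofReal continuous_gaussPDF gaussPDF_pos]

lemma integrable_gaussianReal_iff (g : ℝ → ℝ) : Integrable g (gaussianReal 0 1) ↔ Integrable fun x => g x * (gaussianPDFReal 0 1) x := by
  rw [gaussianReal_eq_withDensity, integrable_withDensity_ofReal continuous_gaussPDF gaussPDF_pos]

/-- Young's inequality for the conjugate pair `a log a - a` and `exp b`. Its instances give
entropy-moment bounds, the lower bound `-1` for `a log a`, and subadditivity of entropy. -/
lemma mul_le_mul_log_sub_add_exp {a : ℝ} (ha : 0 ≤ a) (b : ℝ) :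
    a * b ≤ a * Real.log a - a + Real.exp b := by
  rcases ha.eq_or_lt with h | h
  · rw [← h]; simp [Real.exp_nonneg]
  · have h1 := Real.add_one_le_exp (b - Real.log a)
    rw [Real.exp_sub, Real.exp_log h, le_div_iff₀ h] at h1
    nlinarith

/-- Young's inequality with `b = x² / 4`, whose exponential is still Gaussian integrable. -/
lemma integrable_sq_mul_of_entropy {f : ℝ → ℝ} (hf : ∀ x, 0 ≤ f x) (hfi : Integrable f (gaussianReal 0 1))
    (hfl : Integrable (fun x => f x * Real.log (f x)) (gaussianReal 0 1)) : Integrable (fun x => x ^ 2 * f x) (gaussianReal 0 1) := by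
  have hexp : Integrable (fun x : ℝ => Real.exp (x ^ 2 / 4)) (gaussianReal 0 1) := by
    rw [integrable_gaussianReal_iff]
    refine ((integrable_exp_neg_mul_sq (b := 1 / 4) (by norm_num)).const_mul
      (√(2 * Real.pi))⁻¹).congr (ae_of_all _ fun x => ?_)
    simp only
    rw [gaussPDF_eq, mul_left_comm, ← Real.exp_add]
    congr 2; ring
  refine (((hfl.sub hfi).add hexp).const_mul 4).mono'
    ((by fun_prop : Measurable fun x : ℝ => x ^ 2).aestronglyMeasurable.mul hfi.1)
    (ae_of_all _ fun x => ?_)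
  rw [Real.norm_of_nonneg (mul_nonneg (sq_nonneg _) (hf x))]
  have := mul_le_mul_log_sub_add_exp (hf x) (x ^ 2 / 4)
  simp only [Pi.add_apply, Pi.sub_apply]
  linarith

lemma integrable_sq_gaussianReal : Integrable (fun x : ℝ => x ^ 2) (gaussianReal 0 1) :=
  (memLp_id_gaussianReal 2).integrable_sq

/-- Talagrand's inequality on the line for a continuous positive density, with the monotone
rearrangement as transport map. -/
lemma talagrand_of_continuous {f : ℝ → ℝ} (hc : Continuous f) (hf : ∀ x, 0 < f x)
    (hfi : Integrable f (gaussianReal 0 1)) (hf1 : ∫ x, f x ∂(gaussianReal 0 1) = 1)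
    (hfl : Integrable (fun x => f x * Real.log (f x)) (gaussianReal 0 1)) :
    ∃ S : ℝ → ℝ, StrictMono S ∧ (∀ y, ∫ t in Iic (S y), f t ∂(gaussianReal 0 1) = (gaussianReal 0 1).real (Iic y)) ∧
      Integrable (fun y => (S y - y) ^ 2) (gaussianReal 0 1) ∧
      ∫ y, (S y - y) ^ 2 ∂(gaussianReal 0 1) ≤ 2 * ∫ x, f x * Real.log (f x) ∂(gaussianReal 0 1) := by
  have hqc : Continuous fun x => f x * (gaussianPDFReal 0 1) x := hc.mul continuous_gaussPDF
  have hq : ∀ x, 0 < f x * (gaussianPDFReal 0 1) x := fun x => mul_pos (hf x) (gaussPDF_pos x)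
  have hqi := (integrable_gaussianReal_iff f).1 hfi
  obtain ⟨S, hSm, hSP, hSd, hmp⟩ := exists_rearrangement continuous_gaussPDF hqc gaussPDF_pos hq
    (integrable_gaussianPDFReal 0 1) hqi (integral_gaussianPDFReal_eq_one 0 one_ne_zero)
    (by rw [← integral_gaussianReal, hf1])
  have hint : ∀ g : ℝ → ℝ, Integrable (fun x => f x * g x) (gaussianReal 0 1) → Integrable (fun y => g (S y)) (gaussianReal 0 1) := by
    intro g hg
    rw [gaussianReal_eq_withDensity]
    refine hmp.integrable_comp_of_integrable ?_
    rw [integrable_withDensity_ofReal hqc hq]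
    exact ((integrable_gaussianReal_iff _).1 hg).congr (ae_of_all _ fun x => by simp only; ring)
  have heq : ∀ g : ℝ → ℝ, Measurable g → ∫ y, g (S y) ∂(gaussianReal 0 1) = ∫ x, f x * g x ∂(gaussianReal 0 1) := by
    intro g hg
    have h1 := integral_map (μ := volume.withDensity fun x => ENNReal.ofReal (gaussianPDFReal 0 1 x))
      hmp.measurable.aemeasurable (f := g) hg.aestronglyMeasurable
    rw [hmp.map_eq, ← gaussianReal_eq_withDensity, integral_withDensity_ofReal hqc hq] at h1
    rw [← h1, integral_gaussianReal]
    congr 1; ext x; ring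
  have hS2 : Integrable (fun y => S y ^ 2) (gaussianReal 0 1) := hint (fun x => x ^ 2)
    ((integrable_sq_mul_of_entropy (fun x => (hf x).le) hfi hfl).congr
      (ae_of_all _ fun x => mul_comm _ _))
  have hSc : Continuous S := continuous_iff_continuousAt.2 fun y => (hSd y).continuousAt
  have hSy : Integrable (fun y => (S y - y) ^ 2) (gaussianReal 0 1) := by
    refine ((hS2.add integrable_sq_gaussianReal).const_mul 2).mono'
      (by fun_prop) (ae_of_all _ fun y => ?_)
    rw [Real.norm_of_nonneg (sq_nonneg _)]
    simp only [Pi.add_apply]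
    nlinarith [sq_nonneg (S y + y)]
  have hlogS : Integrable (fun y => Real.log (f (S y))) (gaussianReal 0 1) := hint (fun x => Real.log (f x)) hfl
  have hcum : ∀ y, ∫ t in Iic (S y), f t ∂(gaussianReal 0 1) = (gaussianReal 0 1).real (Iic y) := by
    intro y
    rw [gaussianReal_eq_withDensity, setIntegral_withDensity_eq_setIntegral_toReal_smul
      (by fun_prop) (by simp) _ measurableSet_Iic, Measure.real, withDensity_apply _ measurableSet_Iic,
      ← ofReal_integral_eq_lintegral_ofReal (integrable_gaussianPDFReal 0 1).integrableOn
        (ae_of_all _ fun x => (gaussPDF_pos x).le),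
      ENNReal.toReal_ofReal (integral_nonneg fun x => (gaussPDF_pos x).le), ← hSP]
    congr 1; ext t
    rw [ENNReal.toReal_ofReal (gaussPDF_pos t).le, smul_eq_mul, mul_comm]
  refine ⟨S, hSm, hcum, hSy, ?_⟩
  -- The field `(y - S) φ`, with `φ` the Gaussian density, has derivative at most the integrand:
  -- this is the Monge-Ampère equation with `log r ≤ r - 1`.
  have hmain : 0 ≤ ∫ y, (Real.log (f (S y)) - (S y - y) ^ 2 / 2) * (gaussianPDFReal 0 1) y := by
    refine integral_nonneg_of_deriv_le (g := fun y => (y - S y) * (gaussianPDFReal 0 1) y)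
      (g' := fun y => (1 - (gaussianPDFReal 0 1) y / (f (S y) * (gaussianPDFReal 0 1) (S y))) * (gaussianPDFReal 0 1) y + (y - S y) * (-y * (gaussianPDFReal 0 1) y))
      ?_ (fun y => ((hasDerivAt_id y).sub (hSd y)).mul (hasDerivAt_gaussPDF y)) ?_ fun y => ?_
    · rw [← integrable_gaussianReal_iff]
      refine ((integrable_const 1).add hSy).mono' (by fun_prop) (ae_of_all _ fun y => ?_)
      rw [Real.norm_eq_abs, abs_le]
      simp only [Pi.add_apply]
      constructor <;> nlinarith [sq_nonneg (S y - y - 1), sq_nonneg (S y - y + 1)]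
    · rw [← integrable_gaussianReal_iff]
      exact hlogS.sub (hSy.div_const 2)
    -- Here `r = S'(y)`; the logarithm of the Monge-Ampère equation expresses `log f(S y)` through
    -- `log r`.
    · set r := (gaussianPDFReal 0 1) y / (f (S y) * (gaussianPDFReal 0 1) (S y)) with hr
      have hrp : 0 < r := div_pos (gaussPDF_pos y) (hq _)
      have hlog : Real.log (f (S y)) = (S y ^ 2 - y ^ 2) / 2 - Real.log r := by
        have e : f (S y) = (gaussianPDFReal 0 1) y / (gaussianPDFReal 0 1) (S y) / r := by
          rw [hr]
          have h1 := (gaussPDF_pos y).ne'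
          have h2 := (gaussPDF_pos (S y)).ne'
          have h3 := (hf (S y)).ne'
          field_simp
        have e2 : (gaussianPDFReal 0 1) y / (gaussianPDFReal 0 1) (S y) = Real.exp ((S y ^ 2 - y ^ 2) / 2) := by
          rw [gaussPDF_eq, gaussPDF_eq, mul_div_mul_left _ _ (by positivity), ← Real.exp_sub]
          congr 1; ring
        rw [e, e2, Real.log_div (Real.exp_pos _).ne' hrp.ne', Real.log_exp]
      have hl := Real.log_le_sub_one_of_pos hrp
      have hφ := gaussPDF_pos y
      rw [hlog]
      have : (1 - r) + (y - S y) * (-y) ≤ (S y ^ 2 - y ^ 2) / 2 - Real.log r - (S y - y) ^ 2 / 2 := by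
        nlinarith
      nlinarith
  rw [← integral_gaussianReal, integral_sub hlogS (hSy.div_const 2),
    heq (fun x => Real.log (f x)) (by fun_prop), integral_div] at hmain
  linarith

/-- The logarithmic Sobolev inequality on the line for a positive `C¹` density. -/
lemma logSobolev_real_of_integral_eq_one {f f' : ℝ → ℝ} (hd : ∀ x, HasDerivAt f (f' x) x)
    (hf : ∀ x, 0 < f x) (hfi : Integrable f (gaussianReal 0 1)) (hf1 : ∫ x, f x ∂(gaussianReal 0 1) = 1)
    (hfl : Integrable (fun x => f x * Real.log (f x)) (gaussianReal 0 1))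
    (hI : Integrable (fun x => f' x ^ 2 / f x) (gaussianReal 0 1)) :
    ∫ x, f x * Real.log (f x) ∂(gaussianReal 0 1) ≤ 1 / 2 * ∫ x, f' x ^ 2 / f x ∂(gaussianReal 0 1) := by
  have hc : Continuous f := continuous_iff_continuousAt.2 fun x => (hd x).continuousAt
  have hpc : Continuous fun x => f x * (gaussianPDFReal 0 1) x := hc.mul continuous_gaussPDF
  have hp : ∀ x, 0 < f x * (gaussianPDFReal 0 1) x := fun x => mul_pos (hf x) (gaussPDF_pos x)
  have hpi := (integrable_gaussianReal_iff f).1 hfi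
  obtain ⟨T, hTm, hTP, hTd, hmp⟩ := exists_rearrangement hpc continuous_gaussPDF hp gaussPDF_pos
    hpi (integrable_gaussianPDFReal 0 1) (by rw [← integral_gaussianReal, hf1])
    (integral_gaussianPDFReal_eq_one 0 one_ne_zero)
  have hTc : Continuous T := continuous_iff_continuousAt.2 fun y => (hTd y).continuousAt
  have hT2 : Integrable (fun x => T x ^ 2 * f x) (gaussianReal 0 1) := by
    have h := integrable_sq_gaussianReal
    rw [gaussianReal_eq_withDensity] at h
    have h2 := hmp.integrable_comp_of_integrable h
    rw [integrable_withDensity_ofReal hpc hp] at h2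
    rw [integrable_gaussianReal_iff]
    exact h2.congr (ae_of_all _ fun x => by simp only [Function.comp]; ring)
  have hx2 := integrable_sq_mul_of_entropy (fun x => (hf x).le) hfi hfl
  -- The same argument with the opposite map `T`, from `f γ` to `γ`, and the field `f (x - T) φ`.
  -- The derivative `f'` now appears; Young's inequality trades it for the Fisher integrand and a
  -- square that cancels the transport cost.
  have hmain : 0 ≤ ∫ x, (1 / 2 * (f' x ^ 2 / f x) - f x * Real.log (f x)) * (gaussianPDFReal 0 1) x := by
    refine integral_nonneg_of_deriv_le (g := fun x => f x * (x - T x) * (gaussianPDFReal 0 1) x)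
      (g' := fun x => (f' x * (x - T x) + f x * (1 - f x * (gaussianPDFReal 0 1) x / (gaussianPDFReal 0 1) (T x))) * (gaussianPDFReal 0 1) x
        + f x * (x - T x) * (-x * (gaussianPDFReal 0 1) x))
      ?_ (fun x => ((hd x).mul ((hasDerivAt_id x).sub (hTd x))).mul (hasDerivAt_gaussPDF x)) ?_ fun x => ?_
    · rw [← integrable_gaussianReal_iff]
      refine (hfi.add ((hx2.add hT2).const_mul 2)).mono' (by fun_prop) (ae_of_all _ fun x => ?_)
      rw [norm_mul, Real.norm_of_nonneg (hf x).le, Real.norm_eq_abs]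
      simp only [Pi.add_apply]
      have h1 : |x - T x| ≤ 1 + 2 * (x ^ 2 + T x ^ 2) := by
        rw [abs_le]
        constructor <;> nlinarith [sq_nonneg (x - T x - 1), sq_nonneg (x - T x + 1), sq_nonneg (x + T x)]
      nlinarith [mul_le_mul_of_nonneg_left h1 (hf x).le]
    · rw [← integrable_gaussianReal_iff]
      exact (hI.const_mul _).sub hfl
    · set r := f x * (gaussianPDFReal 0 1) x / (gaussianPDFReal 0 1) (T x) with hr
      have hrp : 0 < r := div_pos (hp x) (gaussPDF_pos _)
      have hlog : Real.log (f x) = (x ^ 2 - T x ^ 2) / 2 + Real.log r := by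
        have e : f x = (gaussianPDFReal 0 1) (T x) / (gaussianPDFReal 0 1) x * r := by
          rw [hr]
          have h1 := (gaussPDF_pos x).ne'
          have h2 := (gaussPDF_pos (T x)).ne'
          field_simp
        have e2 : (gaussianPDFReal 0 1) (T x) / (gaussianPDFReal 0 1) x = Real.exp ((x ^ 2 - T x ^ 2) / 2) := by
          rw [gaussPDF_eq, gaussPDF_eq, mul_div_mul_left _ _ (by positivity), ← Real.exp_sub]
          congr 1; ring
        rw [e, e2, Real.log_mul (Real.exp_pos _).ne' hrp.ne', Real.log_exp]
      have hl := Real.log_le_sub_one_of_pos hrp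
      have hφ := gaussPDF_pos x
      have hfx := hf x
      rw [hlog]
      have h1 : f' x * (x - T x) ≤ 1 / 2 * (f' x ^ 2 / f x) + 1 / 2 * (f x * (x - T x) ^ 2) := by
        have : 0 ≤ (f' x - f x * (x - T x)) ^ 2 / (2 * f x) := by positivity
        have e : (f' x - f x * (x - T x)) ^ 2 / (2 * f x) = 1 / 2 * (f' x ^ 2 / f x)
          + 1 / 2 * (f x * (x - T x) ^ 2) - f' x * (x - T x) := by field_simp; ring
        linarith
      have h2 : f x * Real.log r ≤ f x * (r - 1) := by gcongr
      have : f' x * (x - T x) + f x * (1 - r) + f x * (x - T x) * (-x)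
          ≤ 1 / 2 * (f' x ^ 2 / f x) - f x * ((x ^ 2 - T x ^ 2) / 2 + Real.log r) := by
        nlinarith
      nlinarith
  rw [← integral_gaussianReal, integral_sub (hI.const_mul _) hfl, integral_const_mul] at hmain
  linarith

/-- Homogeneity removes the normalization: tensorization applies the inequality to fibres, whose
mass is arbitrary. -/
lemma logSobolev_real {f f' : ℝ → ℝ} (hd : ∀ x, HasDerivAt f (f' x) x)
    (hf : ∀ x, 0 < f x) (hfi : Integrable f (gaussianReal 0 1))
    (hfl : Integrable (fun x => f x * Real.log (f x)) (gaussianReal 0 1))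
    (hI : Integrable (fun x => f' x ^ 2 / f x) (gaussianReal 0 1)) :
    ∫ x, f x * Real.log (f x) ∂(gaussianReal 0 1) - (∫ x, f x ∂(gaussianReal 0 1)) * Real.log (∫ x, f x ∂(gaussianReal 0 1))
      ≤ 1 / 2 * ∫ x, f' x ^ 2 / f x ∂(gaussianReal 0 1) := by
  set m := ∫ x, f x ∂(gaussianReal 0 1) with hm
  have hmp : 0 < m := by
    rw [hm, integral_pos_iff_support_of_nonneg (fun x => (hf x).le) hfi,
      show Function.support f = univ from eq_univ_of_forall fun x => (hf x).ne']
    simp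
  have e1 : ∀ x, f x / m * Real.log (f x / m) = m⁻¹ * (f x * Real.log (f x)) - Real.log m / m * f x := by
    intro x
    rw [Real.log_div (hf x).ne' hmp.ne']
    field_simp
  have e2 : ∀ x, (f' x / m) ^ 2 / (f x / m) = m⁻¹ * (f' x ^ 2 / f x) := by
    intro x
    have := (hf x).ne'
    field_simp
  have h := logSobolev_real_of_integral_eq_one (f := fun x => f x / m) (f' := fun x => f' x / m)
    (fun x => (hd x).div_const m) (fun x => div_pos (hf x) hmp) (hfi.div_const m)
    (by rw [integral_div]; exact div_self hmp.ne')
    (by simp_rw [e1]; exact (hfl.const_mul _).sub (hfi.const_mul _))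
    (by simp_rw [e2]; exact hI.const_mul _)
  simp_rw [e1, e2] at h
  rw [integral_sub (hfl.const_mul _) (hfi.const_mul _), integral_const_mul, integral_const_mul,
    integral_const_mul, ← hm, div_mul_cancel₀ _ hmp.ne'] at h
  have := mul_le_mul_of_nonneg_left h hmp.le
  rw [mul_sub, mul_left_comm m (1 / 2), mul_inv_cancel_left₀ hmp.ne', mul_inv_cancel_left₀ hmp.ne'] at this
  exact this

end OneDim

/-! ### Monotonicity of entropy under the Mehler operators. -/

section EntropyMehler

variable {V : Type*} [NormedAddCommGroup V] [InnerProductSpace ℝ V] [FiniteDimensional ℝ V]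
  [MeasurableSpace V] [BorelSpace V] {f : V → ℝ}

lemma neg_one_le_mul_log {a : ℝ} (ha : 0 ≤ a) : -1 ≤ a * Real.log a := by
  have := mul_le_mul_log_sub_add_exp ha 0
  simp only [mul_zero, Real.exp_zero] at this
  linarith

lemma integral_mul_log_le {α : Type*} [MeasurableSpace α] {μ : Measure α} [IsProbabilityMeasure μ]
    {f : α → ℝ} (hf : ∀ x, 0 ≤ f x) (hfi : Integrable f μ)
    (hfl : Integrable (fun x => f x * Real.log (f x)) μ) :
    (∫ x, f x ∂μ) * Real.log (∫ x, f x ∂μ) ≤ ∫ x, f x * Real.log (f x) ∂μ :=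
  Real.convexOn_mul_log.map_integral_le Real.continuous_mul_log.continuousOn isClosed_Ici
    (ae_of_all _ hf) hfi hfl

/-- Jensen's inequality for `a log a` inside Mehler's formula, then invariance of `γ`. -/
lemma entropy_mehler_le {ρ : ℝ} (h0 : 0 < ρ) (h1 : ρ < 1) (hf : ∀ x, 0 ≤ f x)
    (hfi : Integrable f (stdGaussian V))
    (hfl : Integrable (fun x => f x * Real.log (f x)) (stdGaussian V)) :
    Integrable (fun x => mehler ρ f x * Real.log (mehler ρ f x)) (stdGaussian V) ∧
    ∫ x, mehler ρ f x * Real.log (mehler ρ f x) ∂(stdGaussian V)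
      ≤ ∫ x, f x * Real.log (f x) ∂(stdGaussian V) := by
  have hle : ∀ y, mehler ρ f y * Real.log (mehler ρ f y)
      ≤ mehler ρ (fun x => f x * Real.log (f x)) y := fun y =>
    integral_mul_log_le (fun z => hf _) (integrable_mehler_section h0 h1 hfi y)
      (integrable_mehler_section h0 h1 hfl y)
  have hi := integrable_mehler h0.le h1.le hfl
  have hI : Integrable (fun x => mehler ρ f x * Real.log (mehler ρ f x)) (stdGaussian V) := by
    refine (hi.abs.add (integrable_const 1)).mono'
      (Real.continuous_mul_log.comp (continuous_mehler h0 h1 hfi)).aestronglyMeasurable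
      (ae_of_all _ fun y => ?_)
    have h2 := neg_one_le_mul_log (mehler_nonneg (ρ := ρ) hf y)
    have h3 := le_abs_self (mehler ρ (fun x => f x * Real.log (f x)) y)
    have h4 := abs_nonneg (mehler ρ (fun x => f x * Real.log (f x)) y)
    simp only [Pi.add_apply]
    rw [Real.norm_eq_abs, abs_le]
    constructor <;> linarith [hle y]
  refine ⟨hI, ?_⟩
  rw [← integral_mehler h0.le h1.le hfl]
  exact integral_mono hI hi hle

end EntropyMehler

/-! ### Quantile maps and Talagrand's inequality for general densities on the line. -/

section Quantile

lemma stdGaussian_real : stdGaussian ℝ = gaussianReal 0 1 := by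
  apply Measure.ext_of_charFun
  ext t
  rw [charFun_stdGaussian, charFun_gaussianReal]
  congr 1
  simp [← Complex.ofReal_pow]
  ring

/-- Right continuity of the distribution function makes the infimum attained. The resulting
equivalence determines the law of the quantile map, its monotonicity, and its measurable dependence
on parameters. -/
lemma sInf_cdf_le_iff (μ : Measure ℝ) {u : ℝ} (hu : u ∈ Ioo (0 : ℝ) 1) (a : ℝ) :
    sInf {a | u ≤ cdf μ a} ≤ a ↔ u ≤ cdf μ a := by
  obtain ⟨b, hb⟩ := ((tendsto_cdf_atTop μ).eventually (lt_mem_nhds hu.2)).exists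
  have hne : {a | u ≤ cdf μ a}.Nonempty := ⟨b, hb.le⟩
  obtain ⟨c, hc⟩ := ((tendsto_cdf_atBot μ).eventually (gt_mem_nhds hu.1)).exists
  have hbdd : BddBelow {a | u ≤ cdf μ a} := ⟨c, fun x hx => by
    by_contra! h
    exact absurd (hx.trans (monotone_cdf μ h.le)) (not_le.2 hc)⟩
  refine ⟨fun h => ?_, fun h => csInf_le hbdd h⟩
  have hr : Tendsto (cdf μ) (𝓝[>] a) (𝓝 (cdf μ a)) :=
    ((cdf μ).right_continuous a).mono_left (nhdsWithin_mono _ Ioi_subset_Ici_self)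
  refine ge_of_tendsto hr ?_
  filter_upwards [self_mem_nhdsWithin] with x hx
  obtain ⟨y, hy, hyx⟩ := (csInf_lt_iff hbdd hne).1 (h.trans_lt hx)
  exact hy.trans (monotone_cdf μ hyx.le)

lemma gaussianReal_real_Iic (y : ℝ) :
    (gaussianReal 0 1).real (Iic y) = ∫ t in Iic y, gaussianPDFReal 0 1 t := by
  rw [gaussianReal_eq_withDensity, Measure.real, withDensity_apply _ measurableSet_Iic,
    ← ofReal_integral_eq_lintegral_ofReal (integrable_gaussianPDFReal 0 1).integrableOn
      (ae_of_all _ fun x => (gaussPDF_pos x).le),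
    ENNReal.toReal_ofReal (integral_nonneg fun x => (gaussPDF_pos x).le)]

lemma gaussianReal_cumulative :
    StrictMono (fun y => (gaussianReal 0 1).real (Iic y)) ∧
    (∀ y, (gaussianReal 0 1).real (Iic y) ∈ Ioo (0 : ℝ) 1) ∧
    ∀ u ∈ Ioo (0 : ℝ) 1, ∃ y, (gaussianReal 0 1).real (Iic y) = u := by
  obtain ⟨hd, hm, h0, h1, hI⟩ := cumulative_props continuous_gaussPDF gaussPDF_pos
    (integrable_gaussianPDFReal 0 1) (integral_gaussianPDFReal_eq_one 0 one_ne_zero)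
  simp only [gaussianReal_real_Iic]
  refine ⟨hm, hI, fun u hu => ?_⟩
  obtain ⟨a, ha⟩ := (h0.eventually (gt_mem_nhds hu.1)).exists
  obtain ⟨b, hb⟩ := (h1.eventually (lt_mem_nhds hu.2)).exists
  exact mem_range_of_exists_le_of_exists_ge
    (continuous_iff_continuousAt.2 fun x => (hd x).continuousAt) ⟨a, ha.le⟩ ⟨b, hb.le⟩

/-- The monotone map transporting the Gaussian measure of the line to the density `f`. -/
def quantileMap (f : ℝ → ℝ) (y : ℝ) : ℝ :=
  sInf {a | (gaussianReal 0 1).real (Iic y) ≤ ∫ t in Iic a, f t ∂(gaussianReal 0 1)}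

variable {f : ℝ → ℝ}

lemma isProbabilityMeasure_withDensity_ofReal {α : Type*} [MeasurableSpace α] {μ : Measure α}
    {f : α → ℝ} (hf : ∀ x, 0 ≤ f x) (hfi : Integrable f μ) (hf1 : ∫ x, f x ∂μ = 1) :
    IsProbabilityMeasure (μ.withDensity fun x => ENNReal.ofReal (f x)) := ⟨by
  rw [withDensity_apply _ MeasurableSet.univ, setLIntegral_univ,
    ← ofReal_integral_eq_lintegral_ofReal hfi (ae_of_all _ hf), hf1, ENNReal.ofReal_one]⟩

lemma cdf_withDensity (hf : ∀ x, 0 ≤ f x) (hfi : Integrable f (gaussianReal 0 1))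
    (hf1 : ∫ x, f x ∂(gaussianReal 0 1) = 1) (a : ℝ) :
    cdf ((gaussianReal 0 1).withDensity fun x => ENNReal.ofReal (f x)) a
      = ∫ t in Iic a, f t ∂(gaussianReal 0 1) := by
  have := isProbabilityMeasure_withDensity_ofReal hf hfi hf1
  rw [cdf_eq_real, Measure.real, withDensity_apply _ measurableSet_Iic,
    ← ofReal_integral_eq_lintegral_ofReal hfi.integrableOn (ae_of_all _ hf),
    ENNReal.toReal_ofReal (integral_nonneg hf)]

lemma quantileMap_le_iff (hf : ∀ x, 0 ≤ f x) (hfi : Integrable f (gaussianReal 0 1))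
    (hf1 : ∫ x, f x ∂(gaussianReal 0 1) = 1) (y a : ℝ) :
    quantileMap f y ≤ a
      ↔ (gaussianReal 0 1).real (Iic y) ≤ ∫ t in Iic a, f t ∂(gaussianReal 0 1) := by
  have := sInf_cdf_le_iff ((gaussianReal 0 1).withDensity fun x => ENNReal.ofReal (f x))
    (gaussianReal_cumulative.2.1 y) a
  simp only [cdf_withDensity hf hfi hf1] at this
  exact this

lemma monotone_quantileMap (hf : ∀ x, 0 ≤ f x) (hfi : Integrable f (gaussianReal 0 1))
    (hf1 : ∫ x, f x ∂(gaussianReal 0 1) = 1) : Monotone (quantileMap f) := fun a b hab => by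
  rw [quantileMap_le_iff hf hfi hf1]
  exact (gaussianReal_cumulative.1.monotone hab).trans
    ((quantileMap_le_iff hf hfi hf1 b _).1 le_rfl)

lemma map_quantileMap (hf : ∀ x, 0 ≤ f x) (hfi : Integrable f (gaussianReal 0 1))
    (hf1 : ∫ x, f x ∂(gaussianReal 0 1) = 1) :
    (gaussianReal 0 1).map (quantileMap f)
      = (gaussianReal 0 1).withDensity fun x => ENNReal.ofReal (f x) := by
  have hp := isProbabilityMeasure_withDensity_ofReal hf hfi hf1
  have hm := (monotone_quantileMap hf hfi hf1).measurable
  have := Measure.isProbabilityMeasure_map (μ := gaussianReal 0 1) hm.aemeasurable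
  refine Measure.ext_of_Iic _ _ fun a => ?_
  rw [Measure.map_apply hm measurableSet_Iic, ← ofReal_cdf, cdf_withDensity hf hfi hf1]
  have e : quantileMap f ⁻¹' Iic a
      = {y | (gaussianReal 0 1).real (Iic y) ≤ ∫ t in Iic a, f t ∂(gaussianReal 0 1)} := by
    ext y; exact quantileMap_le_iff hf hfi hf1 y a
  rw [e]
  have h0 : 0 ≤ ∫ t in Iic a, f t ∂(gaussianReal 0 1) := integral_nonneg hf
  have h1 : ∫ t in Iic a, f t ∂(gaussianReal 0 1) ≤ 1 := by
    rw [← hf1]; exact setIntegral_le_integral hfi (ae_of_all _ hf)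
  obtain ⟨hsm, hI, hs⟩ := gaussianReal_cumulative
  rcases h0.eq_or_lt with h0' | h0'
  · rw [← h0']
    have : {y | (gaussianReal 0 1).real (Iic y) ≤ 0} = ∅ :=
      eq_empty_of_forall_notMem fun y hy => absurd (hI y).1 (not_lt.2 hy)
    rw [this]; simp
  rcases h1.eq_or_lt with h1' | h1'
  · rw [h1']
    have : {y | (gaussianReal 0 1).real (Iic y) ≤ 1} = univ :=
      eq_univ_of_forall fun y => (hI y).2.le
    rw [this]; simp
  obtain ⟨b, hb⟩ := hs _ ⟨h0', h1'⟩
  rw [← hb]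
  have : {y | (gaussianReal 0 1).real (Iic y) ≤ (gaussianReal 0 1).real (Iic b)} = Iic b := by
    ext y; exact hsm.le_iff_le
  rw [this, Measure.real, ENNReal.ofReal_toReal (measure_ne_top _ _)]

/-- Talagrand's inequality on the line. -/
lemma talagrand_real (hf : ∀ x, 0 ≤ f x) (hfi : Integrable f (gaussianReal 0 1))
    (hf1 : ∫ x, f x ∂(gaussianReal 0 1) = 1)
    (hfl : Integrable (fun x => f x * Real.log (f x)) (gaussianReal 0 1)) :
    Integrable (fun y => (quantileMap f y - y) ^ 2) (gaussianReal 0 1) ∧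
      ∫ y, (quantileMap f y - y) ^ 2 ∂(gaussianReal 0 1)
        ≤ 2 * ∫ x, f x * Real.log (f x) ∂(gaussianReal 0 1) := by
  obtain ⟨r, hr0, hr1, -, hr⟩ := exists_seq_tendsto_one
  have hγ := stdGaussian_real
  have hT : ∀ k, ∃ S : ℝ → ℝ,
      (∀ y, ∫ t in Iic (S y), mehler (r k) f t ∂(gaussianReal 0 1) = (gaussianReal 0 1).real (Iic y)) ∧
      Integrable (fun y => (S y - y) ^ 2) (gaussianReal 0 1) ∧
      ∫ y, (S y - y) ^ 2 ∂(gaussianReal 0 1) ≤ 2 * ∫ x, f x * Real.log (f x) ∂(gaussianReal 0 1) := by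
    intro k
    rw [← hγ] at hfi hf1 hfl
    have he := entropy_mehler_le (hr0 k) (hr1 k) hf hfi hfl
    have hi := integrable_mehler (hr0 k).le (hr1 k).le hfi
    have h1 := integral_mehler (hr0 k).le (hr1 k).le hfi
    have hp := mehler_pos (hr0 k) (hr1 k) hfi hf (by rw [hf1]; exact one_pos)
    have hc := continuous_mehler (hr0 k) (hr1 k) hfi
    rw [hf1] at h1
    rw [hγ] at hi h1 he
    obtain ⟨S, -, hS1, hS2, hS3⟩ := talagrand_of_continuous hc hp hi h1 he.1
    exact ⟨S, hS1, hS2, hS3.trans (mul_le_mul_of_nonneg_left he.2 zero_le_two)⟩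
  choose S hS1 hS2 hS3 using hT
  have hi : ∀ k, Integrable (mehler (r k) f) (gaussianReal 0 1) := fun k => by
    rw [← hγ] at hfi ⊢
    exact integrable_mehler (hr0 k).le (hr1 k).le hfi
  have hlim : Tendsto (fun k => ∫ y, |mehler (r k) f y - f y| ∂(gaussianReal 0 1)) atTop (𝓝 0) := by
    rw [← hγ] at hfi ⊢
    exact tendsto_integral_abs_mehler_sub (fun k => (hr0 k).le) (fun k => (hr1 k).le) hr hfi
  have hF : ∀ a, Tendsto (fun k => ∫ t in Iic a, mehler (r k) f t ∂(gaussianReal 0 1)) atTop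
      (𝓝 (∫ t in Iic a, f t ∂(gaussianReal 0 1))) := by
    intro a
    rw [tendsto_iff_norm_sub_tendsto_zero]
    refine squeeze_zero (fun k => norm_nonneg _) (fun k => ?_) hlim
    rw [← integral_sub (hi k).integrableOn hfi.integrableOn]
    refine (norm_integral_le_integral_norm _).trans ?_
    exact setIntegral_le_integral ((hi k).sub hfi).norm (ae_of_all _ fun _ => norm_nonneg _)
  have hmono : ∀ k, Monotone fun a => ∫ t in Iic a, mehler (r k) f t ∂(gaussianReal 0 1) :=
    fun k a b hab => setIntegral_mono_set (hi k).integrableOn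
      (ae_of_all _ fun x => mehler_nonneg hf x) (Iic_subset_Iic.2 hab).eventuallyLE
  have hqm := monotone_quantileMap hf hfi hf1
  -- A monotone map has only countably many discontinuities.
  have hae : ∀ᵐ y ∂(gaussianReal 0 1), ContinuousAt (quantileMap f) y := by
    have h : ∀ᵐ y, ContinuousAt (quantileMap f) y := by
      simpa using hqm.countable_not_continuousAt.ae_notMem volume
    exact (gaussianReal_absolutelyContinuous 0 one_ne_zero).ae_le h
  refine integrable_of_tendsto_of_integral_le hS2 (fun k => ae_of_all _ fun _ => sq_nonneg _) ?_ hS3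
  filter_upwards [hae] with y hy
  refine ((Tendsto.sub_const ?_ y).pow 2)
  -- At a continuity point the maps `S k` are squeezed by convergence of distribution functions:
  -- below directly, above by moving to some `y' > y`, which provides the strict inequality.
  rw [tendsto_order]
  constructor
  · intro a ha
    have h1 : ∫ t in Iic a, f t ∂(gaussianReal 0 1) < (gaussianReal 0 1).real (Iic y) :=
      not_le.1 fun h => absurd ((quantileMap_le_iff hf hfi hf1 y a).2 h) (not_le.2 ha)
    filter_upwards [(hF a).eventually (gt_mem_nhds h1)] with k hk
    rw [← hS1 k y] at hk
    exact (hmono k).reflect_lt hk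
  · intro b hb
    have : ∃ y' > y, quantileMap f y' < b := by
      have h2 := hy.eventually (gt_mem_nhds hb)
      obtain ⟨y', hy', h3⟩ := ((h2.filter_mono nhdsWithin_le_nhds).and
        (self_mem_nhdsWithin : Ioi y ∈ 𝓝[>] y)).exists
      exact ⟨y', h3, hy'⟩
    obtain ⟨y', hyy, hb'⟩ := this
    have h1 : (gaussianReal 0 1).real (Iic y) < ∫ t in Iic b, f t ∂(gaussianReal 0 1) :=
      (gaussianReal_cumulative.1 hyy).trans_le ((quantileMap_le_iff hf hfi hf1 y' b).1 hb'.le)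
    filter_upwards [(hF b).eventually (lt_mem_nhds h1)] with k hk
    rw [← hS1 k y] at hk
    exact (hmono k).reflect_lt hk

end Quantile

/-! ### Disintegration of entropy and fibrewise transport. -/

section Conditioning

variable {X : Type*} [MeasurableSpace X] {μ : Measure X} [IsProbabilityMeasure μ] {F : X × ℝ → ℝ}

/-- The part of the entropy of `F` carried by the conditional laws given the first coordinate. -/
lemma condEntropy_nonneg {Y : Type*} [MeasurableSpace Y] {ν : Measure Y} [IsProbabilityMeasure ν]
    {F : X × Y → ℝ} (hF : ∀ p, 0 ≤ F p) (hFi : Integrable F (μ.prod ν))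
    (hFl : Integrable (fun p => F p * Real.log (F p)) (μ.prod ν)) :
    Integrable (fun x => (∫ s, F (x, s) ∂ν) * Real.log (∫ s, F (x, s) ∂ν)) μ ∧
    ∀ᵐ x ∂μ, (∫ s, F (x, s) ∂ν) * Real.log (∫ s, F (x, s) ∂ν)
      ≤ ∫ s, F (x, s) * Real.log (F (x, s)) ∂ν := by
  have hle : ∀ᵐ x ∂μ, (∫ s, F (x, s) ∂ν) * Real.log (∫ s, F (x, s) ∂ν)
      ≤ ∫ s, F (x, s) * Real.log (F (x, s)) ∂ν := by
    filter_upwards [hFi.prod_right_ae, hFl.prod_right_ae] with x h1 h2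
    exact integral_mul_log_le (fun s => hF _) h1 h2
  refine ⟨?_, hle⟩
  refine (hFl.integral_prod_left.abs.add (integrable_const 1)).mono'
    (Real.continuous_mul_log.comp_aestronglyMeasurable hFi.integral_prod_left.1) ?_
  filter_upwards [hle] with x hx
  have h2 := neg_one_le_mul_log (integral_nonneg fun s => hF (x, s) : 0 ≤ ∫ s, F (x, s) ∂ν)
  have h3 := le_abs_self (∫ s, F (x, s) * Real.log (F (x, s)) ∂ν)
  have h4 := abs_nonneg (∫ s, F (x, s) * Real.log (F (x, s)) ∂ν)
  simp only [Pi.add_apply]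
  rw [Real.norm_eq_abs, abs_le]
  constructor <;> linarith

/-- Fiberwise monotone transport for a density on a product with the Gaussian line. -/
lemma exists_fiber_transport (hFm : Measurable F) (hF : ∀ p, 0 ≤ F p)
    (hFi : Integrable F (μ.prod (gaussianReal 0 1)))
    (hFl : Integrable (fun p => F p * Real.log (F p)) (μ.prod (gaussianReal 0 1))) :
    ∃ S : X × ℝ → ℝ, Measurable S ∧
      ((μ.withDensity fun x => ENNReal.ofReal (∫ s, F (x, s) ∂(gaussianReal 0 1))).prod
        (gaussianReal 0 1)).map (fun p => (p.1, S p))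
          = (μ.prod (gaussianReal 0 1)).withDensity (fun p => ENNReal.ofReal (F p)) ∧
      ∫⁻ x, ∫⁻ y, ENNReal.ofReal ((S (x, y) - y) ^ 2) ∂(gaussianReal 0 1)
          ∂(μ.withDensity fun x => ENNReal.ofReal (∫ s, F (x, s) ∂(gaussianReal 0 1)))
        ≤ ENNReal.ofReal (2 * (∫ p, F p * Real.log (F p) ∂(μ.prod (gaussianReal 0 1))
          - ∫ x, (∫ s, F (x, s) ∂(gaussianReal 0 1)) * Real.log (∫ s, F (x, s) ∂(gaussianReal 0 1)) ∂μ)) := by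
  set F₁ : X → ℝ := fun x => ∫ s, F (x, s) ∂(gaussianReal 0 1) with hF₁
  have hF₁m : Measurable F₁ := hFm.stronglyMeasurable.integral_prod_right'.measurable
  have hF₁0 : ∀ x, 0 ≤ F₁ x := fun x => integral_nonneg fun s => hF _
  -- A non-integrable fibre has integral `0` by convention, so a positive marginal already certifies
  -- integrability.
  have hgood : ∀ x, 0 < F₁ x → Integrable (fun s => F (x, s)) (gaussianReal 0 1) := fun x hx => by
    by_contra h
    exact hx.ne' (integral_undef h)
  have hgoodn : ∀ x, 0 < F₁ x → (∀ s, 0 ≤ F (x, s) / F₁ x) ∧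
      Integrable (fun s => F (x, s) / F₁ x) (gaussianReal 0 1) ∧
      ∫ s, F (x, s) / F₁ x ∂(gaussianReal 0 1) = 1 := fun x hx =>
    ⟨fun s => div_nonneg (hF _) hx.le, (hgood x hx).div_const _, by
      rw [integral_div]; exact div_self hx.ne'⟩
  let S : X × ℝ → ℝ := fun p => if 0 < F₁ p.1 then quantileMap (fun s => F (p.1, s) / F₁ p.1) p.2 else 0
  have hSeq : ∀ x, 0 < F₁ x → ∀ y, S (x, y) = quantileMap (fun s => F (x, s) / F₁ x) y :=
    fun x hx y => if_pos hx
  -- Joint measurability of the fibrewise maps: their sublevel sets compare two distribution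
  -- functions, and the one of the fibre is a partial integral of `F`.
  have hS : Measurable S := by
    refine measurable_of_Iic fun a => ?_
    have e : S ⁻¹' Iic a = {p : X × ℝ | 0 < F₁ p.1 ∧ (gaussianReal 0 1).real (Iic p.2)
        ≤ ∫ s in Iic a, F (p.1, s) / F₁ p.1 ∂(gaussianReal 0 1)} ∪ {p | ¬ 0 < F₁ p.1 ∧ 0 ≤ a} := by
      ext p
      by_cases hp : 0 < F₁ p.1
      · obtain ⟨h1, h2, h3⟩ := hgoodn p.1 hp
        have := quantileMap_le_iff h1 h2 h3 p.2 a
        simp [S, hp, this]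
      · simpa [S, hp] using fun _ => not_lt.1 hp
    rw [e]
    have hpos : MeasurableSet {p : X × ℝ | 0 < F₁ p.1} :=
      measurableSet_lt measurable_const (hF₁m.comp measurable_fst)
    have h1 : Measurable fun p : X × ℝ => (gaussianReal 0 1).real (Iic p.2) :=
      gaussianReal_cumulative.1.monotone.measurable.comp measurable_snd
    have h2 : Measurable fun x : X => ∫ s in Iic a, F (x, s) / F₁ x ∂(gaussianReal 0 1) :=
      StronglyMeasurable.measurable (StronglyMeasurable.integral_prod_right'
        (f := fun p : X × ℝ => F p / F₁ p.1)
        ((hFm.div (hF₁m.comp measurable_fst)).stronglyMeasurable))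
    exact (hpos.inter (measurableSet_le h1 (h2.comp measurable_fst))).union
      (hpos.compl.inter (MeasurableSet.const _))
  refine ⟨S, hS, ?_, ?_⟩
  · refine Measure.ext fun A hA => ?_
    have hm : Measurable fun p : X × ℝ => (p.1, S p) := measurable_fst.prodMk hS
    rw [Measure.map_apply hm hA, Measure.prod_apply (hm hA), withDensity_apply _ hA,
      ← lintegral_indicator hA, lintegral_prod _ ((Measurable.indicator (by fun_prop) hA).aemeasurable),
      lintegral_withDensity_eq_lintegral_mul _ hF₁m.ennreal_ofReal (measurable_measure_prodMk_left (hm hA))]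
    refine lintegral_congr_ae ?_
    filter_upwards [hFi.prod_right_ae] with x hx
    change ENNReal.ofReal (F₁ x) * (gaussianReal 0 1) (Prod.mk x ⁻¹' ((fun p : X × ℝ => (p.1, S p)) ⁻¹' A)) = _
    have hAx : MeasurableSet (Prod.mk x ⁻¹' A) := measurable_prodMk_left hA
    have hR : ∫⁻ s, A.indicator (fun p => ENNReal.ofReal (F p)) (x, s) ∂(gaussianReal 0 1)
        = ∫⁻ s in Prod.mk x ⁻¹' A, ENNReal.ofReal (F (x, s)) ∂(gaussianReal 0 1) := by
      rw [← lintegral_indicator hAx]; rfl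
    rw [hR]
    rcases (hF₁0 x).eq_or_lt with h0 | h0
    · rw [← h0, ENNReal.ofReal_zero, zero_mul]
      have hz : ∫⁻ s, ENNReal.ofReal (F (x, s)) ∂(gaussianReal 0 1) = 0 := by
        rw [← ofReal_integral_eq_lintegral_ofReal hx (ae_of_all _ fun s => hF _)]
        change ENNReal.ofReal (F₁ x) = 0
        rw [← h0, ENNReal.ofReal_zero]
      exact (le_antisymm ((setLIntegral_le_lintegral _ _).trans hz.le) bot_le).symm
    · obtain ⟨h1, h2, h3⟩ := hgoodn x h0
      have hq := map_quantileMap h1 h2 h3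
      have e : Prod.mk x ⁻¹' ((fun p : X × ℝ => (p.1, S p)) ⁻¹' A)
          = quantileMap (fun s => F (x, s) / F₁ x) ⁻¹' (Prod.mk x ⁻¹' A) := by
        ext y; simp only [mem_preimage, hSeq x h0]
      rw [e, ← Measure.map_apply (monotone_quantileMap h1 h2 h3).measurable hAx, hq,
        withDensity_apply _ hAx, ← lintegral_const_mul _ (by fun_prop)]
      refine lintegral_congr fun s => ?_
      rw [← ENNReal.ofReal_mul h0.le, mul_div_cancel₀ _ h0.ne']
  · obtain ⟨hi1, hle⟩ := condEntropy_nonneg hF hFi hFl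
    have hgi : Integrable (fun x => 2 * (∫ s, F (x, s) * Real.log (F (x, s)) ∂(gaussianReal 0 1)
        - (∫ s, F (x, s) ∂(gaussianReal 0 1)) * Real.log (∫ s, F (x, s) ∂(gaussianReal 0 1)))) μ :=
      (hFl.integral_prod_left.sub hi1).const_mul 2
    rw [lintegral_withDensity_eq_lintegral_mul _ hF₁m.ennreal_ofReal
      (Measurable.lintegral_prod_right' (f := fun p : X × ℝ => ENNReal.ofReal ((S p - p.2) ^ 2))
        (by fun_prop)), integral_prod _ hFl, ← integral_sub hFl.integral_prod_left hi1,
      ← integral_const_mul, ofReal_integral_eq_lintegral_ofReal hgi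
        (by filter_upwards [hle] with x hx; simp only [Pi.zero_apply]; linarith)]
    refine lintegral_mono_ae ?_
    filter_upwards [hFl.prod_right_ae, hle] with x hx hxle
    simp only [Pi.mul_apply]
    change ENNReal.ofReal (F₁ x) * _ ≤ ENNReal.ofReal (2 * (_ - F₁ x * Real.log (F₁ x)))
    rcases (hF₁0 x).eq_or_lt with h0 | h0
    · rw [← h0]; simp
    · obtain ⟨h1, h2, h3⟩ := hgoodn x h0
      -- Normalizing a fibre splits its entropy into the conditional part and the part of the
      -- marginal, which is the chain rule for entropy.
      have e1 : ∀ s, F (x, s) / F₁ x * Real.log (F (x, s) / F₁ x)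
          = (F₁ x)⁻¹ * (F (x, s) * Real.log (F (x, s))) - Real.log (F₁ x) / F₁ x * F (x, s) := by
        intro s
        rcases (hF (x, s)).eq_or_lt with h | h
        · rw [← h]; simp
        · rw [Real.log_div h.ne' h0.ne']; field_simp
      have h4 : Integrable (fun s => F (x, s) / F₁ x * Real.log (F (x, s) / F₁ x)) (gaussianReal 0 1) := by
        simp_rw [e1]
        exact (hx.const_mul _).sub ((hgood x h0).const_mul _)
      obtain ⟨ht1, ht2⟩ := talagrand_real h1 h2 h3 h4
      simp_rw [e1] at ht2
      rw [integral_sub (hx.const_mul _) ((hgood x h0).const_mul _), integral_const_mul,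
        integral_const_mul] at ht2
      simp_rw [hSeq x h0]
      rw [← ofReal_integral_eq_lintegral_ofReal ht1 (ae_of_all _ fun _ => sq_nonneg _),
        ← ENNReal.ofReal_mul h0.le]
      refine ENNReal.ofReal_le_ofReal ?_
      calc _ ≤ F₁ x * (2 * ((F₁ x)⁻¹ * ∫ s, F (x, s) * Real.log (F (x, s)) ∂(gaussianReal 0 1)
            - Real.log (F₁ x) / F₁ x * ∫ s, F (x, s) ∂(gaussianReal 0 1))) := by gcongr
        _ = F₁ x * (2 * ((F₁ x)⁻¹ * ∫ s, F (x, s) * Real.log (F (x, s)) ∂(gaussianReal 0 1)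
            - Real.log (F₁ x) / F₁ x * F₁ x)) := rfl
        _ = _ := by field_simp

end Conditioning

/-! ### Talagrand's inequality in dimension `n`. -/

section Tensorization

/-- Talagrand's transport inequality for the standard Gaussian measure on `ℝⁿ`. -/
lemma talagrand_pi (n : ℕ) : ∀ f : (Fin n → ℝ) → ℝ, Measurable f → (∀ x, 0 ≤ f x) →
    Integrable f (Measure.pi fun _ => gaussianReal 0 1) →
    ∫ x, f x ∂(Measure.pi fun _ => gaussianReal 0 1) = 1 →
    Integrable (fun x => f x * Real.log (f x)) (Measure.pi fun _ => gaussianReal 0 1) →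
    ∃ π : Measure ((Fin n → ℝ) × (Fin n → ℝ)), IsProbabilityMeasure π ∧
      π.map Prod.fst = (Measure.pi fun _ => gaussianReal 0 1).withDensity (fun x => ENNReal.ofReal (f x)) ∧
      π.map Prod.snd = Measure.pi (fun _ => gaussianReal 0 1) ∧
      ∫⁻ p, ENNReal.ofReal (∑ i, (p.1 i - p.2 i) ^ 2) ∂π
        ≤ ENNReal.ofReal (2 * ∫ x, f x * Real.log (f x) ∂(Measure.pi fun _ => gaussianReal 0 1)) := by
  induction n with
  | zero =>
    intro f hfm hf hfi hf1 hfl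
    have hp := isProbabilityMeasure_withDensity_ofReal hf hfi hf1
    refine ⟨((Measure.pi fun _ => gaussianReal 0 1).withDensity (fun x => ENNReal.ofReal (f x))).prod
      (Measure.pi fun _ => gaussianReal 0 1), inferInstance, ?_, ?_, by simp⟩
    · exact measurePreserving_fst.map_eq
    · exact measurePreserving_snd.map_eq
  | succ n ih =>
    intro f hfm hf hfi hf1 hfl
    let e := MeasurableEquiv.piFinSuccAbove (fun _ : Fin (n + 1) => ℝ) 0
    have he := measurePreserving_piFinSuccAbove (fun _ : Fin (n + 1) => gaussianReal 0 1) 0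
    have hes := he.symm
    let swap : (Fin n → ℝ) × ℝ → (Fin (n + 1) → ℝ) := fun p => e.symm (p.2, p.1)
    set γn : Measure (Fin n → ℝ) := Measure.pi fun _ => gaussianReal 0 1 with hγn
    have hsw : MeasurePreserving swap (γn.prod (gaussianReal 0 1))
        (Measure.pi fun _ : Fin (n + 1) => gaussianReal 0 1) :=
      hes.comp Measure.measurePreserving_swap
    have hsm : Measurable swap := hsw.measurable
    have hint : ∀ g : (Fin (n + 1) → ℝ) → ℝ, Measurable g →
        ∫ p, g (swap p) ∂(γn.prod (gaussianReal 0 1)) = ∫ x, g x ∂(Measure.pi fun _ => gaussianReal 0 1) := by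
      intro g hg
      rw [← hsw.map_eq, integral_map hsm.aemeasurable hg.aestronglyMeasurable]
    set F : (Fin n → ℝ) × ℝ → ℝ := fun p => f (swap p) with hFdef
    have hFm : Measurable F := hfm.comp hsm
    have hF : ∀ p, 0 ≤ F p := fun p => hf _
    have hFi : Integrable F (γn.prod (gaussianReal 0 1)) := hsw.integrable_comp_of_integrable hfi
    have hFl : Integrable (fun p => F p * Real.log (F p)) (γn.prod (gaussianReal 0 1)) :=
      hsw.integrable_comp_of_integrable hfl
    obtain ⟨S, hS, hSmap, hScost⟩ := exists_fiber_transport hFm hF hFi hFl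
    obtain ⟨hi1, hle⟩ := condEntropy_nonneg hF hFi hFl
    set F₁ : (Fin n → ℝ) → ℝ := fun x => ∫ s, F (x, s) ∂(gaussianReal 0 1) with hF₁
    have hF₁m : Measurable F₁ := hFm.stronglyMeasurable.integral_prod_right'.measurable
    have hF₁0 : ∀ x, 0 ≤ F₁ x := fun x => integral_nonneg fun s => hF _
    have hF₁1 : ∫ x, F₁ x ∂γn = 1 := by
      rw [← hf1, ← hint f hfm, integral_prod _ hFi]
    obtain ⟨π, hπp, hπ1, hπ2, hπc⟩ := ih F₁ hF₁m hF₁0 hFi.integral_prod_left hF₁1 hi1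
    -- The marginals on the first `n` coordinates are coupled by induction; one shared Gaussian `s`
    -- serves as last coordinate of the target and, through the quantile map of the fibre over `x`,
    -- of the source. Costs add, and so do marginal and conditional entropies.
    let Θ : ((Fin n → ℝ) × (Fin n → ℝ)) × ℝ → (Fin (n + 1) → ℝ) × (Fin (n + 1) → ℝ) :=
      fun p => (swap (p.1.1, S (p.1.1, p.2)), swap (p.1.2, p.2))
    have hΘ : Measurable Θ := by fun_prop
    have hprod1 : (π.prod (gaussianReal 0 1)).map (fun p => (p.1.1, p.2))
        = (γn.withDensity fun x => ENNReal.ofReal (F₁ x)).prod (gaussianReal 0 1) := by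
      have := Measure.map_prod_map π (gaussianReal 0 1) measurable_fst measurable_id
      rw [hπ1, Measure.map_id] at this
      exact this.symm
    have hprod2 : (π.prod (gaussianReal 0 1)).map (fun p => (p.1.2, p.2))
        = γn.prod (gaussianReal 0 1) := by
      have := Measure.map_prod_map π (gaussianReal 0 1) measurable_snd measurable_id
      rw [hπ2, Measure.map_id] at this
      exact this.symm
    refine ⟨(π.prod (gaussianReal 0 1)).map Θ, Measure.isProbabilityMeasure_map hΘ.aemeasurable, ?_, ?_, ?_⟩
    · rw [Measure.map_map measurable_fst hΘ]
      have e1 : Prod.fst ∘ Θ = swap ∘ (fun p : (Fin n → ℝ) × ℝ => (p.1, S p))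
          ∘ (fun p : ((Fin n → ℝ) × (Fin n → ℝ)) × ℝ => (p.1.1, p.2)) := rfl
      have hm : Measurable fun p : (Fin n → ℝ) × ℝ => (p.1, S p) := measurable_fst.prodMk hS
      have hq : Measurable fun p : ((Fin n → ℝ) × (Fin n → ℝ)) × ℝ => (p.1.1, p.2) := by fun_prop
      rw [e1, ← Measure.map_map hsm (hm.comp hq), ← Measure.map_map hm hq, hprod1, hSmap]
      refine Measure.ext fun A hA => ?_
      rw [Measure.map_apply hsm hA, withDensity_apply _ (hsm hA), withDensity_apply _ hA]
      exact hsw.setLIntegral_comp_preimage hA hfm.ennreal_ofReal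
    · rw [Measure.map_map measurable_snd hΘ]
      have e1 : Prod.snd ∘ Θ = swap ∘ (fun p : ((Fin n → ℝ) × (Fin n → ℝ)) × ℝ => (p.1.2, p.2)) := rfl
      have hq : Measurable fun p : ((Fin n → ℝ) × (Fin n → ℝ)) × ℝ => (p.1.2, p.2) := by fun_prop
      rw [e1, ← Measure.map_map hsm hq, hprod2, hsw.map_eq]
    · have hc : Measurable fun p : (Fin (n + 1) → ℝ) × (Fin (n + 1) → ℝ) =>
          ENNReal.ofReal (∑ i, (p.1 i - p.2 i) ^ 2) := by fun_prop
      rw [lintegral_map hc hΘ]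
      have e1 : ∀ p, ENNReal.ofReal (∑ i, ((Θ p).1 i - (Θ p).2 i) ^ 2)
          = ENNReal.ofReal (∑ i, (p.1.1 i - p.1.2 i) ^ 2) + ENNReal.ofReal ((S (p.1.1, p.2) - p.2) ^ 2) := by
        intro p
        rw [← ENNReal.ofReal_add (Finset.sum_nonneg fun _ _ => sq_nonneg _) (sq_nonneg _),
          Fin.sum_univ_succ, add_comm]
        rfl
      simp_rw [e1]
      rw [lintegral_add_left (by fun_prop)]
      have c1 : ∫⁻ p : ((Fin n → ℝ) × (Fin n → ℝ)) × ℝ, ENNReal.ofReal (∑ i, (p.1.1 i - p.1.2 i) ^ 2)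
          ∂(π.prod (gaussianReal 0 1)) = ∫⁻ p, ENNReal.ofReal (∑ i, (p.1 i - p.2 i) ^ 2) ∂π := by
        rw [lintegral_prod _ (by fun_prop)]
        simp
      have c2 : ∫⁻ p : ((Fin n → ℝ) × (Fin n → ℝ)) × ℝ, ENNReal.ofReal ((S (p.1.1, p.2) - p.2) ^ 2)
          ∂(π.prod (gaussianReal 0 1)) = ∫⁻ x, ∫⁻ y, ENNReal.ofReal ((S (x, y) - y) ^ 2) ∂(gaussianReal 0 1)
          ∂(γn.withDensity fun x => ENNReal.ofReal (F₁ x)) := by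
        have h := lintegral_map (μ := π.prod (gaussianReal 0 1))
          (f := fun p : (Fin n → ℝ) × ℝ => ENNReal.ofReal ((S p - p.2) ^ 2))
          (g := fun p : ((Fin n → ℝ) × (Fin n → ℝ)) × ℝ => (p.1.1, p.2)) (by fun_prop) (by fun_prop)
        rw [hprod1, lintegral_prod _ (by fun_prop)] at h
        exact h.symm
      rw [c1, c2, ← hint (fun x => f x * Real.log (f x)) (by fun_prop)]
      refine (add_le_add hπc hScost).trans ?_
      have hA : 0 ≤ ∫ x, F₁ x * Real.log (F₁ x) ∂γn := by
        have := integral_mul_log_le hF₁0 hFi.integral_prod_left hi1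
        rwa [hF₁1, Real.log_one, mul_zero] at this
      have hB : ∫ x, F₁ x * Real.log (F₁ x) ∂γn
          ≤ ∫ p, F p * Real.log (F p) ∂(γn.prod (gaussianReal 0 1)) := by
        rw [integral_prod _ hFl]
        exact integral_mono_ae hi1 hFl.integral_prod_left hle
      rw [← ENNReal.ofReal_add (by positivity) (by linarith)]
      refine ENNReal.ofReal_le_ofReal (le_of_eq ?_)
      ring

end Tensorization

/-! ### Subadditivity of entropy and the logarithmic Sobolev inequality in dimension `n`. -/

section Product

variable {X Y : Type*} [MeasurableSpace X] [MeasurableSpace Y] {μ : Measure X} {ν : Measure Y}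
  [IsProbabilityMeasure μ] [IsProbabilityMeasure ν] {F : X × Y → ℝ}

/-- If `F (log ∘ marginal)` is tested against the product measure, the fibre integrates out. -/
lemma integrable_mul_log_marginal (hFm : Measurable F) (hF : ∀ p, 0 ≤ F p)
    (hFi : Integrable F (μ.prod ν))
    (hi : Integrable (fun x => (∫ y, F (x, y) ∂ν) * Real.log (∫ y, F (x, y) ∂ν)) μ) :
    Integrable (fun p => F p * Real.log (∫ y, F (p.1, y) ∂ν)) (μ.prod ν) ∧
    ∫ p, F p * Real.log (∫ y, F (p.1, y) ∂ν) ∂(μ.prod ν)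
      = ∫ x, (∫ y, F (x, y) ∂ν) * Real.log (∫ y, F (x, y) ∂ν) ∂μ := by
  have hF₁m : Measurable fun x => ∫ y, F (x, y) ∂ν :=
    hFm.stronglyMeasurable.integral_prod_right'.measurable
  have h : Integrable (fun p => F p * Real.log (∫ y, F (p.1, y) ∂ν)) (μ.prod ν) := by
    have hm : Measurable fun p : X × Y => F p * Real.log (∫ y, F (p.1, y) ∂ν) :=
      hFm.mul ((hF₁m.comp measurable_fst).log)
    refine (integrable_prod_iff hm.aestronglyMeasurable).2 ⟨?_, ?_⟩
    · filter_upwards [hFi.prod_right_ae] with x hx using hx.mul_const _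
    · refine hi.abs.congr (ae_of_all _ fun x => ?_)
      simp only [norm_mul, Real.norm_eq_abs]
      rw [integral_mul_const, abs_mul, abs_of_nonneg (integral_nonneg fun y => hF (x, y))]
      simp_rw [abs_of_nonneg (hF _)]
  refine ⟨h, ?_⟩
  rw [integral_prod _ h]
  simp_rw [integral_mul_const]

/-- Subadditivity of entropy on a product of probability spaces. -/
lemma entropy_prod_le (hFm : Measurable F) (hF : ∀ p, 0 < F p) (hFi : Integrable F (μ.prod ν))
    (hFl : Integrable (fun p => F p * Real.log (F p)) (μ.prod ν)) :
    ∫ p, F p * Real.log (F p) ∂(μ.prod ν)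
        - (∫ p, F p ∂(μ.prod ν)) * Real.log (∫ p, F p ∂(μ.prod ν))
      ≤ ∫ x, (∫ y, F (x, y) * Real.log (F (x, y)) ∂ν
            - (∫ y, F (x, y) ∂ν) * Real.log (∫ y, F (x, y) ∂ν)) ∂μ
        + ∫ y, (∫ x, F (x, y) * Real.log (F (x, y)) ∂μ
            - (∫ x, F (x, y) ∂μ) * Real.log (∫ x, F (x, y) ∂μ)) ∂ν := by
  have hF' := fun p => (hF p).le
  obtain ⟨i1, -⟩ := condEntropy_nonneg hF' hFi hFl
  obtain ⟨j1, k1⟩ := integrable_mul_log_marginal hFm hF' hFi i1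
  have hFi' : Integrable (fun p : Y × X => F p.swap) (ν.prod μ) := hFi.swap
  have hFl' : Integrable (fun p : Y × X => F p.swap * Real.log (F p.swap)) (ν.prod μ) := hFl.swap
  obtain ⟨i2, -⟩ := condEntropy_nonneg (fun p => hF' p.swap) hFi' hFl'
  obtain ⟨j2, k2⟩ := integrable_mul_log_marginal (hFm.comp measurable_swap)
    (fun p => hF' p.swap) hFi' i2
  have j2' := j2.swap
  have k2' := integral_prod_swap (μ := ν) (ν := μ)
    (fun p : Y × X => F p.swap * Real.log (∫ x, F (x, p.1) ∂μ))
  simp only [Function.comp_def, Prod.swap_swap, Prod.fst_swap, Prod.swap_prod_mk] at i2 j2 k2 j2' k2'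
  rw [k2] at k2'
  set m := ∫ p, F p ∂(μ.prod ν) with hm
  have e2 : ∫ y, ∫ x, F (x, y) ∂μ ∂ν = m := by rw [hm, integral_prod_symm _ hFi]
  have e1 : ∫ x, ∫ y, F (x, y) ∂ν ∂μ = m := by rw [hm, integral_prod _ hFi]
  have hm0 : 0 < m := by
    rw [hm, integral_pos_iff_support_of_nonneg hF' hFi]
    have : Function.support F = univ := by ext p; simp [(hF p).ne']
    rw [this]; simp
  have pos1 : ∀ᵐ x ∂μ, 0 < ∫ y, F (x, y) ∂ν := by
    filter_upwards [hFi.prod_right_ae] with x hx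
    rw [integral_pos_iff_support_of_nonneg (fun y => hF' _) hx]
    have : Function.support (fun y => F (x, y)) = univ := by ext p; simp [(hF _).ne']
    rw [this]; simp
  have pos2 : ∀ᵐ y ∂ν, 0 < ∫ x, F (x, y) ∂μ := by
    filter_upwards [hFi.prod_left_ae] with y hx
    rw [integral_pos_iff_support_of_nonneg (fun x => hF' _) hx]
    have : Function.support (fun x => F (x, y)) = univ := by ext p; simp [(hF _).ne']
    rw [this]; simp
  have hmul : Integrable (fun p : X × Y => (∫ y, F (p.1, y) ∂ν) * (∫ x, F (x, p.2) ∂μ)) (μ.prod ν) :=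
    hFi.integral_prod_left.mul_prod hFi.integral_prod_right
  have emul : ∫ p : X × Y, (∫ y, F (p.1, y) ∂ν) * (∫ x, F (x, p.2) ∂μ) ∂(μ.prod ν) = m * m := by
    rw [integral_prod_mul (fun x => ∫ y, F (x, y) ∂ν) (fun y => ∫ x, F (x, y) ∂μ), e1, e2]
  -- Nonnegativity of the entropy of `F` relative to the product `F₁ F₂ / m` of its marginals, of
  -- the same mass `m`: Young's inequality with `b = log (F₁ F₂ / m)`.
  have key : ∫ p, (F p * Real.log (∫ y, F (p.1, y) ∂ν) + F p * Real.log (∫ x, F (x, p.2) ∂μ)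
      - Real.log m * F p + F p - m⁻¹ * ((∫ y, F (p.1, y) ∂ν) * (∫ x, F (x, p.2) ∂μ))) ∂(μ.prod ν)
      ≤ ∫ p, F p * Real.log (F p) ∂(μ.prod ν) := by
    refine integral_mono_ae ((((j1.add j2').sub (hFi.const_mul _)).add hFi).sub (hmul.const_mul _)) hFl ?_
    filter_upwards [measurePreserving_fst.quasiMeasurePreserving.ae pos1,
      measurePreserving_snd.quasiMeasurePreserving.ae pos2] with p h1 h2
    have h := mul_le_mul_log_sub_add_exp (hF' p) (Real.log ((∫ y, F (p.1, y) ∂ν) * (∫ x, F (x, p.2) ∂μ) / m))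
    rw [Real.exp_log (by positivity), Real.log_div (by positivity) hm0.ne',
      Real.log_mul h1.ne' h2.ne'] at h
    have : m⁻¹ * ((∫ y, F (p.1, y) ∂ν) * (∫ x, F (x, p.2) ∂μ))
      = (∫ y, F (p.1, y) ∂ν) * (∫ x, F (x, p.2) ∂μ) / m := by field_simp
    rw [this]
    nlinarith
  have c1 : Integrable (fun p => F p * Real.log (∫ y, F (p.1, y) ∂ν)
      + F p * Real.log (∫ x, F (x, p.2) ∂μ)) (μ.prod ν) := j1.add j2'
  have c2 : Integrable (fun p => F p * Real.log (∫ y, F (p.1, y) ∂ν)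
      + F p * Real.log (∫ x, F (x, p.2) ∂μ) - Real.log m * F p) (μ.prod ν) := c1.sub (hFi.const_mul _)
  have c3 : Integrable (fun p => F p * Real.log (∫ y, F (p.1, y) ∂ν)
      + F p * Real.log (∫ x, F (x, p.2) ∂μ) - Real.log m * F p + F p) (μ.prod ν) := c2.add hFi
  rw [integral_sub c3 (hmul.const_mul _), integral_add c2 hFi, integral_sub c1 (hFi.const_mul _),
    integral_add j1 j2', integral_const_mul,
    integral_const_mul, emul, k1, k2', ← hm] at key
  rw [integral_sub hFl.integral_prod_left i1, integral_sub hFl.integral_prod_right i2,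
    ← integral_prod _ hFl]
  have e3 : ∫ y, ∫ x, F (x, y) * Real.log (F (x, y)) ∂μ ∂ν = ∫ p, F p * Real.log (F p) ∂(μ.prod ν) := by
    rw [integral_prod_symm _ hFl]
  rw [e3]
  have : m⁻¹ * (m * m) = m := by field_simp
  rw [this] at key
  linarith

end Product

/-- The Gaussian logarithmic Sobolev inequality on `ℝⁿ`, in terms of partial derivatives. -/
lemma logSobolev_pi (n : ℕ) : ∀ (f : (Fin n → ℝ) → ℝ) (D : Fin n → (Fin n → ℝ) → ℝ), Measurable f →
    (∀ x, 0 < f x) → (∀ i x, HasDerivAt (fun t : ℝ => f (x + t • Pi.single i 1)) (D i x) 0) →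
    Integrable f (Measure.pi fun _ => gaussianReal 0 1) →
    Integrable (fun x => f x * Real.log (f x)) (Measure.pi fun _ => gaussianReal 0 1) →
    (∀ i, Integrable (fun x => D i x ^ 2 / f x) (Measure.pi fun _ => gaussianReal 0 1)) →
    ∫ x, f x * Real.log (f x) ∂(Measure.pi fun _ => gaussianReal 0 1)
      - (∫ x, f x ∂(Measure.pi fun _ => gaussianReal 0 1))
        * Real.log (∫ x, f x ∂(Measure.pi fun _ => gaussianReal 0 1))
      ≤ 1 / 2 * ∑ i, ∫ x, D i x ^ 2 / f x ∂(Measure.pi fun _ => gaussianReal 0 1) := by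
  induction n with
  | zero =>
    intro f D hfm hf hD hfi hfl hDi
    rw [Measure.pi_of_empty (fun _ : Fin 0 => gaussianReal 0 1) default]
    simp
  | succ n ih =>
    intro f D hfm hf hD hfi hfl hDi
    let e := MeasurableEquiv.piFinSuccAbove (fun _ : Fin (n + 1) => ℝ) 0
    have he := measurePreserving_piFinSuccAbove (fun _ : Fin (n + 1) => gaussianReal 0 1) 0
    let swap : (Fin n → ℝ) × ℝ → (Fin (n + 1) → ℝ) := fun p => e.symm (p.2, p.1)
    set γn : Measure (Fin n → ℝ) := Measure.pi fun _ => gaussianReal 0 1 with hγn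
    have hsw : MeasurePreserving swap (γn.prod (gaussianReal 0 1))
        (Measure.pi fun _ : Fin (n + 1) => gaussianReal 0 1) :=
      he.symm.comp Measure.measurePreserving_swap
    have hsm : Measurable swap := hsw.measurable
    have hint : ∀ g : (Fin (n + 1) → ℝ) → ℝ,
        Integrable g (Measure.pi fun _ : Fin (n + 1) => gaussianReal 0 1) →
        ∫ p, g (swap p) ∂(γn.prod (gaussianReal 0 1)) = ∫ x, g x ∂(Measure.pi fun _ => gaussianReal 0 1) := by
      intro g hg
      have h := hg.1
      rw [← hsw.map_eq] at h ⊢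
      rw [integral_map hsm.aemeasurable h]
    have hadd0 : ∀ x s (t : ℝ), swap (x, s + t) = swap (x, s) + t • Pi.single 0 1 := by
      intro x s t
      funext i
      refine Fin.cases ?_ (fun j => ?_) i
      · change s + t = s + t • (Pi.single 0 1 : Fin (n + 1) → ℝ) 0
        simp
      · change x j = x j + t • (Pi.single 0 1 : Fin (n + 1) → ℝ) j.succ
        simp
    have hadd : ∀ (x : Fin n → ℝ) s (t : ℝ) (i : Fin n), swap (x + t • Pi.single i 1, s)
        = swap (x, s) + t • Pi.single i.succ 1 := by
      intro x s t i
      funext k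
      refine Fin.cases ?_ (fun j => ?_) k
      · change s = s + t • (Pi.single i.succ 1 : Fin (n + 1) → ℝ) 0
        simp
      · change x j + t • (Pi.single i 1 : Fin n → ℝ) j
          = x j + t • (Pi.single i.succ 1 : Fin (n + 1) → ℝ) j.succ
        simp [Pi.single_apply]
    set F : (Fin n → ℝ) × ℝ → ℝ := fun p => f (swap p) with hFdef
    have hFm : Measurable F := hfm.comp hsm
    have hF : ∀ p, 0 < F p := fun p => hf _
    have hFi : Integrable F (γn.prod (gaussianReal 0 1)) := hsw.integrable_comp_of_integrable hfi
    have hFl : Integrable (fun p => F p * Real.log (F p)) (γn.prod (gaussianReal 0 1)) :=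
      hsw.integrable_comp_of_integrable hfl
    have hFD : ∀ i, Integrable (fun p => D i (swap p) ^ 2 / F p) (γn.prod (gaussianReal 0 1)) :=
      fun i => hsw.integrable_comp_of_integrable (hDi i)
    have hsub := entropy_prod_le hFm hF hFi hFl
    obtain ⟨i1, -⟩ := condEntropy_nonneg (fun p => (hF p).le) hFi hFl
    obtain ⟨i2, -⟩ := condEntropy_nonneg (F := fun p : ℝ × (Fin n → ℝ) => F p.swap)
      (fun p => (hF _).le) hFi.swap hFl.swap
    have hFl2 := hFl.swap.integral_prod_left
    simp only [Function.comp_def, Prod.swap_prod_mk] at i2 hFl2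
    have b1 : ∫ x, (∫ y, F (x, y) * Real.log (F (x, y)) ∂(gaussianReal 0 1)
        - (∫ y, F (x, y) ∂(gaussianReal 0 1)) * Real.log (∫ y, F (x, y) ∂(gaussianReal 0 1))) ∂γn
        ≤ ∫ x, 1 / 2 * ∫ y, D 0 (swap (x, y)) ^ 2 / F (x, y) ∂(gaussianReal 0 1) ∂γn := by
      refine integral_mono_ae (hFl.integral_prod_left.sub i1)
        ((hFD 0).integral_prod_left.const_mul _) ?_
      filter_upwards [hFi.prod_right_ae, hFl.prod_right_ae, (hFD 0).prod_right_ae] with x h1 h2 h3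
      refine logSobolev_real (f := fun s => F (x, s)) (fun s => ?_) (fun s => hF _) h1 h2 h3
      have h := (hD 0 (swap (x, s)))
      have h' := HasDerivAt.comp s (h₂ := fun t : ℝ => f (swap (x, s) + t • Pi.single 0 1))
        (h := fun u : ℝ => u - s) (h₂' := D 0 (swap (x, s))) (by simpa using h)
        ((hasDerivAt_id s).sub_const s)
      rw [mul_one] at h'
      refine h'.congr_of_eventuallyEq (Eventually.of_forall fun u => ?_)
      simp only [Function.comp_def, ← hadd0, hFdef, add_sub_cancel]
    have b2 : ∫ y, (∫ x, F (x, y) * Real.log (F (x, y)) ∂γn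
        - (∫ x, F (x, y) ∂γn) * Real.log (∫ x, F (x, y) ∂γn)) ∂(gaussianReal 0 1)
        ≤ ∫ y, 1 / 2 * ∑ i : Fin n, ∫ x, D i.succ (swap (x, y)) ^ 2 / F (x, y) ∂γn ∂(gaussianReal 0 1) := by
      have hd : ∀ i, Integrable (fun y => ∫ x, D i (swap (x, y)) ^ 2 / F (x, y) ∂γn) (gaussianReal 0 1) :=
        fun i => (hFD i).integral_prod_right
      refine integral_mono_ae (hFl2.sub i2) ((integrable_finsetSum _ fun i _ => hd i.succ).const_mul _) ?_
      have h3 : ∀ᵐ y ∂(gaussianReal 0 1), ∀ i : Fin n,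
          Integrable (fun x => D i.succ (swap (x, y)) ^ 2 / F (x, y)) γn :=
        ae_all_iff.2 fun i => (hFD i.succ).prod_left_ae
      filter_upwards [hFi.prod_left_ae, hFl.prod_left_ae, h3] with y h1 h2 h3
      refine ih (fun x => F (x, y)) (fun i x => D i.succ (swap (x, y)))
        (hFm.comp (by fun_prop)) (fun x => hF _) (fun i x => ?_) h1 h2 h3
      simp only [hFdef, hadd]
      exact hD i.succ (swap (x, y))
    rw [integral_const_mul] at b1
    rw [integral_const_mul, integral_finsetSum _ fun i _ => (hFD i.succ).integral_prod_right] at b2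
    rw [← integral_prod _ (hFD 0), hint (fun x => D 0 x ^ 2 / f x) (hDi 0)] at b1
    have b3 : ∀ i : Fin n, ∫ y, ∫ x, D i.succ (swap (x, y)) ^ 2 / F (x, y) ∂γn ∂(gaussianReal 0 1)
        = ∫ x, D i.succ x ^ 2 / f x ∂(Measure.pi fun _ => gaussianReal 0 1) := fun i => by
      rw [← integral_prod_symm _ (hFD i.succ), hint (fun x => D i.succ x ^ 2 / f x) (hDi i.succ)]
    simp_rw [b3] at b2
    rw [hint f hfi, hint (fun x => f x * Real.log (f x)) hfl] at hsub
    rw [Fin.sum_univ_succ, mul_add]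
    linarith

/-- The Gaussian logarithmic Sobolev inequality on Euclidean space. -/
lemma logSobolev_gauss {n : ℕ} {f : E n → ℝ} {D : Fin n → E n → ℝ} (hfm : Measurable f)
    (hf : ∀ x, 0 < f x)
    (hD : ∀ i x, HasDerivAt (fun t : ℝ => f (x + t • EuclideanSpace.single i 1)) (D i x) 0)
    (hfi : Integrable f (gauss n)) (hfl : Integrable (fun x => f x * Real.log (f x)) (gauss n))
    (hDi : ∀ i, Integrable (fun x => D i x ^ 2 / f x) (gauss n)) :
    ∫ x, f x * Real.log (f x) ∂(gauss n) - (∫ x, f x ∂(gauss n)) * Real.log (∫ x, f x ∂(gauss n))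
      ≤ 1 / 2 * ∑ i, ∫ x, D i x ^ 2 / f x ∂(gauss n) := by
  have hmp : MeasurePreserving (WithLp.toLp 2) (Measure.pi fun _ : Fin n => gaussianReal 0 1) (gauss n) :=
    ⟨by fun_prop, map_pi_eq_stdGaussian⟩
  have hint : ∀ g : E n → ℝ, Integrable g (gauss n) →
      ∫ x, g x ∂(gauss n) = ∫ p, g (WithLp.toLp 2 p) ∂(Measure.pi fun _ : Fin n => gaussianReal 0 1) := by
    intro g hg
    have h := hg.1
    rw [← hmp.map_eq] at h ⊢
    rw [integral_map hmp.measurable.aemeasurable h]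
  rw [hint _ hfi, hint _ hfl]
  simp_rw [fun i => hint _ (hDi i)]
  refine logSobolev_pi n (fun p => f (WithLp.toLp 2 p)) (fun i p => D i (WithLp.toLp 2 p))
    (hfm.comp hmp.measurable) (fun p => hf _) (fun i p => ?_) (hmp.integrable_comp_of_integrable hfi)
    (hmp.integrable_comp_of_integrable hfl) (fun i => hmp.integrable_comp_of_integrable (hDi i))
  exact hD i (WithLp.toLp 2 p)

/-! ### Entropy loss along the flow and finiteness of entropy. -/

section LocalInequality

variable {n : ℕ} {f : E n → ℝ}

/-- The local logarithmic Sobolev inequality: the entropy lost under the Ornstein-Uhlenbeck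
operator is controlled by the Fisher information. -/
lemma entropy_le_entropy_mehler_add {D : Fin n → E n → ℝ} (hfm : Measurable f) (hf : ∀ x, 0 < f x)
    (hD : ∀ i x, HasDerivAt (fun t : ℝ => f (x + t • EuclideanSpace.single i 1)) (D i x) 0)
    (hfi : Integrable f (gauss n)) (hfl : Integrable (fun x => f x * Real.log (f x)) (gauss n))
    (hDi : ∀ i, Integrable (fun x => D i x ^ 2 / f x) (gauss n)) {r : ℝ} (h0 : 0 < r) (h1 : r < 1) :
    ∫ x, f x * Real.log (f x) ∂(gauss n)
      ≤ ∫ x, mehler r f x * Real.log (mehler r f x) ∂(gauss n)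
        + (1 - r ^ 2) / 2 * ∑ i, ∫ x, D i x ^ 2 / f x ∂(gauss n) := by
  have hs := (one_sub_sq_mem h0 h1).1
  obtain ⟨hml, -⟩ := entropy_mehler_le h0 h1 (fun x => (hf x).le) hfi hfl
  have hi1 := integrable_mehler h0.le h1.le hfl
  have hi2 := fun i => integrable_mehler h0.le h1.le (hDi i)
  have key : ∫ y, (mehler r (fun x => f x * Real.log (f x)) y - mehler r f y * Real.log (mehler r f y)) ∂(gauss n)
      ≤ ∫ y, (1 - r ^ 2) / 2 * ∑ i, mehler r (fun x => D i x ^ 2 / f x) y ∂(gauss n) := by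
    refine integral_mono (hi1.sub hml) ((integrable_finsetSum _ fun i _ => hi2 i).const_mul _) fun y => ?_
    have e : ∀ i x, (√(1 - r ^ 2) * D i x) ^ 2 / f x = (1 - r ^ 2) * (D i x ^ 2 / f x) := by
      intro i x; rw [mul_pow, Real.sq_sqrt hs.le]; ring
    -- The logarithmic Sobolev inequality for the noise variable `z` in Mehler's formula at fixed
    -- `y`; the chain rule contributes `√(1 - r²)`, squared in the Fisher term.
    have h := logSobolev_gauss (f := fun z => f (r • y + √(1 - r ^ 2) • z))
      (D := fun i z => √(1 - r ^ 2) * D i (r • y + √(1 - r ^ 2) • z))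
      (hfm.comp (by fun_prop)) (fun z => hf _) (fun i z => ?_)
      (integrable_mehler_section h0 h1 hfi y) (integrable_mehler_section h0 h1 hfl y)
      (fun i => by
        simp_rw [e]
        exact (integrable_mehler_section h0 h1 (hDi i) y).const_mul _)
    · simp_rw [e] at h
      simp_rw [integral_const_mul] at h
      rw [← Finset.mul_sum] at h
      simp only [mehler]
      refine h.trans (le_of_eq ?_)
      ring
    · have h2 := HasDerivAt.comp (0 : ℝ) (h := fun t : ℝ => √(1 - r ^ 2) * t)
        (h₂ := fun t : ℝ => f (r • y + √(1 - r ^ 2) • z + t • EuclideanSpace.single i 1))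
        (h₂' := D i (r • y + √(1 - r ^ 2) • z)) (by simpa using hD i (r • y + √(1 - r ^ 2) • z))
        ((hasDerivAt_id (0 : ℝ)).const_mul (√(1 - r ^ 2)))
      rw [mul_one, mul_comm] at h2
      refine h2.congr_of_eventuallyEq (Eventually.of_forall fun t => ?_)
      simp only [Function.comp_def, smul_add, smul_smul, add_assoc]
  rw [integral_sub hi1 hml, integral_mehler h0.le h1.le hfl, integral_const_mul,
    integral_finsetSum _ fun i _ => hi2 i] at key
  simp_rw [fun i => integral_mehler h0.le h1.le (hDi i)] at key
  linarith

lemma integrable_mehler_mul_sq (hfm : Measurable f) (hfi : Integrable f (gauss n))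
    (hsq : Integrable (fun x => f x * ‖x‖ ^ 2) (gauss n)) {ρ : ℝ} (h0 : 0 < ρ) (h1 : ρ < 1) :
    Integrable (fun x => mehler ρ f x * ‖x‖ ^ 2) (gauss n) := by
  set σ := √(1 - ρ ^ 2)
  have hsq1 : Integrable (fun x : E n => ‖x‖ ^ 2) (gauss n) :=
    (memLp_two_iff_integrable_sq_norm (by fun_prop)).1 IsGaussian.memLp_two_id
  -- In the rotated variables `X = ρx + σz`, `Y = -σx + ρz` one has `x = ρX - σY`, so the second
  -- moments of `f γ` and of `γ` suffice.
  have hH : Integrable (fun p : E n × E n => f p.1 * ‖ρ • p.1 - σ • p.2‖ ^ 2) ((gauss n).prod (gauss n)) := by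
    have i1 : Integrable (fun p : E n × E n => f p.1 * ‖p.1‖ ^ 2) ((gauss n).prod (gauss n)) :=
      hsq.comp_fst _
    have i2 : Integrable (fun p : E n × E n => f p.1 * ‖p.2‖ ^ 2) ((gauss n).prod (gauss n)) :=
      hfi.mul_prod hsq1
    refine ((i1.abs.const_mul (2 * ρ ^ 2)).add (i2.abs.const_mul (2 * σ ^ 2))).mono'
      (Measurable.aestronglyMeasurable (by fun_prop)) (ae_of_all _ fun p => ?_)
    simp only [Pi.add_apply, Real.norm_eq_abs, abs_mul, abs_pow, abs_norm]
    have hn : ‖ρ • p.1 - σ • p.2‖ ≤ |ρ| * ‖p.1‖ + |σ| * ‖p.2‖ := by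
      refine (norm_sub_le _ _).trans ?_
      rw [norm_smul, norm_smul, Real.norm_eq_abs, Real.norm_eq_abs]
    have h2 : ‖ρ • p.1 - σ • p.2‖ ^ 2 ≤ 2 * ρ ^ 2 * ‖p.1‖ ^ 2 + 2 * σ ^ 2 * ‖p.2‖ ^ 2 := by
      refine (pow_le_pow_left₀ (norm_nonneg _) hn 2).trans ?_
      rw [← sq_abs ρ, ← sq_abs σ]
      nlinarith [sq_nonneg (|ρ| * ‖p.1‖ - |σ| * ‖p.2‖)]
    calc |f p.1| * ‖ρ • p.1 - σ • p.2‖ ^ 2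
        ≤ |f p.1| * (2 * ρ ^ 2 * ‖p.1‖ ^ 2 + 2 * σ ^ 2 * ‖p.2‖ ^ 2) := by gcongr
      _ = _ := by ring
  have h := (measurePreserving_rotation (V := E n) (sq_add_sqrt_sq h0.le h1.le)).integrable_comp_of_integrable hH
  have h3 := h.integral_prod_left
  refine h3.congr (ae_of_all _ fun x => ?_)
  simp only [Function.comp_def]
  rw [mehler, ← integral_mul_const]
  refine integral_congr_ae (ae_of_all _ fun z => ?_)
  have hab := sq_add_sqrt_sq h0.le h1.le
  have e : ρ • (ρ • x + σ • z) - σ • (-σ • x + ρ • z) = x := by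
    have : ρ • (ρ • x + σ • z) - σ • (-σ • x + ρ • z) = (ρ ^ 2 + σ ^ 2) • x := by module
    rw [this, hab, one_smul]
  change f (ρ • x + σ • z) * ‖ρ • (ρ • x + σ • z) - σ • (-σ • x + ρ • z)‖ ^ 2
    = f (ρ • x + σ • z) * ‖x‖ ^ 2
  rw [e]

/-- `log (P_ρ f)` is at most quadratic and `P_ρ f` has second moments, so finite entropy of `f` is
not presupposed. -/
lemma integrable_entropy_mehler (hfm : Measurable f) (hf : ∀ x, 0 ≤ f x) (hfi : Integrable f (gauss n))
    (hsq : Integrable (fun x => f x * ‖x‖ ^ 2) (gauss n)) {ρ : ℝ} (h0 : 0 < ρ) (h1 : ρ < 1) :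
    Integrable (fun x => mehler ρ f x * Real.log (mehler ρ f x)) (gauss n) := by
  obtain ⟨C, hC, hle⟩ := exists_abs_mehler_le h0 h1 hfi
  have hmi := integrable_mehler h0.le h1.le hfi
  refine (((integrable_const 1).add (hmi.const_mul |Real.log C|)).add
    ((integrable_mehler_mul_sq hfm hfi hsq h0 h1).const_mul (1 / 2))).mono'
    (Real.continuous_mul_log.comp_aestronglyMeasurable hmi.1) (ae_of_all _ fun x => ?_)
  have hm := mehler_nonneg (ρ := ρ) hf x
  have hlow := neg_one_le_mul_log hm
  simp only [Pi.add_apply]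
  have hup : mehler ρ f x * Real.log (mehler ρ f x)
      ≤ |Real.log C| * mehler ρ f x + 1 / 2 * (mehler ρ f x * ‖x‖ ^ 2) := by
    rcases hm.eq_or_lt with h | h
    · rw [← h]; simp
    · have : Real.log (mehler ρ f x) ≤ Real.log C + ‖x‖ ^ 2 / 2 := by
        rw [Real.log_le_iff_le_exp h, Real.exp_add, Real.exp_log hC]
        exact (le_abs_self _).trans (hle x)
      have h2 := mul_le_mul_of_nonneg_left (this.trans (add_le_add_left (le_abs_self _) _)) hm
      linarith
  rw [Real.norm_eq_abs, abs_le]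
  have h3 : 0 ≤ |Real.log C| * mehler ρ f x := by positivity
  have h4 : 0 ≤ mehler ρ f x * ‖x‖ ^ 2 := by positivity
  constructor <;> linarith

end LocalInequality

/-! ### The constant `c(l)` as an integral. -/

section Constant

/-- This identifies `c(l)` with `∫₀¹ u / (u + l(1 - u)) du`, the total contraction of the Fisher
information in the time variable `u = ρ²`. -/
lemma exists_primitive {l : ℝ} (hl : 0 < l) : ∃ K : ℝ → ℝ, K 1 - K 0 = cConst l ∧
    ∀ u ∈ Icc (0 : ℝ) 1, HasDerivAt K (u / (u + l * (1 - u))) u := by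
  have hpos : ∀ u ∈ Icc (0 : ℝ) 1, 0 < u + l * (1 - u) := fun u hu => by
    rcases hu.1.eq_or_lt with h | h
    · rw [← h]; simpa using hl
    · have := mul_nonneg hl.le (sub_nonneg.2 hu.2)
      linarith
  by_cases h : l = 1
  · subst h
    refine ⟨fun u => u ^ 2 / 2, by simp [cConst], fun u hu => ?_⟩
    have := ((hasDerivAt_id u).pow 2).div_const 2
    convert! this using 1
    simp
  · have h' : 1 - l ≠ 0 := sub_ne_zero.2 (Ne.symm h)
    refine ⟨fun u => u / (1 - l) - l / (1 - l) ^ 2 * Real.log (u + l * (1 - u)), ?_, fun u hu => ?_⟩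
    · simp only [cConst, h, if_false]
      simp
      field_simp
    · have hd : HasDerivAt (fun u : ℝ => u + l * (1 - u)) (1 + l * (0 - 1)) u :=
        (hasDerivAt_id u).add (((hasDerivAt_const u (1 : ℝ)).sub (hasDerivAt_id u)).const_mul l)
      have := ((hasDerivAt_id u).div_const (1 - l)).sub ((hd.log (hpos u hu).ne').const_mul (l / (1 - l) ^ 2))
      convert! this using 1
      have := (hpos u hu).ne'
      field_simp
      ring

lemma contraction_mem {l u : ℝ} (hl : 0 < l) (h0 : 0 ≤ u) (h1 : u ≤ 1) :
    0 ≤ u / (u + l * (1 - u)) ∧ u / (u + l * (1 - u)) ≤ 1 := by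
  have h := mul_nonneg hl.le (sub_nonneg.2 h1)
  exact ⟨by positivity, div_le_one_of_le₀ (by linarith) (by positivity)⟩

lemma contraction_mono {l u v : ℝ} (hl : 0 < l) (h0 : 0 < u) (huv : u ≤ v) (h1 : v ≤ 1) :
    u / (u + l * (1 - u)) ≤ v / (v + l * (1 - v)) := by
  have a := mul_nonneg hl.le (sub_nonneg.2 h1)
  have b := mul_nonneg hl.le (sub_nonneg.2 (huv.trans h1))
  rw [div_le_div_iff₀ (by linarith) (by linarith)]
  nlinarith

/-- Lower Riemann sums of the contraction factor are dominated by increments of its primitive. -/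
lemma contraction_mul_sub_le {l : ℝ} (hl : 0 < l) {K : ℝ → ℝ}
    (hK : ∀ u ∈ Icc (0 : ℝ) 1, HasDerivAt K (u / (u + l * (1 - u))) u) {a b : ℝ} (ha : 0 < a) (hab : a ≤ b)
    (hb : b ≤ 1) : a / (a + l * (1 - a)) * (b - a) ≤ K b - K a := by
  refine (convex_Icc a b).mul_sub_le_image_sub_of_le_deriv
    (fun u hu => (hK u ⟨ha.le.trans hu.1, hu.2.trans hb⟩).continuousAt.continuousWithinAt)
    (fun u hu => ?_) (fun u hu => ?_) a (left_mem_Icc.2 hab) b (right_mem_Icc.2 hab) hab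
  · rw [interior_Icc] at hu
    exact (hK u ⟨ha.le.trans hu.1.le, hu.2.le.trans hb⟩).differentiableAt.differentiableWithinAt
  · rw [interior_Icc] at hu
    rw [(hK u ⟨ha.le.trans hu.1.le, hu.2.le.trans hb⟩).deriv]
    exact contraction_mono hl ha hu.1.le (hu.2.le.trans hb)

/-- The integrand takes values in `[0, 1]`. At `a = 1` this gives `c(l) ≤ 1`, hence the sign of
`c₂(l)`. -/
lemma primitive_sub_mem {l : ℝ} (hl : 0 < l) {K : ℝ → ℝ}
    (hK : ∀ u ∈ Icc (0 : ℝ) 1, HasDerivAt K (u / (u + l * (1 - u))) u) {a : ℝ} (ha : 0 ≤ a) (h1 : a ≤ 1) :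
    0 ≤ K a - K 0 ∧ K a - K 0 ≤ a := by
  have hc : ContinuousOn K (Icc 0 a) := fun u hu => (hK u ⟨hu.1, hu.2.trans h1⟩).continuousAt.continuousWithinAt
  have hd : DifferentiableOn ℝ K (interior (Icc 0 a)) := fun u hu => by
    rw [interior_Icc] at hu
    exact (hK u ⟨hu.1.le, hu.2.le.trans h1⟩).differentiableAt.differentiableWithinAt
  constructor
  · have := (convex_Icc 0 a).mul_sub_le_image_sub_of_le_deriv (C := 0) hc hd (fun u hu => ?_)
      0 (left_mem_Icc.2 ha) a (right_mem_Icc.2 ha) ha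
    · simpa using this
    · rw [interior_Icc] at hu
      rw [(hK u ⟨hu.1.le, hu.2.le.trans h1⟩).deriv]
      exact (contraction_mem hl hu.1.le (hu.2.le.trans h1)).1
  · have := (convex_Icc 0 a).image_sub_le_mul_sub_of_deriv_le (C := 1) hc hd (fun u hu => ?_)
      0 (left_mem_Icc.2 ha) a (right_mem_Icc.2 ha) ha
    · simpa using this
    · rw [interior_Icc] at hu
      rw [(hK u ⟨hu.1.le, hu.2.le.trans h1⟩).deriv]
      exact (contraction_mem hl hu.1.le (hu.2.le.trans h1)).2

lemma cConst_pos {l : ℝ} (hl : 0 < l) : 0 < cConst l := by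
  obtain ⟨K, hK1, hK⟩ := exists_primitive hl
  have h1 := contraction_mul_sub_le hl hK (a := 1 / 2) (b := 1) (by norm_num) (by norm_num) le_rfl
  have h2 := (primitive_sub_mem hl hK (a := 1 / 2) (by norm_num) (by norm_num)).1
  have h3 : 0 < (1 / 2 : ℝ) / (1 / 2 + l * (1 - 1 / 2)) * (1 - 1 / 2) := by
    norm_num
    positivity
  rw [← hK1]
  linarith

lemma cConst_le_one {l : ℝ} (hl : 0 < l) : cConst l ≤ 1 := by
  obtain ⟨K, hK1, hK⟩ := exists_primitive hl
  rw [← hK1]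
  exact (primitive_sub_mem hl hK zero_le_one le_rfl).2

end Constant

variable {n : ℕ} {f : E n → ℝ} {G : E n → E n}

/-! ### The improved logarithmic Sobolev inequality. -/

section EntropyBound

/-- The logarithmic Sobolev inequality improved by a Poincaré inequality, along the
Ornstein-Uhlenbeck flow. -/
lemma entropy_mehler_le_of_poincare {l : ℝ} (hl : 0 < l) (hfm : Measurable f) (hf : ∀ x, 0 ≤ f x)
    (hfi : Integrable f (gauss n)) (hf1 : ∫ x, f x ∂(gauss n) = 1)
    (hsq : Integrable (fun x => f x * ‖x‖ ^ 2) (gauss n))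
    (hpoin : SatisfiesPoincare ((gauss n).withDensity fun x => ENNReal.ofReal (f x)) l)
    (hG : HasWeakGradient f G) {D : Fin n → E n → ℝ}
    (hD : ∀ i x, D i x = inner ℝ (G x) (EuclideanSpace.single i 1))
    (hDi : ∀ i, Integrable (D i) (gauss n)) (hD0 : ∀ i, ∫ x, D i x ∂(gauss n) = 0)
    (hDz : ∀ i, ∀ᵐ x ∂(gauss n), f x = 0 → D i x = 0)
    (hDf : ∀ i, Integrable (fun x => D i x ^ 2 / f x) (gauss n)) {r : ℝ} (h0 : 0 < r) (h1 : r < 1) :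
    ∫ x, mehler r f x * Real.log (mehler r f x) ∂(gauss n)
      ≤ cConst l / 2 * ∑ i, ∫ x, D i x ^ 2 / f x ∂(gauss n) := by
  set I := ∑ i, ∫ x, D i x ^ 2 / f x ∂(gauss n) with hI
  have hI0 : 0 ≤ I := Finset.sum_nonneg fun i _ => integral_nonneg fun x => div_nonneg (sq_nonneg _) (hf x)
  obtain ⟨K, hK1, hK⟩ := exists_primitive hl
  have hD' : ∀ i, D i = fun x => inner ℝ (G x) (EuclideanSpace.single i 1) := fun i => funext (hD i)
  have hpos : ∀ {ρ : ℝ}, 0 < ρ → ρ < 1 → ∀ x, 0 < mehler ρ f x := fun a b x =>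
    mehler_pos a b hfi hf (by rw [hf1]; exact one_pos) x
  have hder : ∀ {ρ : ℝ}, 0 < ρ → ρ < 1 → ∀ i x,
      HasDerivAt (fun t : ℝ => mehler ρ f (x + t • EuclideanSpace.single i 1)) (ρ * mehler ρ (D i) x) 0 := by
    intro ρ a b i x
    rw [hD']
    exact hasDerivAt_mehler hG hfi (by rw [← hD']; exact hDi i) a b x
  have hfish : ∀ {ρ : ℝ}, 0 < ρ → ρ < 1 →
      (∀ i, Integrable (fun x => (ρ * mehler ρ (D i) x) ^ 2 / mehler ρ f x) (gauss n)) ∧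
      ∑ i, ∫ x, (ρ * mehler ρ (D i) x) ^ 2 / mehler ρ f x ∂(gauss n)
        ≤ ρ ^ 2 * (ρ ^ 2 / (ρ ^ 2 + l * (1 - ρ ^ 2))) * I := by
    intro ρ a b
    have e : ∀ i x, (ρ * mehler ρ (D i) x) ^ 2 / mehler ρ f x
        = ρ ^ 2 * (mehler ρ (D i) x ^ 2 / mehler ρ f x) := fun i x => by rw [mul_pow, mul_div_assoc]
    have h := fun i => fisher_contraction hl hfm hf hfi hf1 hpoin (hDi i) (hD0 i) (hDz i) (hDf i) a b
    simp_rw [e]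
    refine ⟨fun i => (h i).1.const_mul _, ?_⟩
    rw [hI, Finset.mul_sum]
    refine Finset.sum_le_sum fun i _ => ?_
    rw [integral_const_mul, mul_assoc]
    exact mul_le_mul_of_nonneg_left (h i).2 (sq_nonneg _)
  have hent := fun {ρ : ℝ} (a : 0 < ρ) (b : ρ < 1) => integrable_entropy_mehler hfm hf hfi hsq a b
  have hp0 : ∀ k : ℕ, 0 < r ^ (k + 1) := fun k => pow_pos h0 _
  have hp1 : ∀ k : ℕ, r ^ (k + 1) < 1 := fun k => pow_lt_one₀ h0.le h1 (Nat.succ_ne_zero k)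
  -- Indices start at `r¹`, not `r⁰`, so that each term is the entropy of a regularized density.
  set H : ℕ → ℝ := fun k => ∫ x, mehler (r ^ (k + 1)) f x * Real.log (mehler (r ^ (k + 1)) f x) ∂(gauss n)
    with hH
  have hstep : ∀ k, H k ≤ H (k + 1) + 1 / 2 * (K ((r ^ k) ^ 2) - K ((r ^ (k + 1)) ^ 2)) * I := by
    intro k
    obtain ⟨c1, c2⟩ := hfish (hp0 k) (hp1 k)
    have hcm := (continuous_mehler (hp0 k) (hp1 k) hfi).measurable
    have h := entropy_le_entropy_mehler_add hcm (hpos (hp0 k) (hp1 k)) (hder (hp0 k) (hp1 k))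
      (integrable_mehler (hp0 k).le (hp1 k).le hfi) (hent (hp0 k) (hp1 k)) c1 h0 h1
    simp_rw [mehler_mehler h0 h1 (hp0 k) (hp1 k) hfi, ← pow_succ'] at h
    refine h.trans (add_le_add le_rfl ?_)
    have hs := (one_sub_sq_mem h0 h1).1
    have hle1 : (r ^ k) ^ 2 ≤ 1 := pow_le_one₀ (by positivity) (pow_le_one₀ h0.le h1.le)
    have e1 : (r ^ (k + 1)) ^ 2 = r ^ 2 * (r ^ k) ^ 2 := by ring
    have hlt : (r ^ (k + 1)) ^ 2 ≤ (r ^ k) ^ 2 := by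
      rw [e1]
      exact mul_le_of_le_one_left (sq_nonneg _) (by linarith)
    have hR := contraction_mul_sub_le hl hK (pow_pos (hp0 k) 2) hlt hle1
    obtain ⟨κ0, -⟩ := contraction_mem hl (pow_pos (hp0 k) 2).le (hlt.trans hle1)
    set κ := (r ^ (k + 1)) ^ 2 / ((r ^ (k + 1)) ^ 2 + l * (1 - (r ^ (k + 1)) ^ 2))
    have h3 : (1 - r ^ 2) * ((r ^ (k + 1)) ^ 2 * κ) ≤ K ((r ^ k) ^ 2) - K ((r ^ (k + 1)) ^ 2) := by
      -- The loss over one step is `r² ≤ 1` times the term of the lower Riemann sum on `[r^(2k+2),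
      -- r^(2k)]`, the contraction factor being increasing. The bound therefore holds for each fixed
      -- `r`, with no refinement of the partition.
      refine le_trans ?_ hR
      have : (1 - r ^ 2) * ((r ^ (k + 1)) ^ 2 * κ) = r ^ 2 * (κ * ((r ^ k) ^ 2 - (r ^ (k + 1)) ^ 2)) := by
        rw [e1]; ring
      rw [this]
      exact mul_le_of_le_one_left (mul_nonneg κ0 (sub_nonneg.2 hlt)) (by linarith)
    calc (1 - r ^ 2) / 2 * _ ≤ (1 - r ^ 2) / 2 * ((r ^ (k + 1)) ^ 2 * κ * I) := by gcongr
      _ = 1 / 2 * ((1 - r ^ 2) * ((r ^ (k + 1)) ^ 2 * κ)) * I := by ring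
      _ ≤ _ := by gcongr
  have htel : ∀ N : ℕ, H 0 ≤ H N + 1 / 2 * (K 1 - K ((r ^ N) ^ 2)) * I := by
    intro N
    induction N with
    | zero => simp
    | succ N ih =>
      have := hstep N
      linarith
  -- The remaining entropy is controlled by the logarithmic Sobolev inequality itself, since the
  -- Fisher information decays at least like `ρ²`.
  have hlast : ∀ N, H N ≤ 1 / 2 * ((r ^ (N + 1)) ^ 2 * I) := by
    intro N
    obtain ⟨c1, c2⟩ := hfish (hp0 N) (hp1 N)
    have h := logSobolev_gauss (continuous_mehler (hp0 N) (hp1 N) hfi).measurable (hpos (hp0 N) (hp1 N))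
      (hder (hp0 N) (hp1 N)) (integrable_mehler (hp0 N).le (hp1 N).le hfi) (hent (hp0 N) (hp1 N)) c1
    rw [integral_mehler (hp0 N).le (hp1 N).le hfi, hf1, Real.log_one, mul_zero, sub_zero] at h
    refine h.trans ?_
    obtain ⟨κ0, κ1⟩ := contraction_mem hl (pow_pos (hp0 N) 2).le
      (pow_le_one₀ (hp0 N).le (hp1 N).le : (r ^ (N + 1)) ^ 2 ≤ 1)
    refine mul_le_mul_of_nonneg_left (c2.trans ?_) (by norm_num)
    refine mul_le_mul_of_nonneg_right ?_ hI0
    exact mul_le_of_le_one_right (sq_nonneg _) κ1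
  have hall : ∀ N : ℕ, H 0 ≤ 1 / 2 * ((r ^ (N + 1)) ^ 2 * I) + cConst l / 2 * I := by
    intro N
    have h2 := (primitive_sub_mem hl hK (a := (r ^ N) ^ 2) (by positivity)
      (pow_le_one₀ (by positivity) (pow_le_one₀ h0.le h1.le))).1
    have h3 : 1 / 2 * (K 1 - K ((r ^ N) ^ 2)) * I ≤ cConst l / 2 * I := by
      refine mul_le_mul_of_nonneg_right ?_ hI0
      rw [← hK1]; linarith
    linarith [htel N, hlast N]
  have hlim : Tendsto (fun N : ℕ => 1 / 2 * ((r ^ (N + 1)) ^ 2 * I) + cConst l / 2 * I) atTop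
      (𝓝 (1 / 2 * (0 ^ 2 * I) + cConst l / 2 * I)) := by
    have h := (tendsto_pow_atTop_nhds_zero_of_lt_one h0.le h1).comp (tendsto_add_atTop_nat 1)
    exact (((h.pow 2).mul_const I).const_mul _).add_const _
  have hfin := ge_of_tendsto' hlim hall
  simpa [hH] using hfin

/-- The logarithmic Sobolev inequality improved by a Poincaré inequality. -/
lemma entropy_le_of_poincare {l : ℝ} (hl : 0 < l) (hfm : Measurable f) (hf : ∀ x, 0 ≤ f x)
    (hfi : Integrable f (gauss n)) (hf1 : ∫ x, f x ∂(gauss n) = 1)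
    (hsq : Integrable (fun x => f x * ‖x‖ ^ 2) (gauss n))
    (hpoin : SatisfiesPoincare ((gauss n).withDensity fun x => ENNReal.ofReal (f x)) l)
    (hG : HasWeakGradient f G) {D : Fin n → E n → ℝ}
    (hD : ∀ i x, D i x = inner ℝ (G x) (EuclideanSpace.single i 1))
    (hDi : ∀ i, Integrable (D i) (gauss n)) (hD0 : ∀ i, ∫ x, D i x ∂(gauss n) = 0)
    (hDz : ∀ i, ∀ᵐ x ∂(gauss n), f x = 0 → D i x = 0)
    (hDf : ∀ i, Integrable (fun x => D i x ^ 2 / f x) (gauss n)) :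
    Integrable (fun x => f x * Real.log (f x)) (gauss n) ∧
    ∫ x, f x * Real.log (f x) ∂(gauss n) ≤ cConst l / 2 * ∑ i, ∫ x, D i x ^ 2 / f x ∂(gauss n) := by
  obtain ⟨r, hr0, hr1, -, hr⟩ := exists_seq_tendsto_one
  have hL := tendsto_integral_abs_mehler_sub (fun k => (hr0 k).le) (fun k => (hr1 k).le) hr hfi
  obtain ⟨φ, hφ, hae⟩ := exists_subseq_tendsto_ae
    (fun k => integrable_mehler (hr0 k).le (hr1 k).le hfi) hfi hL
  have hent := fun k => integrable_entropy_mehler hfm hf hfi hsq (hr0 k) (hr1 k)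
  -- Fatou's lemma needs a nonnegative integrand; adding `1` suffices because `a log a ≥ -1`.
  obtain ⟨h1, h2⟩ := integrable_of_tendsto_of_integral_le (μ := gauss n)
    (u := fun k x => mehler (r (φ k)) f x * Real.log (mehler (r (φ k)) f x) + 1)
    (F := fun x => f x * Real.log (f x) + 1)
    (c := cConst l / 2 * ∑ i, ∫ x, D i x ^ 2 / f x ∂(gauss n) + 1)
    (fun k => (hent (φ k)).add (integrable_const 1))
    (fun k => ae_of_all _ fun x => by linarith [neg_one_le_mul_log (mehler_nonneg (ρ := r (φ k)) hf x)])
    (by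
      filter_upwards [hae] with x hx
      exact ((Real.continuous_mul_log.tendsto _).comp hx).add_const 1)
    (fun k => by
      rw [integral_add (hent (φ k)) (integrable_const 1)]
      simpa using entropy_mehler_le_of_poincare hl hfm hf hfi hf1 hsq hpoin hG hD hDi hD0 hDz hDf
        (hr0 (φ k)) (hr1 (φ k)))
  have h3 : Integrable (fun x => f x * Real.log (f x)) (gauss n) :=
    (h1.sub (integrable_const 1)).congr (ae_of_all _ fun x => by simp)
  refine ⟨h3, ?_⟩
  rw [integral_add h3 (integrable_const 1)] at h2
  simpa using h2

end EntropyBound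

/-! ### Talagrand's inequality for `W₂`. -/

section Transport

/-- Talagrand's transport inequality for the standard Gaussian measure on Euclidean space. -/
lemma W2_le_of_entropy (hfm : Measurable f) (hf : ∀ x, 0 ≤ f x)
    (hfi : Integrable f (gauss n)) (hf1 : ∫ x, f x ∂(gauss n) = 1)
    (hfl : Integrable (fun x => f x * Real.log (f x)) (gauss n)) :
    W2 ((gauss n).withDensity fun x => ENNReal.ofReal (f x)) (gauss n)
      ≤ ENNReal.ofReal (2 * entropy f) ^ (1 / 2 : ℝ) := by
  have hmp : MeasurePreserving (WithLp.toLp 2) (Measure.pi fun _ : Fin n => gaussianReal 0 1) (gauss n) :=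
    ⟨by fun_prop, map_pi_eq_stdGaussian⟩
  have hm := hmp.measurable
  have hint : ∀ g : E n → ℝ, Integrable g (gauss n) →
      ∫ p, g (WithLp.toLp 2 p) ∂(Measure.pi fun _ : Fin n => gaussianReal 0 1) = ∫ x, g x ∂(gauss n) := by
    intro g hg
    have h := hg.1
    rw [← hmp.map_eq] at h ⊢
    rw [integral_map hm.aemeasurable h]
  obtain ⟨π, hπp, hπ1, hπ2, hπc⟩ := talagrand_pi n (fun p => f (WithLp.toLp 2 p)) (hfm.comp hm)
    (fun p => hf _) (hmp.integrable_comp_of_integrable hfi) (by rw [hint f hfi, hf1])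
    (hmp.integrable_comp_of_integrable hfl)
  have hmm : Measurable (Prod.map (WithLp.toLp 2) (WithLp.toLp 2) :
      (Fin n → ℝ) × (Fin n → ℝ) → E n × E n) := hm.prodMap hm
  have hcpl : IsCoupling (π.map (Prod.map (WithLp.toLp 2) (WithLp.toLp 2)))
      ((gauss n).withDensity fun x => ENNReal.ofReal (f x)) (gauss n) := by
    constructor
    · rw [Measure.map_map measurable_fst hmm]
      have e : Prod.fst ∘ (Prod.map (WithLp.toLp 2) (WithLp.toLp 2) :
        (Fin n → ℝ) × (Fin n → ℝ) → E n × E n) = WithLp.toLp 2 ∘ Prod.fst := rfl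
      rw [e, ← Measure.map_map hm measurable_fst, hπ1]
      refine Measure.ext fun A hA => ?_
      rw [Measure.map_apply hm hA, withDensity_apply _ (hm hA), withDensity_apply _ hA]
      exact hmp.setLIntegral_comp_preimage hA hfm.ennreal_ofReal
    · rw [Measure.map_map measurable_snd hmm]
      have e : Prod.snd ∘ (Prod.map (WithLp.toLp 2) (WithLp.toLp 2) :
        (Fin n → ℝ) × (Fin n → ℝ) → E n × E n) = WithLp.toLp 2 ∘ Prod.snd := rfl
      rw [e, ← Measure.map_map hm measurable_snd, hπ2, hmp.map_eq]
  rw [W2]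
  refine (iInf₂_le (π.map (Prod.map (WithLp.toLp 2) (WithLp.toLp 2))) hcpl).trans ?_
  refine ENNReal.rpow_le_rpow ?_ (by norm_num)
  rw [lintegral_map (by fun_prop) hmm]
  rw [hint (fun x => f x * Real.log (f x)) hfl] at hπc
  refine le_trans (le_of_eq (lintegral_congr fun p => ?_)) hπc
  rw [EuclideanSpace.real_norm_sq_eq]
  rfl

end Transport

/-! ### From the hypotheses on `ν` to the stability estimate. -/

variable {n : ℕ} {f : E n → ℝ} {G : E n → E n}

lemma HasWeakGradient.congr {g : E n → ℝ} (hG : HasWeakGradient f G) (h : f =ᵐ[volume] g) :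
    HasWeakGradient g G where
  locallyIntegrable := hG.locallyIntegrable.congr h
  locallyIntegrable_grad := hG.locallyIntegrable_grad
  integral_eq φ hφ hc v := by
    rw [← hG.integral_eq φ hφ hc v]
    refine integral_congr_ae ?_
    filter_upwards [h] with x hx
    rw [hx]

/-- A centred density satisfying a Poincaré inequality has second moments. -/
lemma integrable_mul_norm_sq {l : ℝ} (hl : 0 < l) (hfm : Measurable f) (hf : ∀ x, 0 ≤ f x)
    (hprob : IsProbabilityMeasure ((gauss n).withDensity fun x => ENNReal.ofReal (f x)))
    (hcent : IsCentered ((gauss n).withDensity fun x => ENNReal.ofReal (f x)))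
    (hpoin : SatisfiesPoincare ((gauss n).withDensity fun x => ENNReal.ofReal (f x)) l) :
    Integrable (fun x => f x * ‖x‖ ^ 2) (gauss n) := by
  set ν := (gauss n).withDensity fun x => ENNReal.ofReal (f x) with hν
  have hcoord : ∀ i : Fin n, Integrable (fun x : E n => x i ^ 2) ν := by
    intro i
    let L : E n →L[ℝ] ℝ := innerSL ℝ (EuclideanSpace.single i 1)
    have hL : ∀ x, L x = x i := fun x => by simp [L, EuclideanSpace.inner_single_left]
    have h0 : ∫ x, L x ∂ν = 0 := by rw [L.integral_comp_comm hcent.1, hcent.2, map_zero]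
    -- Coordinate functions are smooth, centered and have unit gradient, so the Poincaré inequality,
    -- stated in `[0, ∞]`, itself forces their second moments to be finite.
    have h := hpoin L L.contDiff (L.integrable_comp hcent.1) h0
    have hg : ∀ x, ‖gradient L x‖ = 1 := fun x => by
      rw [gradient, LinearIsometryEquiv.norm_map, L.fderiv, innerSL_apply_norm]
      simp
    simp only [hg, one_pow, ENNReal.ofReal_one, lintegral_const, measure_univ, mul_one] at h
    have hfin : ∫⁻ x, ENNReal.ofReal (L x ^ 2) ∂ν ≠ ⊤ := fun ht => by
      rw [ht, ENNReal.mul_top (by simpa using hl)] at h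
      simp at h
    have : Integrable (fun x => L x ^ 2) ν := by
      refine ⟨by fun_prop, ?_⟩
      rw [hasFiniteIntegral_iff_ofReal (ae_of_all _ fun x => sq_nonneg _)]
      exact hfin.lt_top
    simpa only [hL] using this
  have hsum : Integrable (fun x : E n => ‖x‖ ^ 2) ν := by
    simp_rw [EuclideanSpace.real_norm_sq_eq]
    exact integrable_finsetSum _ fun i _ => hcoord i
  rw [hν, integrable_withDensity_iff (by fun_prop) (by simp)] at hsum
  refine hsum.congr (ae_of_all _ fun x => ?_)
  simp only [ENNReal.toReal_ofReal (hf x), mul_comm]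

/-- Finite entropy and the improved logarithmic Sobolev inequality for a measurable density. -/
lemma entropy_le_fisherInfo {l : ℝ} (hl : 0 < l) (hfm : Measurable f) (hf : ∀ x, 0 ≤ f x)
    (hG : HasWeakGradient f G) (hfi : Integrable f (gauss n)) (hf1 : ∫ x, f x ∂(gauss n) = 1)
    (hprob : IsProbabilityMeasure ((gauss n).withDensity fun x => ENNReal.ofReal (f x)))
    (hcent : IsCentered ((gauss n).withDensity fun x => ENNReal.ofReal (f x)))
    (hpoin : SatisfiesPoincare ((gauss n).withDensity fun x => ENNReal.ofReal (f x)) l)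
    (hfisher : Integrable (fun x => ‖G x‖ ^ 2 / f x) (gauss n)) :
    Integrable (fun x => f x * Real.log (f x)) (gauss n) ∧ entropy f ≤ cConst l / 2 * fisherInfo f G := by
  have hsq := integrable_mul_norm_sq hl hfm hf hprob hcent hpoin
  set D : Fin n → E n → ℝ := fun i x => inner ℝ (G x) (EuclideanSpace.single i 1) with hDdef
  have hDG : ∀ i x, D i x = G x i := fun i x => by
    simp [hDdef, EuclideanSpace.inner_single_right]
  have hnorm : ∀ x, ‖G x‖ ^ 2 = ∑ i, D i x ^ 2 := fun x => by
    simp_rw [hDG]; exact EuclideanSpace.real_norm_sq_eq _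
  have hDm : ∀ i, AEStronglyMeasurable (D i) (gauss n) := fun i =>
    ((hG.locallyIntegrable_grad.aestronglyMeasurable.inner aestronglyMeasurable_const).mono_ac
      stdGaussian_absolutelyContinuous)
  have hDz : ∀ i, ∀ᵐ x ∂(gauss n), f x = 0 → D i x = 0 := fun i =>
    stdGaussian_absolutelyContinuous.ae_le (hG.ae_eq_zero hfm hf _)
  have hDf : ∀ i, Integrable (fun x => D i x ^ 2 / f x) (gauss n) := fun i => by
    refine hfisher.mono' (((hDm i).aemeasurable.pow_const 2).div hfi.1.aemeasurable).aestronglyMeasurable (ae_of_all _ fun x => ?_)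
    rw [Real.norm_of_nonneg (div_nonneg (sq_nonneg _) (hf x)), hnorm]
    exact div_le_div_of_nonneg_right
      (Finset.single_le_sum (f := fun i => D i x ^ 2) (fun j _ => sq_nonneg _) (Finset.mem_univ i)) (hf x)
  -- From `|D| ≤ D²/f + f` where `f > 0`; on `{f = 0}` the quotient is `0` by convention, and the
  -- vanishing of the weak gradient there is indispensable.
  have hDi : ∀ i, Integrable (D i) (gauss n) := fun i => by
    refine ((hDf i).add hfi).mono' (hDm i) ?_
    filter_upwards [hDz i] with x hx
    simp only [Pi.add_apply]
    rcases (hf x).eq_or_lt with h | h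
    · rw [hx h.symm]; simp [← h]
    · rw [Real.norm_eq_abs, div_add' _ _ _ h.ne', le_div_iff₀ h, ← sq_abs]
      nlinarith [sq_nonneg (|D i x| - f x), abs_nonneg (D i x), mul_nonneg (abs_nonneg (D i x)) h.le]
  have hxf : ∀ i : Fin n, Integrable (fun x => f x * inner ℝ x (EuclideanSpace.single i 1)) (gauss n) ∧
      ∫ x, f x * inner ℝ x (EuclideanSpace.single i (1 : ℝ)) ∂(gauss n) = 0 := fun i => by
    let L : E n →L[ℝ] ℝ := innerSL ℝ (EuclideanSpace.single i 1)
    have hL : ∀ x, L x = inner ℝ x (EuclideanSpace.single i 1) := fun x => by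
      rw [innerSL_apply_apply, real_inner_comm]
    have h1 := L.integrable_comp hcent.1
    have h2 : ∫ x, L x ∂((gauss n).withDensity fun x => ENNReal.ofReal (f x)) = 0 := by
      rw [L.integral_comp_comm hcent.1, hcent.2, map_zero]
    rw [integral_withDensity_gauss hfm hf] at h2
    rw [integrable_withDensity_iff (by fun_prop) (by simp)] at h1
    simp only [hL] at h1 h2
    refine ⟨h1.congr (ae_of_all _ fun x => ?_), h2⟩
    simp only [ENNReal.toReal_ofReal (hf x), mul_comm]
  have hD0 : ∀ i, ∫ x, D i x ∂(gauss n) = 0 := fun i => by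
    rw [hG.integral_gauss hfi (hDi i) (hxf i).1, (hxf i).2]
  have hI : fisherInfo f G = ∑ i, ∫ x, D i x ^ 2 / f x ∂(gauss n) := by
    rw [fisherInfo, ← integral_finsetSum _ fun i _ => hDf i]
    simp_rw [hnorm, Finset.sum_div]
  rw [hI]
  exact entropy_le_of_poincare hl hfm hf hfi hf1 hsq hpoin hG (fun i x => rfl) hDi hD0 hDz hDf

/-- The stability estimate for a measurable density. -/
lemma lsiDeficit_ge_of_measurable {l : ℝ} (hl : 0 < l) (hfm : Measurable f) (hf : ∀ x, 0 ≤ f x)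
    (hG : HasWeakGradient f G)
    (hprob : IsProbabilityMeasure ((gauss n).withDensity fun x => ENNReal.ofReal (f x)))
    (hcent : IsCentered ((gauss n).withDensity fun x => ENNReal.ofReal (f x)))
    (hpoin : SatisfiesPoincare ((gauss n).withDensity fun x => ENNReal.ofReal (f x)) l)
    (hfisher : Integrable (fun x => ‖G x‖ ^ 2 / f x) (gauss n)) :
    Integrable (fun x => f x * Real.log (f x)) (gauss n) ∧
    W2 ((gauss n).withDensity fun x => ENNReal.ofReal (f x)) (gauss n) ≠ ⊤ ∧
    c2Const l * (W2 ((gauss n).withDensity fun x => ENNReal.ofReal (f x)) (gauss n)).toReal ^ 2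
      ≤ lsiDeficit f G := by
  have hmass : ∫⁻ x, ENNReal.ofReal (f x) ∂(gauss n) = 1 := by
    have := hprob.measure_univ
    rwa [withDensity_apply _ MeasurableSet.univ, Measure.restrict_univ] at this
  have hfi : Integrable f (gauss n) := by
    refine ⟨hfm.aestronglyMeasurable, ?_⟩
    rw [hasFiniteIntegral_iff_ofReal (ae_of_all _ hf), hmass]
    exact ENNReal.one_lt_top
  have hf1 : ∫ x, f x ∂(gauss n) = 1 := by
    rw [integral_eq_lintegral_of_nonneg_ae (ae_of_all _ hf) hfi.1, hmass, ENNReal.toReal_one]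
  obtain ⟨hfl, hH⟩ := entropy_le_fisherInfo hl hfm hf hG hfi hf1 hprob hcent hpoin hfisher
  have hW := W2_le_of_entropy hfm hf hfi hf1 hfl
  set W := W2 ((gauss n).withDensity fun x => ENNReal.ofReal (f x)) (gauss n)
  have hH0 : 0 ≤ entropy f := by
    have := integral_mul_log_le hf hfi hfl
    rwa [hf1, Real.log_one, mul_zero] at this
  have hfin : ENNReal.ofReal (2 * entropy f) ^ (1 / 2 : ℝ) ≠ ⊤ :=
    ENNReal.rpow_ne_top_of_nonneg (by norm_num) ENNReal.ofReal_ne_top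
  refine ⟨hfl, ne_top_of_le_ne_top hfin hW, ?_⟩
  have hW2 : W.toReal ^ 2 ≤ 2 * entropy f := by
    have h := ENNReal.toReal_mono hfin hW
    rw [← ENNReal.toReal_rpow, ENNReal.toReal_ofReal (by positivity), ← Real.sqrt_eq_rpow] at h
    refine (pow_le_pow_left₀ ENNReal.toReal_nonneg h 2).trans (Real.sq_sqrt (by positivity)).le
  have hc0 := cConst_pos hl
  have hc1 : 1 ≤ 1 / cConst l := by rw [le_div_iff₀ hc0]; linarith [cConst_le_one hl]
  -- The deficit is at least `(1/c - 1) H`, and both `1/c - 1` and `H` are nonnegative, so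
  -- Talagrand's inequality may be inserted.
  have h2 : entropy f / cConst l ≤ 1 / 2 * fisherInfo f G := by
    rw [div_le_iff₀ hc0]; linarith
  rw [c2Const, lsiDeficit]
  calc 1 / 2 * (1 / cConst l - 1) * W.toReal ^ 2
      ≤ 1 / 2 * (1 / cConst l - 1) * (2 * entropy f) := by
        refine mul_le_mul_of_nonneg_left hW2 ?_
        linarith
    _ = entropy f / cConst l - entropy f := by ring
    _ ≤ _ := by linarith

end LSIStability

end

/-- Stability of the Gaussian logarithmic Sobolev inequality in the distance `W₂`, for centered
probability measures `ν = f γ` in the class `P(l)` with finite Fisher information. -/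
theorem mainTheorem4 (n : ℕ) (l : ℝ) (hl : 0 < l)
    (f : LSIStability.E n → ℝ) (G : LSIStability.E n → LSIStability.E n)
    (hf : ∀ x, 0 ≤ f x)
    (hG : LSIStability.HasWeakGradient f G)
    (ν : Measure (LSIStability.E n)) (hprob : IsProbabilityMeasure ν)
    (hν : ν = (LSIStability.gauss n).withDensity (fun x => ENNReal.ofReal (f x)))
    (hcent : LSIStability.IsCentered ν)
    (hpoin : LSIStability.SatisfiesPoincare ν l)
    (hfisher : Integrable (fun x => ‖G x‖ ^ 2 / f x) (LSIStability.gauss n)) :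
    Integrable (fun x => f x * Real.log (f x)) (LSIStability.gauss n) ∧
    LSIStability.W2 ν (LSIStability.gauss n) ≠ ⊤ ∧
    LSIStability.c2Const l * (LSIStability.W2 ν (LSIStability.gauss n)).toReal ^ 2
      ≤ LSIStability.lsiDeficit f G := by
  -- Local integrability makes `f` only almost everywhere measurable. A measurable nonnegative
  -- version changes neither `ν` nor any of the integrals, and keeps the same weak gradient.
  obtain ⟨g, hgm, hg0, hfg⟩ : ∃ g : LSIStability.E n → ℝ, Measurable g ∧ (∀ x, 0 ≤ g x) ∧ f =ᵐ[volume] g := by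
    have hm := hG.locallyIntegrable.aestronglyMeasurable
    refine ⟨fun x => max (hm.mk f x) 0, hm.stronglyMeasurable_mk.measurable.max measurable_const,
      fun x => le_max_right _ _, ?_⟩
    filter_upwards [hm.ae_eq_mk] with x hx
    rw [← hx, max_eq_left (hf x)]
  have hγ : f =ᵐ[LSIStability.gauss n] g := LSIStability.stdGaussian_absolutelyContinuous.ae_le hfg
  have hν' : ν = (LSIStability.gauss n).withDensity (fun x => ENNReal.ofReal (g x)) := by
    rw [hν]
    exact withDensity_congr_ae (hγ.mono fun x hx => by simp only [hx])
  have e1 : (fun x => ‖G x‖ ^ 2 / f x) =ᵐ[LSIStability.gauss n] fun x => ‖G x‖ ^ 2 / g x :=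
    hγ.mono fun x hx => by simp only [hx]
  have e2 : (fun x => f x * Real.log (f x)) =ᵐ[LSIStability.gauss n] fun x => g x * Real.log (g x) :=
    hγ.mono fun x hx => by simp only [hx]
  have e3 : LSIStability.lsiDeficit f G = LSIStability.lsiDeficit g G := by
    rw [LSIStability.lsiDeficit, LSIStability.lsiDeficit, LSIStability.fisherInfo,
      LSIStability.fisherInfo, LSIStability.entropy, LSIStability.entropy, integral_congr_ae e1,
      integral_congr_ae e2]
  subst hν'
  rw [e3, integrable_congr e2]
  exact LSIStability.lsiDeficit_ge_of_measurable hl hgm hg0 (hG.congr hfg) hprob hcent hpoin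
    (hfisher.congr e1)
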